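/- Let $k$ be a field of characteristic $p>0$, let $G$ be a finite group with normal subgroup $N$, and let $Q=G/N$. Write $\mathrm{Rep}_kG$ for the symmetric tensor category of finite-dimensional representations of $G$ over $k$. Let $\mathcal N$ be the ideal of negligible morphisms in $\mathrm{Rep}_kN$ (those $f:V\to W$ with $\mathrm{tr}(g\circ f)=0$ for all $g:W\to V$; it is the largest proper tensor ideal), let $\overline{\mathrm{Rep}_kN}=(\mathrm{Rep}_kN)/\mathcal N$ be the semisimplification, and let $\mathcal I_N$ be the preimage of $\mathcal N$ under restriction $\mathrm{Rep}_kG\to\mathrm{Rep}_kN$. Choose coset representatives $g_q\in G$, $q\in Q$. Then $Q$ acts on $\mathrm{Rep}_kN$ by symmetric tensor autoequivalences: $T_q$ sends $V$ to the same vector space on which $n\in N$ acts as $g_q^{-1}ng_q$ did on $V$, and $T_q\circ T_r\cong T_{qr}$ is $v\mapsto n_0v$, where $g_qg_r=g_{qr}n_0$ with $n_0\in N$. This action preserves $\mathcal N$, so it induces an action on $\overline{\mathrm{Rep}_kN}$; let $(\overline{\mathrm{Rep}_kN})^Q$ be its equivariantization, i.e. the symmetric monoidal category of objects $X$ with isomorphisms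 $u_q:T_qX\to X$ such that $u_{qr}$ corresponds to $u_q\circ T_q(u_r)$ under $T_qT_r\cong T_{qr}$. Sending a representation $V$ of $G$ to its restriction to $N$ with $u_q(v)=g_qv$ induces a symmetric $k$-linear monoidal functor $$\Phi:(\mathrm{Rep}_kG)/\mathcal I_N\longrightarrow(\overline{\mathrm{Rep}_kN})^Q .$$ **Theorem.** $\Phi$ is an abelian envelope. Here a pseudo-tensor category over $k$ is an essentially small, additive, idempotent complete, rigid $k$-linear monoidal category with finite-dimensional morphism spaces and $k\xrightarrow{\sim}\mathrm{End}(\mathbf 1)$; a tensor category over $k$ is an essentially small, abelian, rigid $k$-linear monoidal category with all objects of finite length and $k\xrightarrow{\sim}\mathrm{End}(\mathbf 1)$; a tensor functor is a $k$-linear (strong) monoidal functor. That a tensor functor $\Phi:\mathsf A\to\mathsf C$ is an abelian envelope means: $\mathsf A$ is a pseudo-tensor category, $\mathsf C$ is a tensor category, $\Phi$ is faithful, and for every tensor category $\mathsf D$ over $k$ 1. every faithful tensor functor $F:\mathsf A\to\mathsf D$ is monoidally isomorphic to $E\circ\Phi$ for some exact tensor functor $E:\mathsf C\to\mathsf D$;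 2. for all exact tensor functors $E,E':\mathsf C\to\mathsf D$, every monoidal natural transformation $E\circ\Phi\Rightarrow E'\circ\Phi$ is the restriction along $\Phi$ of a unique monoidal natural transformation $E\Rightarrow E'$. (In particular the $E$ in 1 is unique up to a unique compatible monoidal isomorphism.) -/

import Mathlib

universe u v w v₁ v₂ v₃ u₁ u₂ u₃

namespace TensorEnvelope

open CategoryTheory MonoidalCategory Limits Functor.LaxMonoidal Functor.OplaxMonoidal

noncomputable section

section Aux

variable {C : Type u₁} [Category.{v₁} C] [MonoidalCategory C] (F : C ⥤ C)

section

variable [F.Monoidal]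

lemma equivariant_tensorHom {X₁ Y₁ X₂ Y₂ : C} (f : X₁ ⟶ Y₁) (g : X₂ ⟶ Y₂)
    {a₁ : F.obj X₁ ⟶ X₁} {b₁ : F.obj Y₁ ⟶ Y₁} {a₂ : F.obj X₂ ⟶ X₂} {b₂ : F.obj Y₂ ⟶ Y₂}
    (hf : F.map f ≫ b₁ = a₁ ≫ f) (hg : F.map g ≫ b₂ = a₂ ≫ g) :
    F.map (f ⊗ₘ g) ≫ δ F Y₁ Y₂ ≫ (b₁ ⊗ₘ b₂) = (δ F X₁ X₂ ≫ (a₁ ⊗ₘ a₂)) ≫ (f ⊗ₘ g) := by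
  rw [← δ_natural_assoc, Category.assoc, tensorHom_comp_tensorHom,
    tensorHom_comp_tensorHom, hf, hg]

lemma equivariant_whiskerLeft (X : C) {Y₁ Y₂ : C} (f : Y₁ ⟶ Y₂) (a : F.obj X ⟶ X)
    {b₁ : F.obj Y₁ ⟶ Y₁} {b₂ : F.obj Y₂ ⟶ Y₂} (hf : F.map f ≫ b₂ = b₁ ≫ f) :
    F.map (X ◁ f) ≫ δ F X Y₂ ≫ (a ⊗ₘ b₂) = (δ F X Y₁ ≫ (a ⊗ₘ b₁)) ≫ X ◁ f := by
  rw [← id_tensorHom]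
  exact equivariant_tensorHom F (𝟙 X) f (by simp) hf

lemma equivariant_whiskerRight {X₁ X₂ : C} (f : X₁ ⟶ X₂) (Y : C) (b : F.obj Y ⟶ Y)
    {a₁ : F.obj X₁ ⟶ X₁} {a₂ : F.obj X₂ ⟶ X₂} (hf : F.map f ≫ a₂ = a₁ ≫ f) :
    F.map (f ▷ Y) ≫ δ F X₂ Y ≫ (a₂ ⊗ₘ b) = (δ F X₁ Y ≫ (a₁ ⊗ₘ b)) ≫ f ▷ Y := by
  rw [← tensorHom_id]
  exact equivariant_tensorHom F f (𝟙 Y) hf (by simp)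

lemma equivariant_associator {X Y Z : C} (a : F.obj X ⟶ X) (b : F.obj Y ⟶ Y) (c : F.obj Z ⟶ Z) :
    F.map (α_ X Y Z).hom ≫ δ F X (Y ⊗ Z) ≫ (a ⊗ₘ (δ F Y Z ≫ (b ⊗ₘ c))) =
      (δ F (X ⊗ Y) Z ≫ ((δ F X Y ≫ (a ⊗ₘ b)) ⊗ₘ c)) ≫ (α_ X Y Z).hom := by
  have h₁ : (a ⊗ₘ (δ F Y Z ≫ (b ⊗ₘ c))) = F.obj X ◁ δ F Y Z ≫ (a ⊗ₘ (b ⊗ₘ c)) := by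
    rw [← id_tensorHom, tensorHom_comp_tensorHom, Category.id_comp]
  have h₂ : ((δ F X Y ≫ (a ⊗ₘ b)) ⊗ₘ c) = δ F X Y ▷ F.obj Z ≫ ((a ⊗ₘ b) ⊗ₘ c) := by
    rw [← tensorHom_id, tensorHom_comp_tensorHom, Category.id_comp]
  rw [h₁, h₂, Category.assoc, Category.assoc, associator_naturality,
    Functor.OplaxMonoidal.associativity_assoc]

lemma equivariant_leftUnitor {X : C} (a : F.obj X ⟶ X) :
    F.map (λ_ X).hom ≫ a = (δ F (𝟙_ C) X ≫ (η F ⊗ₘ a)) ≫ (λ_ X).hom := by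
  rw [MonoidalCategory.tensorHom_def, Category.assoc, Category.assoc, leftUnitor_naturality,
    Functor.Monoidal.map_leftUnitor_assoc]

lemma equivariant_rightUnitor {X : C} (a : F.obj X ⟶ X) :
    F.map (ρ_ X).hom ≫ a = (δ F X (𝟙_ C) ≫ (a ⊗ₘ η F)) ≫ (ρ_ X).hom := by
  rw [MonoidalCategory.tensorHom_def', Category.assoc, Category.assoc, rightUnitor_naturality,
    Functor.Monoidal.map_rightUnitor_assoc]

end

lemma equivariant_braiding [SymmetricCategory C] [F.Braided] {X Y : C} (a : F.obj X ⟶ X)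
    (b : F.obj Y ⟶ Y) :
    F.map (β_ X Y).hom ≫ δ F Y X ≫ (b ⊗ₘ a) = (δ F X Y ≫ (a ⊗ₘ b)) ≫ (β_ X Y).hom := by
  rw [Category.assoc, BraidedCategory.braiding_naturality, Functor.map_braiding]
  simp only [Category.assoc, Functor.Monoidal.μ_δ_assoc]

end Aux

section Ideals

variable (k : Type u) [Field k] (C : Type u₁) [Category.{v₁} C] [Preadditive C] [Linear k C]
  [MonoidalCategory C]

/-- A two-sided tensor ideal of a `k`-linear monoidal category. -/
structure TensorIdeal where
  hom : ∀ X Y : C, Submodule k (X ⟶ Y)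
  comp_left : ∀ {X Y Z : C} (f : X ⟶ Y) {g : Y ⟶ Z}, g ∈ hom Y Z → f ≫ g ∈ hom X Z
  comp_right : ∀ {X Y Z : C} {f : X ⟶ Y} (g : Y ⟶ Z), f ∈ hom X Y → f ≫ g ∈ hom X Z
  whiskerLeft : ∀ (Z : C) {X Y : C} {f : X ⟶ Y}, f ∈ hom X Y → Z ◁ f ∈ hom (Z ⊗ X) (Z ⊗ Y)
  whiskerRight : ∀ (Z : C) {X Y : C} {f : X ⟶ Y}, f ∈ hom X Y → f ▷ Z ∈ hom (X ⊗ Z) (Y ⊗ Z)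

end Ideals

namespace TensorIdeal

variable {k : Type u} [Field k] {C : Type u₁} [Category.{v₁} C] [Preadditive C] [Linear k C]
  [MonoidalCategory C] (I : TensorIdeal k C)

/-- Congruence modulo a tensor ideal. -/
def rel : HomRel C := fun X Y f g => f - g ∈ I.hom X Y

instance : Congruence I.rel where
  comp_left f g g' h := by
    have := I.comp_left f h
    rwa [Preadditive.comp_sub] at this
  comp_right g h := by
    have := I.comp_right g h
    rwa [Preadditive.sub_comp] at this
  equivalence :=
    { refl := fun f => by simp [rel]
      symm := fun {f g} h => by
        have := (I.hom _ _).neg_mem h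
        rwa [neg_sub] at this
      trans := fun {f g h} h₁ h₂ => by
        have := (I.hom _ _).add_mem h₁ h₂
        rwa [sub_add_sub_cancel] at this }

/-- The quotient category `C / I`: the same objects, and `Hom(X, Y) / I(X, Y)` as morphisms. -/
abbrev Quot : Type u₁ := CategoryTheory.Quotient I.rel

/-- The quotient functor `C ⥤ C / I`. -/
abbrev proj : C ⥤ I.Quot := CategoryTheory.Quotient.functor I.rel

lemma rel_add ⦃X Y : C⦄ (f₁ f₂ g₁ g₂ : X ⟶ Y) (hf : I.rel f₁ f₂) (hg : I.rel g₁ g₂) :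
    I.rel (f₁ + g₁) (f₂ + g₂) := by
  have := (I.hom _ _).add_mem hf hg
  rwa [← add_sub_add_comm] at this

lemma rel_smul (a : k) ⦃X Y : C⦄ (f₁ f₂ : X ⟶ Y) (hf : I.rel f₁ f₂) :
    I.rel (a • f₁) (a • f₂) := by
  have := (I.hom _ _).smul_mem a hf
  rwa [smul_sub] at this

instance : Preadditive I.Quot := CategoryTheory.Quotient.preadditive I.rel I.rel_add

instance : I.proj.Additive := CategoryTheory.Quotient.functor_additive I.rel I.rel_add

instance : Linear k I.Quot := CategoryTheory.Quotient.linear k I.rel I.rel_smul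

instance : I.proj.Linear k := CategoryTheory.Quotient.linear_functor k I.rel I.rel_smul

lemma proj_map_eq_iff {X Y : C} (f g : X ⟶ Y) :
    I.proj.map f = I.proj.map g ↔ f - g ∈ I.hom X Y :=
  CategoryTheory.Quotient.functor_map_eq_iff I.rel f g

lemma proj_map_surj {X Y : I.Quot} (f : X ⟶ Y) : ∃ g : X.as ⟶ Y.as, I.proj.map g = f :=
  I.proj.map_surjective (X := X.as) (Y := Y.as) f


section Lift

variable {D : Type u₂} [Category.{v₂} D] [Preadditive D] (F : C ⥤ D) [F.Additive]
  (hF : ∀ ⦃X Y : C⦄ ⦃f : X ⟶ Y⦄, f ∈ I.hom X Y → F.map f = 0)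

/-- A functor that kills a tensor ideal factors through the quotient category. -/
def lift : I.Quot ⥤ D :=
  CategoryTheory.Quotient.lift I.rel F fun _ _ f g h => by
    rw [← sub_eq_zero, ← F.map_sub]
    exact hF h

lemma lift_map_proj {X Y : C} (f : X ⟶ Y) : (I.lift F hF).map (I.proj.map f) = F.map f := rfl

instance : (I.lift F hF).Additive where
  map_add := by
    rintro X Y ⟨f⟩ ⟨g⟩
    exact F.map_add (f := f) (g := g)

instance [Linear k D] [F.Linear k] : (I.lift F hF).Linear k where
  map_smul := by
    rintro X Y ⟨f⟩ a
    exact F.map_smul a f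

end Lift

section Monoidal

variable [MonoidalPreadditive C]

lemma proj_whiskerLeft_eq (Z : C) {X Y : C} {f g : X ⟶ Y} (h : HomRel.CompClosure I.rel f g) :
    I.proj.map (Z ◁ f) = I.proj.map (Z ◁ g) := by
  rw [HomRel.compClosure_iff_self] at h
  rw [proj_map_eq_iff,
    show Z ◁ f - Z ◁ g = Z ◁ (f - g) from ((tensorLeft Z).map_sub (f := f) (g := g)).symm]
  exact I.whiskerLeft Z h

lemma proj_whiskerRight_eq (Z : C) {X Y : C} {f g : X ⟶ Y} (h : HomRel.CompClosure I.rel f g) :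
    I.proj.map (f ▷ Z) = I.proj.map (g ▷ Z) := by
  rw [HomRel.compClosure_iff_self] at h
  rw [proj_map_eq_iff,
    show f ▷ Z - g ▷ Z = (f - g) ▷ Z from ((tensorRight Z).map_sub (f := f) (g := g)).symm]
  exact I.whiskerRight Z h

instance : MonoidalCategoryStruct I.Quot where
  tensorObj X Y := I.proj.obj (X.as ⊗ Y.as)
  whiskerLeft X {_ _} f := Quot.liftOn f (fun f => I.proj.map (X.as ◁ f))
    fun _ _ h => I.proj_whiskerLeft_eq X.as h
  whiskerRight {_ _} f Y := Quot.liftOn f (fun f => I.proj.map (f ▷ Y.as))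
    fun _ _ h => I.proj_whiskerRight_eq Y.as h
  tensorUnit := I.proj.obj (𝟙_ C)
  associator X Y Z := I.proj.mapIso (α_ X.as Y.as Z.as)
  leftUnitor X := I.proj.mapIso (λ_ X.as)
  rightUnitor X := I.proj.mapIso (ρ_ X.as)

lemma whiskerLeft_proj (X : I.Quot) {Y Z : C} (f : Y ⟶ Z) :
    X ◁ I.proj.map f = I.proj.map (X.as ◁ f) := rfl

lemma proj_whiskerRight {Y Z : C} (f : Y ⟶ Z) (X : I.Quot) :
    I.proj.map f ▷ X = I.proj.map (f ▷ X.as) := rfl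

lemma proj_tensorHom {X₁ Y₁ X₂ Y₂ : C} (f : X₁ ⟶ Y₁) (g : X₂ ⟶ Y₂) :
    I.proj.map f ⊗ₘ I.proj.map g = I.proj.map (f ⊗ₘ g) := by
  rw [MonoidalCategory.tensorHom_def, I.proj.map_comp]
  rfl

instance : MonoidalCategory I.Quot where
  tensorHom_def _ _ := rfl
  id_tensorHom_id X Y := by
    have := I.proj_tensorHom (𝟙 X.as) (𝟙 Y.as)
    rw [id_tensorHom_id, I.proj.map_id] at this
    exact this
  tensorHom_comp_tensorHom := by
    rintro X₁ Y₁ Z₁ X₂ Y₂ Z₂ ⟨f₁⟩ ⟨f₂⟩ ⟨g₁⟩ ⟨g₂⟩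
    change (I.proj.map f₁ ⊗ₘ I.proj.map f₂) ≫ (I.proj.map g₁ ⊗ₘ I.proj.map g₂) =
      (I.proj.map f₁ ≫ I.proj.map g₁) ⊗ₘ (I.proj.map f₂ ≫ I.proj.map g₂)
    simp only [← Functor.map_comp, proj_tensorHom, tensorHom_comp_tensorHom]
  whiskerLeft_id X Y := congrArg I.proj.map (whiskerLeft_id X.as Y.as)
  id_whiskerRight X Y := congrArg I.proj.map (id_whiskerRight X.as Y.as)
  associator_naturality := by
    rintro X₁ X₂ X₃ Y₁ Y₂ Y₃ ⟨f₁⟩ ⟨f₂⟩ ⟨f₃⟩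
    have := congrArg I.proj.map (associator_naturality f₁ f₂ f₃)
    rw [I.proj.map_comp, I.proj.map_comp, ← proj_tensorHom, ← proj_tensorHom, ← proj_tensorHom,
      ← proj_tensorHom] at this
    exact this
  leftUnitor_naturality := by
    rintro X Y ⟨f⟩
    exact congrArg I.proj.map (leftUnitor_naturality f)
  rightUnitor_naturality := by
    rintro X Y ⟨f⟩
    exact congrArg I.proj.map (rightUnitor_naturality f)
  pentagon W X Y Z := congrArg I.proj.map (pentagon W.as X.as Y.as Z.as)
  triangle X Y := congrArg I.proj.map (triangle X.as Y.as)

instance : MonoidalPreadditive I.Quot where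
  whiskerLeft_zero := congrArg I.proj.map (MonoidalPreadditive.whiskerLeft_zero (C := C))
  zero_whiskerRight := congrArg I.proj.map (MonoidalPreadditive.zero_whiskerRight (C := C))
  whiskerLeft_add := by
    rintro X Y Z ⟨f⟩ ⟨g⟩
    exact congrArg I.proj.map (MonoidalPreadditive.whiskerLeft_add f g)
  add_whiskerRight := by
    rintro X Y Z ⟨f⟩ ⟨g⟩
    exact congrArg I.proj.map (MonoidalPreadditive.add_whiskerRight f g)

instance [MonoidalLinear k C] : MonoidalLinear k I.Quot where
  whiskerLeft_smul := by
    rintro X Y Z a ⟨f⟩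
    exact congrArg I.proj.map (MonoidalLinear.whiskerLeft_smul X.as a f)
  smul_whiskerRight := by
    rintro a Y Z ⟨f⟩ X
    exact congrArg I.proj.map (MonoidalLinear.smul_whiskerRight a f X.as)


instance : I.proj.Monoidal :=
  Functor.CoreMonoidal.toMonoidal
    { εIso := Iso.refl _
      μIso := fun X Y => Iso.refl (I.proj.obj (X ⊗ Y))
      μIso_hom_natural_left := fun f X =>
        (Category.comp_id _).trans (Category.id_comp _).symm
      μIso_hom_natural_right := fun X f =>
        (Category.comp_id _).trans (Category.id_comp _).symm
      associativity := fun X Y Z => by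
        have h₁ : (𝟙 (I.proj.obj (X ⊗ Y))) ▷ I.proj.obj Z = 𝟙 _ := id_whiskerRight _ _
        have h₂ : I.proj.obj X ◁ (𝟙 (I.proj.obj (Y ⊗ Z))) = 𝟙 _ := whiskerLeft_id _ _
        dsimp only [Iso.refl_hom]
        erw [h₁, h₂, Category.id_comp, Category.id_comp, Category.comp_id, Category.comp_id]
        rfl
      left_unitality := fun X => by
        have h₁ : (𝟙 (I.proj.obj (𝟙_ C))) ▷ I.proj.obj X = 𝟙 _ := id_whiskerRight _ _
        dsimp only [Iso.refl_hom]
        erw [h₁, Category.id_comp, Category.id_comp]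
        rfl
      right_unitality := fun X => by
        have h₁ : I.proj.obj X ◁ (𝟙 (I.proj.obj (𝟙_ C))) = 𝟙 _ := whiskerLeft_id _ _
        dsimp only [Iso.refl_hom]
        erw [h₁, Category.id_comp, Category.id_comp]
        rfl }

lemma proj_ε : ε I.proj = 𝟙 (I.proj.obj (𝟙_ C)) := rfl
lemma proj_η : η I.proj = 𝟙 (I.proj.obj (𝟙_ C)) := rfl
lemma proj_μ (X Y : C) : μ I.proj X Y = 𝟙 (I.proj.obj (X ⊗ Y)) := rfl
lemma proj_δ (X Y : C) : δ I.proj X Y = 𝟙 (I.proj.obj (X ⊗ Y)) := rfl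

instance [BraidedCategory C] : BraidedCategory I.Quot where
  braiding X Y := I.proj.mapIso (β_ X.as Y.as)
  braiding_naturality_right := by
    rintro X Y Z ⟨f⟩
    exact congrArg I.proj.map (BraidedCategory.braiding_naturality_right X.as f)
  braiding_naturality_left := by
    rintro X Y ⟨f⟩ Z
    exact congrArg I.proj.map (BraidedCategory.braiding_naturality_left f Z.as)
  hexagon_forward X Y Z :=
    congrArg I.proj.map (BraidedCategory.hexagon_forward X.as Y.as Z.as)
  hexagon_reverse X Y Z :=
    congrArg I.proj.map (BraidedCategory.hexagon_reverse X.as Y.as Z.as)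

instance [SymmetricCategory C] : SymmetricCategory I.Quot where
  symmetry X Y := congrArg I.proj.map (SymmetricCategory.symmetry X.as Y.as)

instance [BraidedCategory C] : I.proj.Braided where
  braided _ _ := (Category.id_comp _).trans (Category.comp_id _).symm

section Lift

variable {D : Type u₂} [Category.{v₂} D] [Preadditive D] (F : C ⥤ D) [F.Additive]
  (hF : ∀ ⦃X Y : C⦄ ⦃f : X ⟶ Y⦄, f ∈ I.hom X Y → F.map f = 0)

variable [MonoidalCategory D]

instance [F.Monoidal] : (I.lift F hF).Monoidal :=
  Functor.CoreMonoidal.toMonoidal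
    { εIso := Functor.Monoidal.εIso F
      μIso := fun X Y => Functor.Monoidal.μIso F X.as Y.as
      μIso_hom_natural_left := by
        rintro X Y ⟨f⟩ Z
        exact μ_natural_left F f Z.as
      μIso_hom_natural_right := by
        rintro X Y Z ⟨f⟩
        exact μ_natural_right F Z.as f
      associativity := fun X Y Z => associativity F X.as Y.as Z.as
      left_unitality := fun X => left_unitality F X.as
      right_unitality := fun X => right_unitality F X.as }

lemma lift_ε [F.Monoidal] : ε (I.lift F hF) = ε F := rfl
lemma lift_η [F.Monoidal] : η (I.lift F hF) = η F := rfl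
lemma lift_μ [F.Monoidal] (X Y : I.Quot) : μ (I.lift F hF) X Y = μ F X.as Y.as := rfl
lemma lift_δ [F.Monoidal] (X Y : I.Quot) : δ (I.lift F hF) X Y = δ F X.as Y.as := rfl

instance [BraidedCategory C] [BraidedCategory D] [F.Braided] : (I.lift F hF).Braided where
  braided X Y := Functor.LaxBraided.braided (F := F) X.as Y.as

end Lift

end Monoidal

section Comap

variable {D : Type u₂} [Category.{v₂} D] [Preadditive D] [Linear k D] [MonoidalCategory D]

/-- The preimage of a tensor ideal under a `k`-linear monoidal functor. -/
def comap (J : TensorIdeal k D) (F : C ⥤ D) [F.Additive] [F.Linear k] [F.Monoidal] :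
    TensorIdeal k C where
  hom X Y := (J.hom (F.obj X) (F.obj Y)).comap (F.mapLinearMap k)
  comp_left f g hg := by
    have := J.comp_left (F.map f) hg
    simpa using this
  comp_right g hf := by
    have := J.comp_right (F.map g) hf
    simpa using this
  whiskerLeft Z {X Y f} hf := by
    have := J.comp_right (μ F Z Y) (J.comp_left (δ F Z X) (J.whiskerLeft (F.obj Z) hf))
    simpa using this
  whiskerRight Z {X Y f} hf := by
    have := J.comp_right (μ F Y Z) (J.comp_left (δ F X Z) (J.whiskerRight (F.obj Z) hf))
    simpa using this

lemma mem_comap (J : TensorIdeal k D) (F : C ⥤ D) [F.Additive] [F.Linear k] [F.Monoidal]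
    {X Y : C} (f : X ⟶ Y) : f ∈ (J.comap F).hom X Y ↔ F.map f ∈ J.hom (F.obj X) (F.obj Y) :=
  Iff.rfl

end Comap

end TensorIdeal

section Action

variable (k : Type u) [Field k] (Q : Type w) [Group Q]
  (C : Type u₁) [Category.{v₁} C] [Preadditive C] [Linear k C]
  [MonoidalCategory C] [SymmetricCategory C]

/-- An action of a group `Q` on a symmetric `k`-linear monoidal category `C` by `k`-linear
symmetric tensor autoequivalences: functors `T q`, with coherent monoidal isomorphisms
`T q ∘ T r ≅ T (q r)` and `id ≅ T 1`. (The composition isomorphism is indexed by a proof of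
`q * r = s` in order to avoid transport along equalities in `Q`.) -/
structure SymmetricAction where
  T : Q → C ⥤ C
  additive : ∀ q, (T q).Additive
  linear : ∀ q, (T q).Linear k
  braided : ∀ q, (T q).Braided
  compIso : ∀ {q r s : Q}, q * r = s → (T r ⋙ T q ≅ T s)
  unitIso : 𝟭 C ≅ T 1
  compIso_isMonoidal : ∀ {q r s : Q} (h : q * r = s), NatTrans.IsMonoidal (compIso h).hom
  unitIso_isMonoidal : NatTrans.IsMonoidal unitIso.hom
  assoc : ∀ {q r t qr rt s : Q} (h₁ : q * r = qr) (h₂ : r * t = rt) (h₃ : qr * t = s)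
    (h₄ : q * rt = s) (X : C),
    (compIso h₁).hom.app ((T t).obj X) ≫ (compIso h₃).hom.app X =
      (T q).map ((compIso h₂).hom.app X) ≫ (compIso h₄).hom.app X
  unit_left : ∀ (q : Q) (X : C),
    unitIso.hom.app ((T q).obj X) ≫ (compIso (one_mul q)).hom.app X = 𝟙 _
  unit_right : ∀ (q : Q) (X : C),
    (T q).map (unitIso.hom.app X) ≫ (compIso (mul_one q)).hom.app X = 𝟙 _

end Action

namespace SymmetricAction

variable {k : Type u} [Field k] {Q : Type w} [Group Q]
  {C : Type u₁} [Category.{v₁} C] [Preadditive C] [Linear k C]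
  [MonoidalCategory C] [SymmetricCategory C] (A : SymmetricAction k Q C)

instance (q : Q) : (A.T q).Additive := A.additive q
instance (q : Q) : (A.T q).Linear k := A.linear q
instance (q : Q) : (A.T q).Braided := A.braided q
instance {q r s : Q} (h : q * r = s) : NatTrans.IsMonoidal (A.compIso h).hom :=
  A.compIso_isMonoidal h

/-- An equivariant object: an object `X` with isomorphisms `u q : T q X ≅ X` such that
`u (q r)` is identified with `u q ∘ T q (u r)`. -/
structure EquivariantObject where
  obj : C
  u : ∀ q : Q, (A.T q).obj obj ≅ obj
  u_comp : ∀ {q r s : Q} (h : q * r = s),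
    (A.compIso h).hom.app obj ≫ (u s).hom = (A.T q).map (u r).hom ≫ (u q).hom

namespace EquivariantObject

variable {A}

/-- A morphism of equivariant objects is a morphism that commutes with the isomorphisms `u q`. -/
@[ext]
structure Hom (X Y : A.EquivariantObject) where
  hom : X.obj ⟶ Y.obj
  comm : ∀ q : Q, (A.T q).map hom ≫ (Y.u q).hom = (X.u q).hom ≫ hom

/-- The equivariantization `C^Q`. -/
instance : Category A.EquivariantObject where
  Hom X Y := Hom X Y
  id X := ⟨𝟙 X.obj, fun q => by simp⟩
  comp f g := ⟨f.hom ≫ g.hom, fun q => by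
    rw [Functor.map_comp, Category.assoc, g.comm, ← Category.assoc, f.comm, Category.assoc]⟩
  id_comp f := Hom.ext (Category.id_comp _)
  comp_id f := Hom.ext (Category.comp_id _)
  assoc f g h := Hom.ext (Category.assoc _ _ _)

@[ext]
lemma hom_ext {X Y : A.EquivariantObject} {f g : X ⟶ Y} (h : f.hom = g.hom) : f = g :=
  Hom.ext h

@[simp] lemma id_hom (X : A.EquivariantObject) : Hom.hom (𝟙 X) = 𝟙 X.obj := rfl
@[simp] lemma comp_hom {X Y Z : A.EquivariantObject} (f : X ⟶ Y) (g : Y ⟶ Z) :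
    (f ≫ g).hom = f.hom ≫ g.hom := rfl

variable (A) in
/-- The functor `C^Q ⥤ C` that forgets the equivariant structure. -/
def forget : A.EquivariantObject ⥤ C where
  obj X := X.obj
  map f := f.hom

instance : (forget A).Faithful where
  map_injective h := Hom.ext h

/-- An isomorphism of the underlying objects that is equivariant is an isomorphism. -/
def mkIso {X Y : A.EquivariantObject} (e : X.obj ≅ Y.obj)
    (h : ∀ q : Q, (A.T q).map e.hom ≫ (Y.u q).hom = (X.u q).hom ≫ e.hom) : X ≅ Y where
  hom := ⟨e.hom, h⟩
  inv := ⟨e.inv, fun q => by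
    rw [← cancel_mono e.hom, Category.assoc, Category.assoc, ← h q, ← Functor.map_comp_assoc]
    simp⟩
  hom_inv_id := Hom.ext e.hom_inv_id
  inv_hom_id := Hom.ext e.inv_hom_id

instance (X Y : A.EquivariantObject) : Zero (X ⟶ Y) := ⟨⟨0, fun q => by simp⟩⟩
instance (X Y : A.EquivariantObject) : Add (X ⟶ Y) :=
  ⟨fun f g => ⟨f.hom + g.hom, fun q => by simp [f.comm, g.comm]⟩⟩
instance (X Y : A.EquivariantObject) : Neg (X ⟶ Y) :=
  ⟨fun f => ⟨-f.hom, fun q => by simp [f.comm]⟩⟩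
instance (X Y : A.EquivariantObject) : Sub (X ⟶ Y) :=
  ⟨fun f g => ⟨f.hom - g.hom, fun q => by simp [f.comm, g.comm]⟩⟩
instance (X Y : A.EquivariantObject) : SMul ℕ (X ⟶ Y) :=
  ⟨fun n f => ⟨n • f.hom, fun q => by
    rw [Functor.map_nsmul, Preadditive.nsmul_comp, Preadditive.comp_nsmul, f.comm]⟩⟩
instance (X Y : A.EquivariantObject) : SMul ℤ (X ⟶ Y) :=
  ⟨fun n f => ⟨n • f.hom, fun q => by
    rw [Functor.map_zsmul, Preadditive.zsmul_comp, Preadditive.comp_zsmul, f.comm]⟩⟩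
instance (X Y : A.EquivariantObject) : SMul k (X ⟶ Y) :=
  ⟨fun a f => ⟨a • f.hom, fun q => by
    rw [Functor.map_smul, Linear.smul_comp, Linear.comp_smul, f.comm]⟩⟩

lemma hom_injective (X Y : A.EquivariantObject) :
    Function.Injective (fun f : X ⟶ Y => f.hom) := fun _ _ h => Hom.ext h

instance : Preadditive A.EquivariantObject where
  homGroup X Y := (hom_injective X Y).addCommGroup _ rfl (fun _ _ => rfl) (fun _ => rfl)
    (fun _ _ => rfl) (fun _ _ => rfl) (fun _ _ => rfl)
  add_comp _ _ _ _ _ _ := Hom.ext (Preadditive.add_comp _ _ _ _ _ _)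
  comp_add _ _ _ _ _ _ := Hom.ext (Preadditive.comp_add _ _ _ _ _ _)

instance : Linear k A.EquivariantObject where
  homModule X Y := (hom_injective X Y).module k
    { toFun := fun f : X ⟶ Y => f.hom, map_zero' := rfl, map_add' := fun _ _ => rfl }
    (fun _ _ => rfl)
  smul_comp _ _ _ _ _ _ := Hom.ext (Linear.smul_comp _ _ _ _ _ _)
  comp_smul _ _ _ _ _ _ := Hom.ext (Linear.comp_smul _ _ _ _ _ _)

lemma add_hom {X Y : A.EquivariantObject} (f g : X ⟶ Y) : (f + g).hom = f.hom + g.hom := rfl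
lemma smul_hom {X Y : A.EquivariantObject} (a : k) (f : X ⟶ Y) : (a • f).hom = a • f.hom := rfl
lemma zero_hom {X Y : A.EquivariantObject} : Hom.hom (0 : X ⟶ Y) = 0 := rfl

instance : (forget A).Additive where
instance : (forget A).Linear k where

/-- The tensor product of equivariant objects. -/
def tensor (X Y : A.EquivariantObject) : A.EquivariantObject where
  obj := X.obj ⊗ Y.obj
  u q := (Functor.Monoidal.μIso (A.T q) X.obj Y.obj).symm ≪≫ (X.u q ⊗ᵢ Y.u q)
  u_comp {q r s} h := by
    rw [← cancel_epi (μ (A.T r ⋙ A.T q) X.obj Y.obj), NatTrans.IsMonoidal.tensor_assoc]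
    simp only [Iso.trans_hom, Iso.symm_hom, Functor.Monoidal.μIso_inv, tensorIso_hom,
      Functor.Monoidal.μ_δ_assoc, Functor.map_comp, Category.assoc, Functor.LaxMonoidal.comp_μ]
    rw [← Functor.map_comp_assoc (A.T q) (μ (A.T r) _ _), Functor.Monoidal.μ_δ,
      CategoryTheory.Functor.map_id, Category.id_comp, ← μ_natural_assoc, Functor.Monoidal.μ_δ_assoc,
      tensorHom_comp_tensorHom, tensorHom_comp_tensorHom, X.u_comp h, Y.u_comp h]

variable (A) in
/-- The unit object with its canonical equivariant structure. -/
def unit : A.EquivariantObject where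
  obj := 𝟙_ C
  u q := (Functor.Monoidal.εIso (A.T q)).symm
  u_comp {q r s} h := by
    rw [← cancel_epi (ε (A.T r ⋙ A.T q)), NatTrans.IsMonoidal.unit_assoc]
    simp

lemma tensor_u (X Y : A.EquivariantObject) (q : Q) :
    ((tensor X Y).u q).hom = δ (A.T q) X.obj Y.obj ≫ ((X.u q).hom ⊗ₘ (Y.u q).hom) := rfl

lemma unit_u (q : Q) : ((unit A).u q).hom = η (A.T q) := rfl

instance : MonoidalCategoryStruct A.EquivariantObject where
  tensorObj := tensor
  tensorUnit := unit A
  tensorHom f g := ⟨f.hom ⊗ₘ g.hom, fun q =>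
    equivariant_tensorHom (A.T q) f.hom g.hom (f.comm q) (g.comm q)⟩
  whiskerLeft X {_ _} f := ⟨X.obj ◁ f.hom, fun q =>
    equivariant_whiskerLeft (A.T q) X.obj f.hom (X.u q).hom (f.comm q)⟩
  whiskerRight {_ _} f Y := ⟨f.hom ▷ Y.obj, fun q =>
    equivariant_whiskerRight (A.T q) f.hom Y.obj (Y.u q).hom (f.comm q)⟩
  associator X Y Z := mkIso (α_ X.obj Y.obj Z.obj) fun q =>
    equivariant_associator (A.T q) (X.u q).hom (Y.u q).hom (Z.u q).hom
  leftUnitor X := mkIso (λ_ X.obj) fun q => equivariant_leftUnitor (A.T q) (X.u q).hom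
  rightUnitor X := mkIso (ρ_ X.obj) fun q => equivariant_rightUnitor (A.T q) (X.u q).hom

instance : MonoidalCategory A.EquivariantObject where
  tensorHom_def _ _ := Hom.ext (MonoidalCategory.tensorHom_def _ _)
  id_tensorHom_id _ _ := Hom.ext (id_tensorHom_id _ _)
  tensorHom_comp_tensorHom _ _ _ _ := Hom.ext (tensorHom_comp_tensorHom _ _ _ _)
  whiskerLeft_id _ _ := Hom.ext (whiskerLeft_id _ _)
  id_whiskerRight _ _ := Hom.ext (id_whiskerRight _ _)
  associator_naturality _ _ _ := Hom.ext (associator_naturality _ _ _)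
  leftUnitor_naturality _ := Hom.ext (leftUnitor_naturality _)
  rightUnitor_naturality _ := Hom.ext (rightUnitor_naturality _)
  pentagon _ _ _ _ := Hom.ext (pentagon _ _ _ _)
  triangle _ _ := Hom.ext (triangle _ _)

instance [MonoidalPreadditive C] : MonoidalPreadditive A.EquivariantObject where
  whiskerLeft_zero := Hom.ext (MonoidalPreadditive.whiskerLeft_zero (C := C))
  zero_whiskerRight := Hom.ext (MonoidalPreadditive.zero_whiskerRight (C := C))
  whiskerLeft_add _ _ := Hom.ext (MonoidalPreadditive.whiskerLeft_add _ _)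
  add_whiskerRight _ _ := Hom.ext (MonoidalPreadditive.add_whiskerRight _ _)

instance [MonoidalPreadditive C] [MonoidalLinear k C] :
    MonoidalLinear k A.EquivariantObject where
  whiskerLeft_smul _ _ _ _ _ := Hom.ext (MonoidalLinear.whiskerLeft_smul _ _ _)
  smul_whiskerRight _ _ _ _ _ := Hom.ext (MonoidalLinear.smul_whiskerRight _ _ _)

instance : BraidedCategory A.EquivariantObject where
  braiding X Y := mkIso (β_ X.obj Y.obj) fun q => equivariant_braiding (A.T q) (X.u q).hom (Y.u q).hom
  braiding_naturality_right _ _ _ _ := Hom.ext (BraidedCategory.braiding_naturality_right _ _)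
  braiding_naturality_left _ _ := Hom.ext (BraidedCategory.braiding_naturality_left _ _)
  hexagon_forward _ _ _ := Hom.ext (BraidedCategory.hexagon_forward _ _ _)
  hexagon_reverse _ _ _ := Hom.ext (BraidedCategory.hexagon_reverse _ _ _)

instance : SymmetricCategory A.EquivariantObject where
  symmetry _ _ := Hom.ext (SymmetricCategory.symmetry _ _)

section Lift

variable {D : Type u₂} [Category.{v₂} D] [MonoidalCategory D] [BraidedCategory D]
  (F : D ⥤ C) [F.Braided] (τ : ∀ q : Q, F ⋙ A.T q ≅ F)
  (hτ : ∀ {q r s : Q} (h : q * r = s) (X : D),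
    (A.compIso h).hom.app (F.obj X) ≫ (τ s).hom.app X =
      (A.T q).map ((τ r).hom.app X) ≫ (τ q).hom.app X)

/-- A functor `F` with coherent isomorphisms `T q ∘ F ≅ F` takes values in `C^Q`. -/
def lift : D ⥤ A.EquivariantObject where
  obj X :=
    { obj := F.obj X
      u := fun q => (τ q).app X
      u_comp := fun h => hτ h X }
  map f := ⟨F.map f, fun q => (τ q).hom.naturality f⟩
  map_id X := Hom.ext (F.map_id X)
  map_comp f g := Hom.ext (F.map_comp f g)

instance lift_additive [Preadditive D] [F.Additive] : (lift F τ hτ).Additive where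
  map_add := Hom.ext F.map_add

instance lift_linear [Preadditive D] [Linear k D] [F.Additive] [F.Linear k] : (lift F τ hτ).Linear k where
  map_smul f a := Hom.ext (F.map_smul a f)

variable [∀ q : Q, NatTrans.IsMonoidal (τ q).hom]

/-- The compatibility of `lift` with the unit objects. -/
def liftUnitIso : 𝟙_ A.EquivariantObject ≅ (lift F τ hτ).obj (𝟙_ D) :=
  mkIso (Functor.Monoidal.εIso F) fun q => by
    have h := NatTrans.IsMonoidal.unit (τ := (τ q).hom)
    rw [Functor.LaxMonoidal.comp_ε, Category.assoc] at h
    change (A.T q).map (ε F) ≫ (τ q).hom.app (𝟙_ D) = η (A.T q) ≫ ε F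
    conv_rhs => rw [← h, Functor.Monoidal.η_ε_assoc]

/-- The compatibility of `lift` with tensor products. -/
def liftTensorIso (X Y : D) :
    (lift F τ hτ).obj X ⊗ (lift F τ hτ).obj Y ≅ (lift F τ hτ).obj (X ⊗ Y) :=
  mkIso (Functor.Monoidal.μIso F X Y) fun q => by
    have h := NatTrans.IsMonoidal.tensor (τ := (τ q).hom) X Y
    rw [Functor.LaxMonoidal.comp_μ, Category.assoc] at h
    change (A.T q).map (μ F X Y) ≫ (τ q).hom.app (X ⊗ Y) =
      (δ (A.T q) (F.obj X) (F.obj Y) ≫ ((τ q).hom.app X ⊗ₘ (τ q).hom.app Y)) ≫ μ F X Y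
    rw [Category.assoc, ← h, Functor.Monoidal.δ_μ_assoc]

instance liftMonoidal : (lift F τ hτ).Monoidal :=
  Functor.CoreMonoidal.toMonoidal
    { εIso := liftUnitIso F τ hτ
      μIso := liftTensorIso F τ hτ
      μIso_hom_natural_left := fun f Z => Hom.ext (μ_natural_left F f Z)
      μIso_hom_natural_right := fun Z f => Hom.ext (μ_natural_right F Z f)
      associativity := fun X Y Z => Hom.ext (associativity F X Y Z)
      left_unitality := fun X => Hom.ext (left_unitality F X)
      right_unitality := fun X => Hom.ext (right_unitality F X) }

instance liftBraided : (lift F τ hτ).Braided where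
  braided X Y := Hom.ext (Functor.LaxBraided.braided (F := F) X Y)

end Lift

end EquivariantObject

section Quotient

variable [MonoidalPreadditive C] (I : TensorIdeal k C)
  (hI : ∀ (q : Q) ⦃X Y : C⦄ ⦃f : X ⟶ Y⦄, f ∈ I.hom X Y →
    (A.T q).map f ∈ I.hom ((A.T q).obj X) ((A.T q).obj Y))

/-- The functor on `C / I` induced by `T q`. -/
def quotT (q : Q) : I.Quot ⥤ I.Quot :=
  I.lift (A.T q ⋙ I.proj) fun _ _ f hf => by
    have := (I.proj_map_eq_iff ((A.T q).map f) 0).2 (by simpa using hI q hf)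
    simpa using this

instance (q : Q) : (A.quotT I hI q).Additive :=
  inferInstanceAs (I.lift (A.T q ⋙ I.proj) _).Additive
instance (q : Q) : (A.quotT I hI q).Linear k :=
  inferInstanceAs ((I.lift (A.T q ⋙ I.proj) _).Linear k)
instance (q : Q) : (A.quotT I hI q).Braided :=
  inferInstanceAs (I.lift (A.T q ⋙ I.proj) _).Braided

lemma quotT_ε (q : Q) : ε (A.quotT I hI q) = I.proj.map (ε (A.T q)) :=
  Category.id_comp (I.proj.map (ε (A.T q)))

lemma quotT_μ (q : Q) (X Y : I.Quot) :
    μ (A.quotT I hI q) X Y = I.proj.map (μ (A.T q) X.as Y.as) :=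
  Category.id_comp (I.proj.map (μ (A.T q) X.as Y.as))

/-- The isomorphism `T q ∘ T r ≅ T s` on `C / I`. -/
def quotCompIso {q r s : Q} (h : q * r = s) :
    A.quotT I hI r ⋙ A.quotT I hI q ≅ A.quotT I hI s :=
  NatIso.ofComponents (fun X => I.proj.mapIso ((A.compIso h).app X.as)) (by
    rintro X Y ⟨f⟩
    exact congrArg I.proj.map ((A.compIso h).hom.naturality f))

/-- The isomorphism `id ≅ T 1` on `C / I`. -/
def quotUnitIso : 𝟭 I.Quot ≅ A.quotT I hI 1 :=
  NatIso.ofComponents (fun X => I.proj.mapIso (A.unitIso.app X.as)) (by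
    rintro X Y ⟨f⟩
    exact congrArg I.proj.map (A.unitIso.hom.naturality f))

/-- The action on the quotient by an invariant tensor ideal. -/
def quotient : SymmetricAction k Q I.Quot where
  T := A.quotT I hI
  additive _ := inferInstance
  linear _ := inferInstance
  braided _ := inferInstance
  compIso h := A.quotCompIso I hI h
  unitIso := A.quotUnitIso I hI
  compIso_isMonoidal {q r s} h :=
    { unit := by
        have := NatTrans.IsMonoidal.unit (τ := (A.compIso h).hom)
        rw [Functor.LaxMonoidal.comp_ε] at this ⊢
        rw [quotT_ε, quotT_ε, quotT_ε]
        exact congrArg I.proj.map this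
      tensor := fun X Y => by
        have := NatTrans.IsMonoidal.tensor (τ := (A.compIso h).hom) X.as Y.as
        rw [Functor.LaxMonoidal.comp_μ] at this ⊢
        rw [quotT_μ, quotT_μ, quotT_μ]
        refine (congrArg I.proj.map this).trans ?_
        rw [I.proj.map_comp, ← I.proj_tensorHom]
        rfl }
  unitIso_isMonoidal :=
    { unit := by
        have := A.unitIso_isMonoidal.unit
        rw [quotT_ε]
        exact congrArg I.proj.map this
      tensor := fun X Y => by
        have := A.unitIso_isMonoidal.tensor X.as Y.as
        rw [quotT_μ]
        refine (congrArg I.proj.map this).trans ?_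
        rw [I.proj.map_comp, ← I.proj_tensorHom]
        rfl }
  assoc h₁ h₂ h₃ h₄ X := congrArg I.proj.map (A.assoc h₁ h₂ h₃ h₄ X.as)
  unit_left q X := congrArg I.proj.map (A.unit_left q X.as)
  unit_right q X := congrArg I.proj.map (A.unit_right q X.as)

end Quotient

end SymmetricAction

section Rep

variable (k : Type u) [Field k] {G : Type v} [Group G] {H : Type w} [Group H]

/-- Restriction of finite-dimensional representations along a group homomorphism. -/
def resFunctor (f : H →* G) : FDRep k G ⥤ FDRep k H := Action.res (FGModuleCat.{u} k) f

instance (f : H →* G) : (resFunctor k f).Additive where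
  map_add := rfl

instance (f : H →* G) : (resFunctor k f).Linear k where
  map_smul _ _ := rfl

instance (f : H →* G) : (resFunctor k f).Monoidal :=
  Functor.CoreMonoidal.toMonoidal
    { εIso := Action.mkIso (Iso.refl (𝟙_ (FGModuleCat k))) (fun _ =>
        (Category.comp_id _).trans (Category.id_comp _).symm)
      μIso := fun X Y => Action.mkIso (Iso.refl (X.V ⊗ Y.V)) (fun _ =>
        (Category.comp_id _).trans (Category.id_comp _).symm)
      μIso_hom_natural_left := fun _ _ => Action.Hom.ext
        ((Category.comp_id _).trans (Category.id_comp _).symm)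
      μIso_hom_natural_right := fun _ _ => Action.Hom.ext
        ((Category.comp_id _).trans (Category.id_comp _).symm)
      associativity := fun X Y Z => Action.Hom.ext (by
        have h₁ := Action.associator_hom_hom X Y Z
        have h₂ := Action.associator_hom_hom ((resFunctor k f).obj X) ((resFunctor k f).obj Y)
          ((resFunctor k f).obj Z)
        change (𝟙 (X.V ⊗ Y.V)) ▷ Z.V ≫ 𝟙 ((X.V ⊗ Y.V) ⊗ Z.V) ≫ (α_ X Y Z).hom.hom =
          Action.Hom.hom (α_ ((resFunctor k f).obj X) ((resFunctor k f).obj Y)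
            ((resFunctor k f).obj Z)).hom ≫ X.V ◁ 𝟙 (Y.V ⊗ Z.V) ≫ 𝟙 (X.V ⊗ Y.V ⊗ Z.V)
        have h₃ : (𝟙 (X.V ⊗ Y.V)) ▷ Z.V ≫ 𝟙 ((X.V ⊗ Y.V) ⊗ Z.V) ≫ (α_ X.V Y.V Z.V).hom =
            (α_ X.V Y.V Z.V).hom ≫ X.V ◁ 𝟙 (Y.V ⊗ Z.V) ≫ 𝟙 (X.V ⊗ Y.V ⊗ Z.V) := by simp
        rw [h₁, h₂]
        exact h₃)
      left_unitality := fun X => Action.Hom.ext (by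
        have h₁ := Action.leftUnitor_hom_hom X
        have h₂ := Action.leftUnitor_hom_hom ((resFunctor k f).obj X)
        change Action.Hom.hom (λ_ ((resFunctor k f).obj X)).hom =
          (𝟙 (𝟙_ (FGModuleCat k))) ▷ X.V ≫ 𝟙 (𝟙_ (FGModuleCat k) ⊗ X.V) ≫ (λ_ X).hom.hom
        rw [h₁, h₂, id_whiskerRight, Category.id_comp, Category.id_comp]
        rfl)
      right_unitality := fun X => Action.Hom.ext (by
        have h₁ := Action.rightUnitor_hom_hom X
        have h₂ := Action.rightUnitor_hom_hom ((resFunctor k f).obj X)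
        change Action.Hom.hom (ρ_ ((resFunctor k f).obj X)).hom =
          X.V ◁ (𝟙 (𝟙_ (FGModuleCat k))) ≫ 𝟙 (X.V ⊗ 𝟙_ (FGModuleCat k)) ≫ (ρ_ X).hom.hom
        rw [h₁, h₂, whiskerLeft_id, Category.id_comp, Category.id_comp]
        rfl) }

instance (f : H →* G) : (resFunctor k f).Braided where
  braided X Y := Action.Hom.ext (by
    change 𝟙 (X.V ⊗ Y.V) ≫ (β_ X.V Y.V).hom = (β_ X.V Y.V).hom ≫ 𝟙 (Y.V ⊗ X.V)
    simp)

lemma resFunctor_ε_hom (f : H →* G) : (ε (resFunctor k f)).hom = 𝟙 (𝟙_ (FGModuleCat k)) := rfl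
lemma resFunctor_μ_hom (f : H →* G) (X Y : FDRep k G) :
    (μ (resFunctor k f) X Y).hom = 𝟙 (X.V ⊗ Y.V) := rfl

lemma ρ_comp (V : FDRep k G) (x y : G) :
    Action.ρ V x ≫ Action.ρ V y = Action.ρ V (y * x) := (map_mul (Action.ρ V) y x).symm

/-- If `x f₁(m) = f₂(m) x` for all `m`, then `v ↦ x v` is an isomorphism from the restriction
along `f₁` to the restriction along `f₂`. -/
def resIso (f₁ f₂ : H →* G) (x : G) (hx : ∀ m, x * f₁ m = f₂ m * x) :
    resFunctor k f₁ ≅ resFunctor k f₂ :=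
  NatIso.ofComponents
    (fun V => Action.mkIso
      { hom := Action.ρ V x
        inv := Action.ρ V x⁻¹
        hom_inv_id := (ρ_comp k V x x⁻¹).trans (by rw [inv_mul_cancel]; exact map_one (Action.ρ V))
        inv_hom_id := (ρ_comp k V x⁻¹ x).trans (by rw [mul_inv_cancel]; exact map_one (Action.ρ V)) }
      fun m => by
        change Action.ρ V (f₁ m) ≫ Action.ρ V x = Action.ρ V x ≫ Action.ρ V (f₂ m)
        rw [ρ_comp, ρ_comp, hx])
    fun f => Action.Hom.ext (f.comm x).symm

lemma resIso_hom_app_hom (f₁ f₂ : H →* G) (x : G) (hx : ∀ m, x * f₁ m = f₂ m * x)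
    (V : FDRep k G) : ((resIso k f₁ f₂ x hx).hom.app V).hom = Action.ρ V x := rfl

/-- The linear map underlying a morphism of representations. -/
def lin {V W : FDRep k G} (f : V ⟶ W) : V →ₗ[k] W := f.hom.hom.hom

lemma lin_comm {V W : FDRep k G} (f : V ⟶ W) (g : G) : lin k f ∘ₗ V.ρ g = W.ρ g ∘ₗ lin k f := by
  have := congrArg (fun (x : V.V ⟶ W.V) => x.hom.hom) (f.comm g)
  exact this

/-- An equivariant linear map, as a morphism of representations. -/
def ofLin {V W : FDRep k G} (f : V →ₗ[k] W) (hf : ∀ g : G, f ∘ₗ V.ρ g = W.ρ g ∘ₗ f) : V ⟶ W where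
  hom := FGModuleCat.ofHom f
  comm g := FGModuleCat.hom_ext (hf g)

lemma lin_comp {V W U : FDRep k G} (f : V ⟶ W) (g : W ⟶ U) :
    lin k (f ≫ g) = lin k g ∘ₗ lin k f := rfl
lemma lin_whiskerLeft (Z : FDRep k G) {V W : FDRep k G} (f : V ⟶ W) :
    lin k (Z ◁ f) = TensorProduct.map LinearMap.id (lin k f) := rfl
lemma lin_whiskerRight (Z : FDRep k G) {V W : FDRep k G} (f : V ⟶ W) :
    lin k (f ▷ Z) = TensorProduct.map (lin k f) LinearMap.id := rfl
lemma tensor_ρ (V W : FDRep k G) (g : G) :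
    (V ⊗ W).ρ g = TensorProduct.map (V.ρ g) (W.ρ g) := rfl

/-- The trace of an endomorphism of a finite-dimensional representation. -/
def tr {V : FDRep k G} (f : V ⟶ V) : k := LinearMap.trace k V (lin k f)

lemma tr_comm {V W : FDRep k G} (f : V ⟶ W) (g : W ⟶ V) : tr k (f ≫ g) = tr k (g ≫ f) :=
  (LinearMap.trace_comp_comm' (lin k f) (lin k g))

section PartialTrace

open TensorProduct

variable {Z V W : Type u} [AddCommGroup Z] [Module k Z] [FiniteDimensional k Z]
  [AddCommGroup V] [Module k V] [AddCommGroup W] [Module k W] [FiniteDimensional k W]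

/-- The partial trace over the first tensor factor. -/
def ptrace : (Z ⊗[k] W →ₗ[k] Z ⊗[k] V) →ₗ[k] (W →ₗ[k] V) :=
  TensorProduct.lift ((LinearMap.lsmul k (W →ₗ[k] V)).comp (LinearMap.trace k Z)) ∘ₗ
    (homTensorHomEquiv k Z W Z V).symm.toLinearMap

lemma ptrace_map (a : Z →ₗ[k] Z) (b : W →ₗ[k] V) :
    ptrace k (TensorProduct.map a b) = LinearMap.trace k Z a • b := by
  have : (homTensorHomEquiv k Z W Z V).symm (TensorProduct.map a b) = a ⊗ₜ b := by
    rw [LinearEquiv.symm_apply_eq, homTensorHomEquiv_apply]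
    rfl
  simp [ptrace, this]

lemma induction_map {P : (Z ⊗[k] W →ₗ[k] Z ⊗[k] V) → Prop} (h0 : P 0)
    (hmap : ∀ a b, P (TensorProduct.map a b)) (hadd : ∀ x y, P x → P y → P (x + y)) (x) : P x := by
  obtain ⟨t, rfl⟩ := (homTensorHomEquiv k Z W Z V).surjective x
  induction t with
  | zero => simpa using h0
  | tmul a b =>
    rw [homTensorHomEquiv_apply]
    exact hmap a b
  | add x y hx hy => simpa using hadd _ _ hx hy

lemma trace_comp_map_id [FiniteDimensional k V] (x : Z ⊗[k] W →ₗ[k] Z ⊗[k] V) (f : V →ₗ[k] W) :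
    LinearMap.trace k (Z ⊗[k] V) (x ∘ₗ TensorProduct.map LinearMap.id f) =
      LinearMap.trace k V (ptrace k x ∘ₗ f) := by
  induction x using induction_map with
  | h0 => simp
  | hmap a b =>
    rw [ptrace_map, ← TensorProduct.map_comp, LinearMap.trace_tensorProduct', LinearMap.smul_comp,
      map_smul, LinearMap.comp_id, smul_eq_mul]
  | hadd x y hx hy => simp only [map_add, LinearMap.add_comp, hx, hy]

lemma ptrace_conj (x : Z ⊗[k] W →ₗ[k] Z ⊗[k] V) (z z' : Z →ₗ[k] Z) (hz : z' ∘ₗ z = LinearMap.id)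
    (v : V →ₗ[k] V) (w : W →ₗ[k] W) :
    ptrace k (TensorProduct.map z v ∘ₗ x ∘ₗ TensorProduct.map z' w) = v ∘ₗ ptrace k x ∘ₗ w := by
  induction x using induction_map with
  | h0 => simp
  | hmap a b =>
    rw [ptrace_map, ← TensorProduct.map_comp, ← TensorProduct.map_comp, ptrace_map,
      LinearMap.trace_comp_comm', LinearMap.comp_assoc, hz, LinearMap.comp_id,
      LinearMap.smul_comp, LinearMap.comp_smul]
  | hadd x y hx hy => simp only [map_add, LinearMap.add_comp, LinearMap.comp_add, hx, hy]

end PartialTrace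

lemma tr_whiskerLeft (Z : FDRep k G) {V W : FDRep k G} (g : Z ⊗ W ⟶ Z ⊗ V) :
    ∃ g' : W ⟶ V, ∀ f : V ⟶ W, tr k (Z ◁ f ≫ g) = tr k (f ≫ g') := by
  let t : TensorProduct k Z W →ₗ[k] TensorProduct k Z V := lin k g
  refine ⟨ofLin k (ptrace k t) fun a => ?_, fun f => trace_comp_map_id k t (lin k f)⟩
  have h : ∀ {U : FDRep k G}, U.ρ a ∘ₗ U.ρ a⁻¹ = LinearMap.id := fun {U} => by
    rw [← Module.End.mul_eq_comp, ← map_mul, mul_inv_cancel, map_one]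
    rfl
  have h' : ∀ {U : FDRep k G}, U.ρ a⁻¹ ∘ₗ U.ρ a = LinearMap.id := fun {U} => by
    rw [← Module.End.mul_eq_comp, ← map_mul, inv_mul_cancel, map_one]
    rfl
  have ht : t ∘ₗ TensorProduct.map (Z.ρ a) (W.ρ a) = TensorProduct.map (Z.ρ a) (V.ρ a) ∘ₗ t :=
    lin_comm k g a
  have key := ptrace_conj k t (Z.ρ a) (Z.ρ a⁻¹) h' (V.ρ a) LinearMap.id
  have key2 := ptrace_conj k t LinearMap.id LinearMap.id rfl LinearMap.id (W.ρ a)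
  rw [← LinearMap.comp_assoc, ← ht, LinearMap.comp_assoc, ← TensorProduct.map_comp, h,
    LinearMap.comp_id] at key
  rw [TensorProduct.map_id, LinearMap.id_comp, LinearMap.id_comp] at key2
  rw [← key2, key, LinearMap.comp_id]

/-- The ideal of negligible morphisms: `f : V ⟶ W` with `tr (g ∘ f) = 0` for all `g : W ⟶ V`. -/
def negligible (G : Type v) [Group G] : TensorIdeal k (FDRep k G) where
  hom V W :=
    { carrier := {f | ∀ g : W ⟶ V, tr k (f ≫ g) = 0}
      add_mem' := fun {f f'} hf hf' g => by
        have : lin k ((f + f') ≫ g) = lin k (f ≫ g) + lin k (f' ≫ g) := by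
          rw [Preadditive.add_comp]; rfl
        rw [tr, this, map_add]
        exact (congrArg₂ (· + ·) (hf g) (hf' g)).trans (add_zero 0)
      zero_mem' := fun g => by
        rw [zero_comp]
        exact map_zero (LinearMap.trace k V)
      smul_mem' := fun a f hf g => by
        have : lin k ((a • f) ≫ g) = a • lin k (f ≫ g) := by
          rw [Linear.smul_comp]; rfl
        rw [tr, this, map_smul]
        exact (congrArg (a • ·) (hf g)).trans (smul_zero a) }
  comp_left f g hg h := by
    rw [Category.assoc, tr_comm, Category.assoc]
    exact hg _
  comp_right g hf h := by
    rw [Category.assoc]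
    exact hf _
  whiskerLeft Z {V W f} hf g := by
    obtain ⟨g', hg'⟩ := tr_whiskerLeft k Z g
    rw [hg']
    exact hf g'
  whiskerRight Z {V W f} hf g := by
    have e : f ▷ Z = (β_ V Z).hom ≫ Z ◁ f ≫ (β_ Z W).hom := by simp
    obtain ⟨g', hg'⟩ := tr_whiskerLeft k Z ((β_ Z W).hom ≫ g ≫ (β_ V Z).hom)
    rw [e, Category.assoc, tr_comm, Category.assoc, Category.assoc, hg']
    exact hf g'

lemma negligible_unit : 𝟙 (𝟙_ (FDRep k G)) ∉ (negligible k G).hom _ _ := by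
  intro h
  have := h (𝟙 _)
  rw [Category.comp_id] at this
  have e : LinearMap.trace k k LinearMap.id = 0 := this
  simp at e

/-- The negligible ideal is the largest proper tensor ideal of `Rep G`. -/
lemma le_negligible (J : TensorIdeal k (FDRep k G)) (hJ : 𝟙 (𝟙_ (FDRep k G)) ∉ J.hom _ _)
    (V W : FDRep k G) : J.hom V W ≤ (negligible k G).hom V W := by
  intro f hf g
  by_contra hne
  apply hJ
  let h : V ⟶ V := f ≫ g
  have hh : h ∈ J.hom V V := J.comp_right g hf
  let V' : FDRep k G := FDRep.of (Representation.dual V.ρ)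
  let t : TensorProduct k (Module.Dual k V) V := (dualTensorHomEquiv k V V).symm LinearMap.id
  have ht : dualTensorHom k V V t = LinearMap.id :=
    (dualTensorHomEquiv k V V).apply_symm_apply LinearMap.id
  have hinj : Function.Injective (dualTensorHom k V V) := (dualTensorHomEquiv k V V).injective
  have ht' : ∀ a : G, TensorProduct.map (Representation.dual V.ρ a) (V.ρ a) t = t := fun a => by
    apply hinj
    have h₁ := LinearMap.congr_fun (Representation.dualTensorHom_comm V.ρ V.ρ a) t
    rw [LinearMap.comp_apply, LinearMap.comp_apply, ht] at h₁
    refine h₁.trans (Eq.trans ?_ ht.symm)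
    change V.ρ a ∘ₗ LinearMap.id ∘ₗ V.ρ a⁻¹ = LinearMap.id
    rw [LinearMap.id_comp, ← Module.End.mul_eq_comp, ← map_mul, mul_inv_cancel, map_one]
    rfl
  let co : 𝟙_ (FDRep k G) ⟶ V' ⊗ V := ofLin k (V := 𝟙_ (FDRep k G)) (W := V' ⊗ V)
    (LinearMap.toSpanSingleton k (TensorProduct k (Module.Dual k V) V) t) (fun a => by
      change LinearMap.toSpanSingleton k (TensorProduct k (Module.Dual k V) V) t ∘ₗ
        LinearMap.id = TensorProduct.map (Representation.dual V.ρ a) (V.ρ a) ∘ₗ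
          LinearMap.toSpanSingleton k (TensorProduct k (Module.Dual k V) V) t
      refine LinearMap.ext_ring ?_
      simp only [LinearMap.comp_apply, LinearMap.id_apply, LinearMap.toSpanSingleton_apply,
        one_smul]
      exact (ht' a).symm)
  let ev : V' ⊗ V ⟶ 𝟙_ (FDRep k G) := ofLin k (V := V' ⊗ V) (W := 𝟙_ (FDRep k G))
    (contractLeft k V) (fun a => by
      change contractLeft k V ∘ₗ TensorProduct.map (Representation.dual V.ρ a) (V.ρ a) =
        LinearMap.id ∘ₗ contractLeft k V
      refine TensorProduct.ext' fun φ v => ?_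
      have hv : V.ρ a⁻¹ (V.ρ a v) = v := by
        rw [← Module.End.mul_apply, ← map_mul, inv_mul_cancel, map_one]
        rfl
      simp [Module.Dual.transpose_apply, hv])
  have key : co ≫ V' ◁ h ≫ ev = tr k h • 𝟙 (𝟙_ (FDRep k G)) := by
    refine Action.Hom.ext (FGModuleCat.hom_ext ?_)
    change contractLeft k V ∘ₗ TensorProduct.map LinearMap.id (lin k h) ∘ₗ
      LinearMap.toSpanSingleton k (TensorProduct k (Module.Dual k V) V) t =
        tr k h • (LinearMap.id : k →ₗ[k] k)
    have h₂ : ∀ x : TensorProduct k (Module.Dual k V) V,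
        dualTensorHom k V V (TensorProduct.map LinearMap.id (lin k h) x) =
          lin k h ∘ₗ dualTensorHom k V V x := fun x => by
      induction x with
      | zero => simp
      | tmul φ v => ext w; simp
      | add x y hx hy => simp only [map_add, hx, hy, LinearMap.comp_add]
    ext
    have h₃ : contractLeft k V (TensorProduct.map LinearMap.id (lin k h) t) = tr k h := by
      rw [← LinearMap.trace_eq_contract_apply, h₂, ht, LinearMap.comp_id]
      rfl
    simp [h₃]
  have := J.comp_left co (J.comp_right ev (J.whiskerLeft V' hh))
  rw [key] at this
  exact ((J.hom _ _).smul_mem_iff hne).1 this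

end Rep

section Envelope

variable (k : Type u) [Field k] {G : Type v} [Group G] (N : Subgroup G) [N.Normal]

/-- For `g ∈ G`, the automorphism `n ↦ g⁻¹ n g` of `N`. -/
def conjInv (g : G) : N →* N := (MulAut.conjNormal g⁻¹ : MulAut N).toMonoidHom

lemma coe_conjInv (g : G) (n : N) : (conjInv N g n : G) = g⁻¹ * n * g := by
  simp [conjInv]

/-- The twist of a representation of `N` by `g ∈ G`: on the same vector space, `n ∈ N` now acts
as `g⁻¹ n g` did before. -/
abbrev twist (g : G) : FDRep k N ⥤ FDRep k N := resFunctor k (conjInv N g)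

variable (s : G ⧸ N → G) (hs : ∀ q : G ⧸ N, (s q : G ⧸ N) = q)

/-- For coset representatives `s q`, `s r`, `s t` with `q r = t`, the element `n ∈ N` such that
`s q * s r = s t * n`. -/
def cocycle {q r t : G ⧸ N} (h : q * r = t) : N :=
  ⟨(s t)⁻¹ * (s q * s r), by
    rw [← QuotientGroup.eq, QuotientGroup.mk_mul, hs, hs, hs, h]⟩

lemma s_one_mem (s : G ⧸ N → G) (hs : ∀ q : G ⧸ N, (s q : G ⧸ N) = q) : s 1 ∈ N := by
  rw [← QuotientGroup.eq_one_iff, hs]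

/-- The isomorphism `T q ∘ T r ≅ T t` for `q r = t`: it is `v ↦ n v` where
`s q * s r = s t * n`. -/
def twistComp {q r t : G ⧸ N} (h : q * r = t) :
    twist k N (s r) ⋙ twist k N (s q) ≅ twist k N (s t) :=
  resIso k ((conjInv N (s r)).comp (conjInv N (s q))) (conjInv N (s t)) (cocycle N s hs h)
    fun m => Subtype.ext (by
      simp only [MonoidHom.comp_apply, Subgroup.coe_mul, coe_conjInv, cocycle]
      group)

/-- The isomorphism `id ≅ T 1`: it is `v ↦ (s 1)⁻¹ v`. -/
def twistUnit : 𝟭 (FDRep k N) ≅ twist k N (s 1) :=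
  resIso k (MonoidHom.id N) (conjInv N (s 1)) ⟨(s 1)⁻¹, N.inv_mem (s_one_mem N s hs)⟩
    fun m => Subtype.ext (by
      simp only [MonoidHom.id_apply, Subgroup.coe_mul, coe_conjInv]
      group)

/-- The action of `Q = G / N` on `Rep N`, for a choice `s` of coset representatives. -/
def repAction : SymmetricAction k (G ⧸ N) (FDRep k N) where
  T q := twist k N (s q)
  additive _ := inferInstance
  linear _ := inferInstance
  braided _ := inferInstance
  compIso h := twistComp k N s hs h
  unitIso := twistUnit k N s hs
  compIso_isMonoidal h :=
    { unit := Action.Hom.ext (by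
        change (𝟙 (𝟙_ (FGModuleCat k)) ≫ 𝟙 (𝟙_ (FGModuleCat k))) ≫ 𝟙 (𝟙_ (FGModuleCat k)) =
          𝟙 (𝟙_ (FGModuleCat k))
        simp)
      tensor := fun X Y => Action.Hom.ext (by
        change (𝟙 (X.V ⊗ Y.V) ≫ 𝟙 (X.V ⊗ Y.V)) ≫
          (Action.ρ X (cocycle N s hs h) ⊗ₘ Action.ρ Y (cocycle N s hs h)) =
          (Action.ρ X (cocycle N s hs h) ⊗ₘ Action.ρ Y (cocycle N s hs h)) ≫ 𝟙 (X.V ⊗ Y.V)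
        simp) }
  unitIso_isMonoidal :=
    { unit := Action.Hom.ext (by
        change 𝟙 (𝟙_ (FGModuleCat k)) ≫ 𝟙 (𝟙_ (FGModuleCat k)) = 𝟙 (𝟙_ (FGModuleCat k))
        simp)
      tensor := fun X Y => Action.Hom.ext ((Category.id_comp _).trans (Category.comp_id _).symm) }
  assoc {q r t qr rt u} h₁ h₂ h₃ h₄ X := Action.Hom.ext (by
    have e : cocycle N s hs h₃ * conjInv N (s t) (cocycle N s hs h₁) =
        cocycle N s hs h₄ * cocycle N s hs h₂ := Subtype.ext (by
      simp only [Subgroup.coe_mul, coe_conjInv, cocycle]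
      group)
    exact (ρ_comp k X _ _).trans ((congrArg (Action.ρ X) e).trans (ρ_comp k X _ _).symm))
  unit_left q X := Action.Hom.ext (by
    have e : cocycle N s hs (one_mul q) *
        conjInv N (s q) ⟨(s 1)⁻¹, N.inv_mem (s_one_mem N s hs)⟩ = 1 := Subtype.ext (by
      simp only [Subgroup.coe_mul, coe_conjInv, cocycle, Subgroup.coe_one]
      group)
    exact (ρ_comp k X _ _).trans ((congrArg (Action.ρ X) e).trans (map_one (Action.ρ X))))
  unit_right q X := Action.Hom.ext (by
    have e : cocycle N s hs (mul_one q) *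
        ⟨(s 1)⁻¹, N.inv_mem (s_one_mem N s hs)⟩ = 1 := Subtype.ext (by
      simp only [Subgroup.coe_mul, cocycle, Subgroup.coe_one]
      group)
    exact (ρ_comp k X _ _).trans ((congrArg (Action.ρ X) e).trans (map_one (Action.ρ X))))

lemma negligible_twist (g : G) ⦃V W : FDRep k N⦄ ⦃f : V ⟶ W⦄
    (hf : f ∈ (negligible k N).hom V W) :
    (twist k N g).map f ∈ (negligible k N).hom ((twist k N g).obj V) ((twist k N g).obj W) := by
  intro h
  have hcomm : ∀ n : N, Action.ρ W n ≫ h.hom = h.hom ≫ Action.ρ V n := fun n => by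
    have e : conjInv N g (conjInv N g⁻¹ n) = n := Subtype.ext (by
      simp only [coe_conjInv]
      group)
    have := h.comm (conjInv N g⁻¹ n)
    change Action.ρ W (conjInv N g (conjInv N g⁻¹ n)) ≫ h.hom =
      h.hom ≫ Action.ρ V (conjInv N g (conjInv N g⁻¹ n)) at this
    rwa [e] at this
  exact hf ⟨h.hom, hcomm⟩

/-- The semisimplification of `Rep N`: the quotient by the ideal of negligible morphisms. -/
abbrev Semisimplification (N : Type v) [Group N] : Type (max (u + 1) v) := (negligible k N).Quot

/-- The induced action of `Q = G / N` on the semisimplification of `Rep N`. -/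
def semisimpleAction : SymmetricAction k (G ⧸ N) (Semisimplification k N) :=
  (repAction k N s hs).quotient (negligible k N) fun q => negligible_twist k N (s q)

/-- The ideal `I_N` of `Rep G`: the preimage under restriction of the negligible ideal of
`Rep N`. -/
def idealOf : TensorIdeal k (FDRep k G) := (negligible k N).comap (resFunctor k N.subtype)

/-- Restriction to `N` followed by semisimplification. -/
abbrev resSemisimple : FDRep k G ⥤ Semisimplification k N :=
  resFunctor k N.subtype ⋙ (negligible k N).proj

/-- For `V ∈ Rep G`, the isomorphism from the twist by `g` of the restriction of `V` to the
restriction of `V`, given by `v ↦ g v`. -/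
def resTwist (g : G) : resFunctor k N.subtype ⋙ twist k N g ≅ resFunctor k N.subtype :=
  resIso k (N.subtype.comp (conjInv N g)) N.subtype g fun m => by
    simp only [MonoidHom.comp_apply, Subgroup.coe_subtype, coe_conjInv]
    group

/-- The isomorphism `resTwist` for `g = s q` on the semisimplification. -/
def resSemisimpleTwist (q : G ⧸ N) :
    resSemisimple k N ⋙ (semisimpleAction k N s hs).T q ≅ resSemisimple k N :=
  Functor.isoWhiskerRight (resTwist k N (s q)) (negligible k N).proj

instance (q : G ⧸ N) : NatTrans.IsMonoidal (resSemisimpleTwist k N s hs q).hom where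
  unit := congrArg (negligible k N).proj.map
    (a₁ := ((𝟙 _ ≫ ε (twist k N (s q))) ≫
      (twist k N (s q)).map (𝟙 _ ≫ ε (resFunctor k N.subtype))) ≫
        (resTwist k N (s q)).hom.app (𝟙_ (FDRep k G)))
    (a₂ := 𝟙 _ ≫ ε (resFunctor k N.subtype)) (Action.Hom.ext (by
      change ((𝟙 (𝟙_ (FGModuleCat k)) ≫ 𝟙 (𝟙_ (FGModuleCat k))) ≫
        (𝟙 (𝟙_ (FGModuleCat k)) ≫ 𝟙 (𝟙_ (FGModuleCat k)))) ≫ 𝟙 (𝟙_ (FGModuleCat k)) =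
          𝟙 (𝟙_ (FGModuleCat k)) ≫ 𝟙 (𝟙_ (FGModuleCat k))
      simp))
  tensor X Y := congrArg (negligible k N).proj.map
    (a₁ := ((𝟙 _ ≫ μ (twist k N (s q)) ((resFunctor k N.subtype).obj X)
        ((resFunctor k N.subtype).obj Y)) ≫
      (twist k N (s q)).map (𝟙 _ ≫ μ (resFunctor k N.subtype) X Y)) ≫
        (resTwist k N (s q)).hom.app (X ⊗ Y))
    (a₂ := ((resTwist k N (s q)).hom.app X ▷ _ ≫ _ ◁ (resTwist k N (s q)).hom.app Y) ≫
      (𝟙 _ ≫ μ (resFunctor k N.subtype) X Y)) (Action.Hom.ext (by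
      change ((𝟙 (X.V ⊗ Y.V) ≫ 𝟙 (X.V ⊗ Y.V)) ≫ (𝟙 (X.V ⊗ Y.V) ≫ 𝟙 (X.V ⊗ Y.V))) ≫
        (Action.ρ X (s q) ⊗ₘ Action.ρ Y (s q)) =
          (Action.ρ X (s q) ▷ Y.V ≫ X.V ◁ Action.ρ Y (s q)) ≫ 𝟙 (X.V ⊗ Y.V) ≫ 𝟙 (X.V ⊗ Y.V)
      simp [MonoidalCategory.tensorHom_def]))

lemma resSemisimpleTwist_comp {q r t : G ⧸ N} (h : q * r = t) (X : FDRep k G) :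
    ((semisimpleAction k N s hs).compIso h).hom.app ((resSemisimple k N).obj X) ≫
        (resSemisimpleTwist k N s hs t).hom.app X =
      ((semisimpleAction k N s hs).T q).map ((resSemisimpleTwist k N s hs r).hom.app X) ≫
        (resSemisimpleTwist k N s hs q).hom.app X :=
  congrArg (negligible k N).proj.map (Action.Hom.ext (by
    have e : s t * (cocycle N s hs h : G) = s q * s r := by
      simp only [cocycle]
      group
    exact (ρ_comp k X _ _).trans ((congrArg (Action.ρ X) e).trans (ρ_comp k X _ _).symm)))

/-- The functor `Rep G ⥤ (semisimplification of Rep N)^Q`: a representation `V` of `G` is sent to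
its restriction to `N`, with the isomorphisms `T q V ≅ V`, `v ↦ (s q) v`. -/
def toEquivariant : FDRep k G ⥤ (semisimpleAction k N s hs).EquivariantObject :=
  SymmetricAction.EquivariantObject.lift (resSemisimple k N) (resSemisimpleTwist k N s hs)
    (resSemisimpleTwist_comp k N s hs)

instance : (toEquivariant k N s hs).Additive :=
  SymmetricAction.EquivariantObject.lift_additive (resSemisimple k N)
    (resSemisimpleTwist k N s hs) (resSemisimpleTwist_comp k N s hs)
instance : (toEquivariant k N s hs).Linear k :=
  SymmetricAction.EquivariantObject.lift_linear (resSemisimple k N)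
    (resSemisimpleTwist k N s hs) (resSemisimpleTwist_comp k N s hs)
instance : (toEquivariant k N s hs).Braided :=
  SymmetricAction.EquivariantObject.liftBraided (resSemisimple k N)
    (resSemisimpleTwist k N s hs) (resSemisimpleTwist_comp k N s hs)

/-- The functor `Φ : (Rep G) / I_N ⥤ (semisimplification of Rep N)^Q` induced by
`toEquivariant`. -/
def envelopeFunctor : (idealOf k N).Quot ⥤ (semisimpleAction k N s hs).EquivariantObject :=
  (idealOf k N).lift (toEquivariant k N s hs) fun V W f hf =>
    SymmetricAction.EquivariantObject.hom_ext
      (((negligible k N).proj_map_eq_iff ((resFunctor k N.subtype).map f) 0).2 (by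
        rw [sub_zero]
        exact hf))

instance : (envelopeFunctor k N s hs).Additive :=
  inferInstanceAs (TensorIdeal.lift _ _ _).Additive
instance : (envelopeFunctor k N s hs).Linear k :=
  inferInstanceAs ((TensorIdeal.lift _ _ _).Linear k)
instance : (envelopeFunctor k N s hs).Braided :=
  inferInstanceAs (TensorIdeal.lift _ _ _).Braided

end Envelope

section TensorCategories

variable (k : Type u) [Field k]

/-- A pseudo-tensor category over `k`: an essentially small, pseudo-abelian, rigid `k`-linear
monoidal category with finite-dimensional morphism spaces and `End(𝟙) = k`. -/
structure IsPseudoTensorCategory (C : Type u₁) [Category.{v₁} C] [Preadditive C] [Linear k C]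
    [MonoidalCategory C] [MonoidalPreadditive C] [MonoidalLinear k C] : Prop where
  essentiallySmall : EssentiallySmall.{v₁} C
  hasFiniteBiproducts : HasFiniteBiproducts C
  isIdempotentComplete : IsIdempotentComplete C
  finite_hom : ∀ X Y : C, Module.Finite k (X ⟶ Y)
  bijective_unit : Function.Bijective (fun a : k => a • 𝟙 (𝟙_ C))
  hasLeftDual : ∀ X : C, Nonempty (HasLeftDual X)
  hasRightDual : ∀ X : C, Nonempty (HasRightDual X)

/-- A tensor category over `k`: an essentially small, abelian, rigid `k`-linear monoidal category
in which all objects have finite length, with `End(𝟙) = k`. -/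
structure IsTensorCategory (C : Type u₁) [Category.{v₁} C] [Preadditive C] [Linear k C]
    [MonoidalCategory C] [MonoidalPreadditive C] [MonoidalLinear k C] : Prop where
  essentiallySmall : EssentiallySmall.{v₁} C
  hasFiniteProducts : HasFiniteProducts C
  hasKernels : HasKernels C
  hasCokernels : HasCokernels C
  isNormalMonoCategory : IsNormalMonoCategory C
  isNormalEpiCategory : IsNormalEpiCategory C
  isNoetherianObject : ∀ X : C, IsNoetherianObject X
  isArtinianObject : ∀ X : C, IsArtinianObject X
  bijective_unit : Function.Bijective (fun a : k => a • 𝟙 (𝟙_ C))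
  hasLeftDual : ∀ X : C, Nonempty (HasLeftDual X)
  hasRightDual : ∀ X : C, Nonempty (HasRightDual X)

/-- A `k`-linear exact functor. -/
structure IsLinearExact {C : Type u₁} [Category.{v₁} C] [Preadditive C] [Linear k C]
    {D : Type u₂} [Category.{v₂} D] [Preadditive D] [Linear k D] (E : C ⥤ D) : Prop where
  additive : E.Additive
  linear : E.Linear k
  preservesFiniteLimits : PreservesFiniteLimits E
  preservesFiniteColimits : PreservesFiniteColimits E

/-- A tensor functor `Φ : A ⥤ C` is an abelian envelope if it is a faithful tensor functor from a
pseudo-tensor category to a tensor category that is universal among the faithful tensor functors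
from `A` to tensor categories `D` over `k`: every such functor extends along `Φ` to an exact tensor
functor `C ⥤ D`, and monoidal transformations between two exact tensor functors `C ⥤ D` are the
same as monoidal transformations between their restrictions along `Φ` (so that the extension is
unique up to a unique monoidal isomorphism). -/
structure IsAbelianEnvelope {A : Type u₁} [Category.{v₁} A] [Preadditive A] [Linear k A]
    [MonoidalCategory A] [MonoidalPreadditive A] [MonoidalLinear k A]
    {C : Type u₂} [Category.{v₂} C] [Preadditive C] [Linear k C]
    [MonoidalCategory C] [MonoidalPreadditive C] [MonoidalLinear k C]
    (Φ : A ⥤ C) [Φ.Additive] [Φ.Linear k] [Φ.Monoidal] : Prop where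
  isPseudoTensorCategory : IsPseudoTensorCategory k A
  isTensorCategory : IsTensorCategory k C
  faithful : Φ.Faithful
  exists_extension : ∀ (D : Type u₃) [Category.{v₃} D] [Preadditive D] [Linear k D]
    [MonoidalCategory D] [MonoidalPreadditive D] [MonoidalLinear k D],
    IsTensorCategory k D → ∀ (F : A ⥤ D) [F.Additive] [F.Linear k] [F.Monoidal] [F.Faithful],
      ∃ (E : C ⥤ D) (_ : E.Monoidal), IsLinearExact k E ∧
        ∃ e : Φ ⋙ E ≅ F, NatTrans.IsMonoidal e.hom
  existsUnique_natTrans : ∀ (D : Type u₃) [Category.{v₃} D] [Preadditive D] [Linear k D]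
    [MonoidalCategory D] [MonoidalPreadditive D] [MonoidalLinear k D],
    IsTensorCategory k D → ∀ (E E' : C ⥤ D) [E.Monoidal] [E'.Monoidal],
      IsLinearExact k E → IsLinearExact k E' →
        ∀ τ : Φ ⋙ E ⟶ Φ ⋙ E', NatTrans.IsMonoidal τ →
          ∃! σ : E ⟶ E', NatTrans.IsMonoidal σ ∧ Functor.whiskerLeft Φ σ = τ

end TensorCategories

end

end TensorEnvelope

namespace TensorEnvelope

open CategoryTheory MonoidalCategory Limits Functor.LaxMonoidal Functor.OplaxMonoidal

noncomputable section

/-! ### Duality: tensoring with a dualizable object, and images of dual pairs -/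

section Duals

variable {C : Type u₁} [Category.{v₁} C] [MonoidalCategory C]

/-! The proof rests on a general criterion. Let Φ : A ⥤ C be a faithful tensor functor to a tensor
category. Suppose A contains an object X with nonzero morphisms e : X ⟶ 𝟙 and i : 𝟙 ⟶ X, and there
is a functor J : C ⥤ A lifting Y ↦ Φ X ⊗ Y, such that Φ is full on morphisms from and to the objects
J Y and J splits exact sequences (`Presentation`). The unit of a tensor category is simple: for a
subobject U of 𝟙 the composite of U ⟶ 𝟙 with its dual 𝟙 ⟶ Uᘁ is an isomorphism, so U is a summand
(`isSplitMono_of_mono_unit`), and End 𝟙 = k leaves only 0 and 𝟙. Hence a faithful tensor functor to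
a tensor category makes e epi and i mono, and rigidity keeps them so after tensoring. Every Y in C
is therefore the image of a composite Φ (J Y) ⟶ Y ⟶ Φ (J Y), and by fullness this composite is Φ φ
for some φ in A.

Given a faithful tensor functor F : A ⥤ D, this forces E Y to be the image of F φ. For Y = Φ V the
factorisation of φ through V exists already in A, and F makes its two halves epi and mono, so E ∘ Φ
≅ F (`exists_extension_functor`). The objects E Y ⊗ E Z and E (Y ⊗ Z) are images of the same
morphism, which gives the monoidal structure (`exists_tensorIso`, `exists_monoidal`). Since E (Φ X)
⊗ E (-) ≅ F ∘ J turns exact sequences into split ones, and tensoring with a nonzero object reflects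
exactness, E is exact (`isLinearExact_of_monoidal`). Transformations extend uniquely because Y is a
quotient and a subobject of Φ (J Y).

For the criterion to apply, the target must be a tensor category. A finite-dimensional algebra is
von Neumann regular modulo its radical, and radical elements are nilpotent, hence of trace zero. So
every f in the semisimplification of Rep N satisfies f r f = f for some r
(`exists_sub_mem_negligible`). Regularity and idempotent completeness make the equivariantization
abelian, with exact sequences that split once the equivariant structure is forgotten
(`exists_contraction`). Nothing is divided by the order of Q, which p may divide.

The presentation is induction from N to G: X is induced from 𝟙, J Y is induced from the underlying
object of Y, and the isomorphism J Y ≅ X ⊗ Y is the projection formula. Every equivariant morphism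
from or to an induced object is a sum of Q-conjugates, a `trace`. Such sums come from Rep G, where
the same sum is taken over coset representatives (`map_average`). This is the required fullness;
contractions survive because J depends only on the underlying object. -/

lemma isLeftAdjoint_tensorLeft (X : C) [HasLeftDual X] : (tensorLeft X).IsLeftAdjoint :=
  (tensorLeftAdjunction (ᘁX) X).isLeftAdjoint

lemma isRightAdjoint_tensorLeft (X : C) [HasRightDual X] : (tensorLeft X).IsRightAdjoint :=
  (tensorLeftAdjunction X (Xᘁ)).isRightAdjoint

lemma isLeftAdjoint_tensorRight (X : C) [HasRightDual X] : (tensorRight X).IsLeftAdjoint :=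
  (tensorRightAdjunction X (Xᘁ)).isLeftAdjoint

lemma isRightAdjoint_tensorRight (X : C) [HasLeftDual X] : (tensorRight X).IsRightAdjoint :=
  (tensorRightAdjunction (ᘁX) X).isRightAdjoint

/-- Left adjoints preserve epimorphisms and right adjoints preserve monomorphisms; the side of the
dual decides which of the two is available. -/
lemma epi_whiskerLeft (X : C) [HasLeftDual X] {Y Z : C} (f : Y ⟶ Z) [Epi f] : Epi (X ◁ f) :=
  have := isLeftAdjoint_tensorLeft X
  inferInstanceAs (Epi ((tensorLeft X).map f))

lemma mono_whiskerLeft (X : C) [HasRightDual X] {Y Z : C} (f : Y ⟶ Z) [Mono f] : Mono (X ◁ f) :=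
  have := isRightAdjoint_tensorLeft X
  inferInstanceAs (Mono ((tensorLeft X).map f))

lemma epi_whiskerRight (X : C) [HasRightDual X] {Y Z : C} (f : Y ⟶ Z) [Epi f] : Epi (f ▷ X) :=
  have := isLeftAdjoint_tensorRight X
  inferInstanceAs (Epi ((tensorRight X).map f))

lemma mono_whiskerRight (X : C) [HasLeftDual X] {Y Z : C} (f : Y ⟶ Z) [Mono f] : Mono (f ▷ X) :=
  have := isRightAdjoint_tensorRight X
  inferInstanceAs (Mono ((tensorRight X).map f))

variable {D : Type u₂} [Category.{v₂} D] [MonoidalCategory D] (F : C ⥤ D) [F.Monoidal]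

/-- A monoidal functor maps dual pairs to dual pairs. -/
@[reducible]
def exactPairingMap (X Y : C) [ExactPairing X Y] : ExactPairing (F.obj X) (F.obj Y) where
  coevaluation' := ε F ≫ F.map (η_ X Y) ≫ δ F X Y
  evaluation' := μ F Y X ≫ F.map (ε_ X Y) ≫ η F
  coevaluation_evaluation' := by
    have h := congrArg F.map (ExactPairing.coevaluation_evaluation X Y)
    simp only [Functor.map_comp, Functor.Monoidal.map_whiskerLeft, Functor.Monoidal.map_whiskerRight,
      Functor.Monoidal.map_associator_inv, Functor.Monoidal.map_leftUnitor_inv,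
      Functor.Monoidal.map_rightUnitor, Category.assoc, Functor.Monoidal.μ_δ_assoc] at h
    rw [cancel_epi] at h
    simp only [← Category.assoc] at h
    rw [cancel_mono] at h
    simp only [Category.assoc] at h
    -- The image of the zigzag has `F (𝟙)` in place of the unit; composing with `ε F` and `η F` on
    -- the outside removes it.
    have h' := F.obj Y ◁ ε F ≫= (h =≫ η F ▷ F.obj Y)
    simp only [Category.assoc, ← comp_whiskerRight, Functor.Monoidal.ε_η, id_whiskerRight,
      Category.comp_id, ← MonoidalCategory.whiskerLeft_comp_assoc, MonoidalCategory.whiskerLeft_id,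
      Category.id_comp] at h'
    simpa using h'
  evaluation_coevaluation' := by
    have h := congrArg F.map (ExactPairing.evaluation_coevaluation X Y)
    simp only [Functor.map_comp, Functor.Monoidal.map_whiskerLeft, Functor.Monoidal.map_whiskerRight,
      Functor.Monoidal.map_associator, Functor.Monoidal.map_leftUnitor,
      Functor.Monoidal.map_rightUnitor_inv, Category.assoc, Functor.Monoidal.μ_δ_assoc] at h
    rw [cancel_epi] at h
    simp only [← Category.assoc] at h
    rw [cancel_mono] at h
    simp only [Category.assoc] at h
    have h' := ε F ▷ F.obj X ≫= (h =≫ F.obj X ◁ η F)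
    simp only [Category.assoc, ← MonoidalCategory.whiskerLeft_comp, Functor.Monoidal.ε_η,
      MonoidalCategory.whiskerLeft_id, Category.comp_id, ← comp_whiskerRight_assoc, id_whiskerRight,
      Category.id_comp] at h'
    simpa using h'

end Duals

/-! ### Simplicity of the unit of a tensor category -/

section SimpleUnit

variable {C : Type u₁} [Category.{v₁} C] [Abelian C] [MonoidalCategory C] [MonoidalPreadditive C]

/-- In a rigid abelian monoidal category, a subobject of the unit is a direct summand. -/
lemma isSplitMono_of_mono_unit (hL : ∀ X : C, Nonempty (HasLeftDual X))
    (hR : ∀ X : C, Nonempty (HasRightDual X)) {U : C} (i : U ⟶ 𝟙_ C) [Mono i] :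
    ∃ r, i ≫ r = 𝟙 U := by
  have := fun X => (hL X).some
  have := fun X => (hR X).some
  -- `i ▷ T` is mono, and `U ◁ t` followed by it is `i ≫ t` up to unitors.
  have hp : ∀ {T : C} (t : 𝟙_ C ⟶ T), i ≫ t = 0 → U ◁ t = 0 := fun {T} t ht => by
    have := mono_whiskerRight T i
    rw [← cancel_mono (i ▷ T), zero_comp, whisker_exchange, whiskerRight_id, Category.assoc,
      Category.assoc, id_whiskerLeft, ← unitors_inv_equal, Iso.inv_hom_id_assoc,
      reassoc_of% ht, zero_comp, comp_zero]
  -- `m` is the dual of `i`. Once `i ≫ m : U ⟶ Uᘁ` is known to be an isomorphism, `m` followed by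
  -- its inverse is the retraction.
  let m : 𝟙_ C ⟶ Uᘁ := η_ U (Uᘁ) ≫ i ▷ Uᘁ ≫ (λ_ _).hom
  have h1 : ∀ {Z : C} (z : Uᘁ ⟶ Z), η_ U (Uᘁ) ≫ U ◁ z = 0 → z = 0 := fun {Z} z hz => by
    have e : Uᘁ ◁ (η_ U (Uᘁ) ≫ U ◁ z) ≫ (α_ _ _ _).inv ≫ ε_ U (Uᘁ) ▷ Z =
        (ρ_ _).hom ≫ z ≫ (λ_ Z).inv := by
      rw [MonoidalCategory.whiskerLeft_comp, Category.assoc, associator_inv_naturality_right_assoc,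
        whisker_exchange, ExactPairing.coevaluation_evaluation_assoc, id_whiskerLeft]
      simp
    rw [hz, MonoidalPreadditive.whiskerLeft_zero, zero_comp] at e
    rw [← cancel_mono (λ_ Z).inv, ← cancel_epi (ρ_ (Uᘁ)).hom, ← e, zero_comp, comp_zero]
  have h2 : ∀ {Z : C} (z : Uᘁ ⟶ Z), m ≫ z = 0 → z = 0 := fun {Z} z hz => by
    have := mono_whiskerRight Z i
    refine h1 z ?_
    rw [← cancel_mono (i ▷ Z), ← cancel_mono (λ_ Z).hom, zero_comp, zero_comp, Category.assoc,
      Category.assoc, whisker_exchange_assoc, leftUnitor_naturality, ← hz]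
    simp [m]
  have hm : Epi m := Preadditive.epi_of_cancel_zero _ fun z hz => h2 z hz
  -- `hp` kills `U ◁ (m ≫ z)`, and `U ◁ m` is epi, so `U ◁ z = 0`.
  have h3 : ∀ {Z : C} (z : Uᘁ ⟶ Z), i ≫ m ≫ z = 0 → z = 0 := fun {Z} z hz => by
    have := epi_whiskerLeft U m
    have h := hp _ hz
    rw [MonoidalCategory.whiskerLeft_comp] at h
    refine h1 z ?_
    rw [zero_of_epi_comp _ h, comp_zero]
  have h4 : Mono (i ≫ m) := by
    refine Preadditive.mono_of_kernel_zero ?_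
    -- The kernel `x : T ⟶ U` satisfies `x ▷ U = 0`, so `T ◁ i = 0`. This kills `i ≫ η` for the
    -- coevaluation of `T`, then `T ◁ η`, and a zigzag identity for `T` gives `x = 0`.
    let T := kernel (i ≫ m)
    let x : T ⟶ U := kernel.ι (i ≫ m)
    change x = 0
    have hx : x ≫ i ≫ m = 0 := kernel.condition _
    have hm' : m ▷ U ≫ ε_ U (Uᘁ) = (λ_ U).hom ≫ i := by
      have e := ExactPairing.evaluation_coevaluation U (Uᘁ)
      have e' : m ▷ U ≫ ε_ U (Uᘁ) = (η_ U (Uᘁ) ▷ U ≫ (α_ _ _ _).hom ≫ U ◁ ε_ U (Uᘁ)) ≫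
          i ▷ _ ≫ (λ_ _).hom := by
        rw [Category.assoc, Category.assoc, whisker_exchange_assoc]
        simp [m]
      rw [e', e]
      simp only [whiskerRight_id, Category.assoc, unitors_equal, Iso.inv_hom_id_assoc,
        Iso.inv_hom_id, Category.comp_id]
    have hxU : x ▷ U = 0 := by
      have := mono_whiskerRight U i
      rw [← cancel_mono (i ▷ U), zero_comp, ← cancel_mono (λ_ U).hom, ← cancel_mono i, zero_comp,
        zero_comp, Category.assoc, Category.assoc, ← hm', ← comp_whiskerRight_assoc,
        ← comp_whiskerRight_assoc, Category.assoc, hx, MonoidalPreadditive.zero_whiskerRight,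
        zero_comp]
    have hTi : T ◁ i = 0 := by
      have := mono_whiskerRight (𝟙_ C) x
      rw [← cancel_mono (x ▷ 𝟙_ C), whisker_exchange, hxU, zero_comp, zero_comp]
    have hiη : i ≫ η_ (ᘁT) T = 0 := by
      rw [← cancel_epi (λ_ U).hom, ← leftUnitor_naturality_assoc, comp_zero, unitors_equal,
        ← rightUnitor_naturality, whisker_exchange_assoc]
      have : ((ᘁT) ⊗ T) ◁ i = 0 := by simp [hTi]
      rw [this, zero_comp, comp_zero]
    have hTη : T ◁ η_ (ᘁT) T = 0 := by
      have := mono_whiskerRight ((ᘁT) ⊗ T) x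
      rw [← cancel_mono (x ▷ ((ᘁT) ⊗ T)), whisker_exchange, hp _ hiη, comp_zero, zero_comp]
    have e := ExactPairing.coevaluation_evaluation (ᘁT) T
    rw [hTη, zero_comp] at e
    rw [← cancel_epi (ρ_ T).hom, ← Category.id_comp x, ← (λ_ T).inv_hom_id, Category.assoc, ← reassoc_of% e]
    simp
  have h5 : Epi (i ≫ m) := Preadditive.epi_of_cancel_zero _ fun z hz => h3 z (by simpa using hz)
  have := isIso_of_mono_of_epi (i ≫ m)
  exact ⟨m ≫ inv (i ≫ m), by rw [← Category.assoc, IsIso.hom_inv_id]⟩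

variable {k : Type u} [Field k] [Linear k C]

/-- The idempotent `r ≫ i` of the unit is a scalar `a`, and `a • i = i` with `i ≠ 0` forces `a = 1`.
-/
lemma isIso_of_mono_unit (h : Function.Bijective (fun a : k => a • 𝟙 (𝟙_ C)))
    (hL : ∀ X : C, Nonempty (HasLeftDual X))
    (hR : ∀ X : C, Nonempty (HasRightDual X)) {U : C} (i : U ⟶ 𝟙_ C) [Mono i] (hi : i ≠ 0) :
    IsIso i := by
  obtain ⟨r, hr⟩ := isSplitMono_of_mono_unit hL hR i
  obtain ⟨a, ha⟩ := h.2 (r ≫ i)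
  have ha' : a • i = i := by
    have := i ≫= ha
    simpa [reassoc_of% hr] using this
  have : a = 1 := by
    by_contra hne
    apply hi
    have h0 : (a - 1) • i = 0 := by rw [sub_smul, ha', one_smul, sub_self]
    exact (smul_eq_zero.1 h0).resolve_left (sub_ne_zero.2 hne)
  refine ⟨r, hr, ?_⟩
  rw [← ha, this]
  exact one_smul _ _

/-- The unit of a tensor category is simple: nonzero morphisms to it are epimorphisms. -/
lemma epi_of_ne_zero_unit (h : Function.Bijective (fun a : k => a • 𝟙 (𝟙_ C)))
    (hL : ∀ X : C, Nonempty (HasLeftDual X))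
    (hR : ∀ X : C, Nonempty (HasRightDual X)) {X : C} (f : X ⟶ 𝟙_ C) (hf : f ≠ 0) : Epi f := by
  have := isIso_of_mono_unit h hL hR (image.ι f) fun h0 => hf (by
    rw [← image.fac f, h0, comp_zero])
  rw [← image.fac f]
  exact epi_comp _ _

/-- The unit of a tensor category is simple: nonzero morphisms from it are monomorphisms. -/
lemma mono_of_ne_zero_unit (h : Function.Bijective (fun a : k => a • 𝟙 (𝟙_ C)))
    (hL : ∀ X : C, Nonempty (HasLeftDual X))
    (hR : ∀ X : C, Nonempty (HasRightDual X)) {X : C} (f : 𝟙_ C ⟶ X) (hf : f ≠ 0) : Mono f := by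
  refine Preadditive.mono_of_kernel_zero ?_
  by_contra hne
  have := isIso_of_mono_unit h hL hR (kernel.ι f) hne
  exact hf (zero_of_epi_comp _ (kernel.condition f))

/-- In a tensor category, the tensor product with a nonzero object is faithful. -/
lemma faithful_tensorLeft (h : Function.Bijective (fun a : k => a • 𝟙 (𝟙_ C)))
    (hL : ∀ X : C, Nonempty (HasLeftDual X))
    (hR : ∀ X : C, Nonempty (HasRightDual X)) (X : C) (hX : ¬ IsZero X) :
    (tensorLeft X).Faithful := by
  have := fun X => (hL X).some
  -- A vanishing coevaluation would make the identity of `X` zero, by a zigzag identity.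
  have hη : η_ (ᘁX) X ≠ 0 := fun h0 => hX (by
    have e := ExactPairing.coevaluation_evaluation (ᘁX) X
    rw [h0, MonoidalPreadditive.whiskerLeft_zero, zero_comp] at e
    rw [IsZero.iff_id_eq_zero, ← cancel_epi (ρ_ X).hom, ← cancel_mono (λ_ X).inv, Category.comp_id,
      comp_zero, zero_comp, ← e])
  have := mono_of_ne_zero_unit h hL hR _ hη
  refine ⟨fun {Y Z f g} hfg => ?_⟩
  change X ◁ f = X ◁ g at hfg
  -- Coevaluation embeds `Z` into `(ᘁX ⊗ X) ⊗ Z`, where `f` and `g` have become equal.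
  have := mono_whiskerRight Z (η_ (ᘁX) X)
  rw [← cancel_epi (λ_ Y).hom, ← leftUnitor_naturality, ← leftUnitor_naturality, cancel_mono,
    ← cancel_mono (η_ (ᘁX) X ▷ Z), whisker_exchange, whisker_exchange]
  simp [hfg]

end SimpleUnit

section TensorCategory

variable {k : Type u} [Field k] {C : Type u₁} [Category.{v₁} C] [Preadditive C] [Linear k C]
  [MonoidalCategory C] [MonoidalPreadditive C] [MonoidalLinear k C]

/-- A tensor category is abelian. -/
@[reducible]
def IsTensorCategory.abelian (h : IsTensorCategory k C) : Abelian C :=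
  have := h.isNormalMonoCategory
  have := h.isNormalEpiCategory
  { has_finite_products := h.hasFiniteProducts
    has_kernels := h.hasKernels
    has_cokernels := h.hasCokernels }

end TensorCategory

end

end TensorEnvelope

namespace TensorEnvelope

open CategoryTheory MonoidalCategory Limits Functor.LaxMonoidal Functor.OplaxMonoidal

noncomputable section

set_option linter.unusedSectionVars false

/-! ### Image factorisations and contractions in abelian categories -/

section ImageFactorisation

variable {C : Type u₁} [Category.{v₁} C] [Abelian C]

/-- Epimorphisms in an abelian category are strong, so the square has a diagonal filler. -/
lemma exists_lift_of_epi_mono {X Y I I' : C} (e : X ⟶ I) (m : I' ⟶ Y) (v : X ⟶ I') (w : I ⟶ Y)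
    [Epi e] [Mono m] (h : e ≫ w = v ≫ m) : ∃ l, e ≫ l = v ∧ l ≫ m = w := by
  have := strongEpi_of_epi e
  have sq : CommSq v e m w := ⟨h.symm⟩
  exact ⟨sq.lift, sq.fac_left, sq.fac_right⟩

/-- Two factorisations of a morphism as an epimorphism followed by a monomorphism are isomorphic. -/
lemma exists_iso_of_epi_mono {X Y I I' : C} (e : X ⟶ I) (m : I ⟶ Y) (e' : X ⟶ I') (m' : I' ⟶ Y)
    [Epi e] [Mono m] [Epi e'] [Mono m'] (h : e ≫ m = e' ≫ m') :
    ∃ κ : I ≅ I', e ≫ κ.hom = e' ∧ κ.hom ≫ m' = m := by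
  obtain ⟨a, ha, ha'⟩ := exists_lift_of_epi_mono e m' e' m h
  obtain ⟨b, hb, hb'⟩ := exists_lift_of_epi_mono e' m e m' h.symm
  exact ⟨⟨a, b, by rw [← cancel_mono m, Category.assoc, hb', ha', Category.id_comp],
    by rw [← cancel_mono m', Category.assoc, ha', hb', Category.id_comp]⟩, ha, ha'⟩

/-- A complex with a contraction in the middle is exact. -/
lemma exact_of_contraction (S : ShortComplex C) (a : S.X₃ ⟶ S.X₂) (b : S.X₂ ⟶ S.X₁)
    (h : S.g ≫ a + b ≫ S.f = 𝟙 S.X₂) : S.Exact := by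
  rw [ShortComplex.exact_iff_epi_kernel_lift]
  have : (kernel.ι S.g ≫ b) ≫ kernel.lift S.g S.f S.zero = 𝟙 _ := by
    rw [← cancel_mono (kernel.ι S.g), Category.assoc, kernel.lift_ι, Category.id_comp,
      Category.assoc]
    have := kernel.ι S.g ≫= h
    rwa [Preadditive.comp_add, kernel.condition_assoc, zero_comp, zero_add,
      Category.comp_id] at this
  exact (IsSplitEpi.mk' ⟨_, this⟩).epi

end ImageFactorisation

/-! ### Presentations of a tensor category by objects of a pseudo-tensor category -/

variable (k : Type u) [Field k]
  {A : Type u₁} [Category.{v₁} A] [Preadditive A] [Linear k A]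
  [MonoidalCategory A] [MonoidalPreadditive A] [MonoidalLinear k A]
  {C : Type u₂} [Category.{v₂} C] [Preadditive C] [Linear k C]
  [MonoidalCategory C] [MonoidalPreadditive C] [MonoidalLinear k C]
  (Φ : A ⥤ C) [Φ.Additive] [Φ.Linear k] [Φ.Monoidal] [Φ.Faithful]

/-- Data that present every object of `C` by objects of `A`: an object `X` of `A` with nonzero
morphisms to and from the unit, and a functor `J : C ⥤ A` that lifts the tensor product with
`Φ X`, such that `Φ` is full on morphisms from and to the objects `J Y` and `J` turns exact
sequences into split ones. -/
structure Presentation where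
  X : A
  e : X ⟶ 𝟙_ A
  i : 𝟙_ A ⟶ X
  e_ne_zero : e ≠ 0
  i_ne_zero : i ≠ 0
  J : C ⥤ A
  additive : J.Additive
  linear : J.Linear k
  θ : J ⋙ Φ ≅ tensorLeft (Φ.obj X)
  full_from : ∀ (Y : C) (V : A) (f : Φ.obj (J.obj Y) ⟶ Φ.obj V), ∃ g, Φ.map g = f
  full_to : ∀ (V : A) (Y : C) (f : Φ.obj V ⟶ Φ.obj (J.obj Y)), ∃ g, Φ.map g = f
  contraction : ∀ {Y₁ Y₂ Y₃ : C} (f : Y₁ ⟶ Y₂) (g : Y₂ ⟶ Y₃) (w : f ≫ g = 0)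
    [(ShortComplex.mk f g w).HasHomology], (ShortComplex.mk f g w).Exact →
      ∃ (a : J.obj Y₃ ⟶ J.obj Y₂) (b : J.obj Y₂ ⟶ J.obj Y₁),
        J.map g ≫ a + b ≫ J.map f = 𝟙 (J.obj Y₂)

namespace Presentation

variable {k Φ} (P : Presentation k Φ)

instance : P.J.Additive := P.additive
instance : P.J.Linear k := P.linear

/-- The natural morphism `Φ (J Y) ⟶ Y`. -/
def π (Y : C) : Φ.obj (P.J.obj Y) ⟶ Y :=
  P.θ.hom.app Y ≫ (Φ.map P.e ≫ η Φ) ▷ Y ≫ (λ_ Y).hom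

/-- The natural morphism `Y ⟶ Φ (J Y)`. -/
def ι (Y : C) : Y ⟶ Φ.obj (P.J.obj Y) :=
  (λ_ Y).inv ≫ (ε Φ ≫ Φ.map P.i) ▷ Y ≫ P.θ.inv.app Y

lemma θ_hom_naturality {Y Z : C} (f : Y ⟶ Z) :
    Φ.map (P.J.map f) ≫ P.θ.hom.app Z = P.θ.hom.app Y ≫ Φ.obj P.X ◁ f :=
  P.θ.hom.naturality f

lemma θ_hom_naturality_assoc {Y Z : C} (f : Y ⟶ Z) {W : C} (t : Φ.obj P.X ⊗ Z ⟶ W) :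
    Φ.map (P.J.map f) ≫ P.θ.hom.app Z ≫ t = P.θ.hom.app Y ≫ Φ.obj P.X ◁ f ≫ t := by
  rw [reassoc_of% (P.θ_hom_naturality f)]

lemma θ_inv_naturality {Y Z : C} (f : Y ⟶ Z) :
    Φ.obj P.X ◁ f ≫ P.θ.inv.app Z = P.θ.inv.app Y ≫ Φ.map (P.J.map f) :=
  P.θ.inv.naturality f

lemma θ_inv_hom_comp {Y Z : C} (g : Φ.obj P.X ⊗ Y ⟶ Z) :
    P.θ.inv.app Y ≫ P.θ.hom.app Y ≫ g = g :=
  P.θ.inv_hom_id_app_assoc Y g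

lemma π_naturality {Y Z : C} (f : Y ⟶ Z) : Φ.map (P.J.map f) ≫ P.π Z = P.π Y ≫ f := by
  rw [π, π, θ_hom_naturality_assoc, Category.assoc, Category.assoc, whisker_exchange_assoc,
    leftUnitor_naturality]

lemma π_naturality_assoc {Y Z : C} (f : Y ⟶ Z) {W : C} (t : Z ⟶ W) :
    Φ.map (P.J.map f) ≫ P.π Z ≫ t = P.π Y ≫ f ≫ t := by
  rw [reassoc_of% (P.π_naturality f)]

lemma ι_naturality {Y Z : C} (f : Y ⟶ Z) : f ≫ P.ι Z = P.ι Y ≫ Φ.map (P.J.map f) := by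
  rw [ι, ι, Category.assoc, Category.assoc, ← θ_inv_naturality, leftUnitor_inv_naturality_assoc,
    whisker_exchange_assoc]

/-- Composition with `η F` moves the target to the unit of `D`, where a nonzero morphism is epi once
`D` is a tensor category. -/
lemma map_e_ne_zero {D : Type u₃} [Category.{v₃} D] [Preadditive D] [MonoidalCategory D] (F : A ⥤ D)
    [F.Additive] [F.Monoidal] [F.Faithful] : F.map P.e ≫ η F ≠ 0 := fun h => P.e_ne_zero (by
  apply F.map_injective
  rw [← cancel_mono (η F), h, F.map_zero, zero_comp])

lemma map_i_ne_zero {D : Type u₃} [Category.{v₃} D] [Preadditive D] [MonoidalCategory D] (F : A ⥤ D)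
    [F.Additive] [F.Monoidal] [F.Faithful] : ε F ≫ F.map P.i ≠ 0 := fun h => P.i_ne_zero (by
  apply F.map_injective
  rw [← cancel_epi (ε F), h, F.map_zero, comp_zero])

section Extend

variable {D : Type u₃} [Category.{v₃} D] [Preadditive D] [Linear k D]
  [MonoidalCategory D] [MonoidalPreadditive D] [MonoidalLinear k D] (hD : IsTensorCategory k D)
  (F : A ⥤ D) [F.Additive] [F.Linear k] [F.Monoidal] [F.Faithful]

include hD in
lemma epi_map_e_whiskerRight (Y : D) : Epi ((F.map P.e ≫ η F) ▷ Y) := by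
  let := hD.abelian
  have := epi_of_ne_zero_unit hD.bijective_unit hD.hasLeftDual hD.hasRightDual _
    (P.map_e_ne_zero F)
  have := (hD.hasRightDual Y).some
  exact epi_whiskerRight _ _

include hD in
lemma mono_map_i_whiskerRight (Y : D) : Mono ((ε F ≫ F.map P.i) ▷ Y) := by
  let := hD.abelian
  have := mono_of_ne_zero_unit hD.bijective_unit hD.hasLeftDual hD.hasRightDual _
    (P.map_i_ne_zero F)
  have := (hD.hasLeftDual Y).some
  exact mono_whiskerRight _ _

end Extend

/-- Together with `mono_ι`, this exhibits `Y` as the image of `π ≫ ι`, hence of a morphism coming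
from `A`. -/
lemma epi_π (hC : IsTensorCategory k C) (Y : C) : Epi (P.π Y) :=
  have := P.epi_map_e_whiskerRight hC Φ Y
  epi_comp' inferInstance (epi_comp _ _)

lemma mono_ι (hC : IsTensorCategory k C) (Y : C) : Mono (P.ι Y) :=
  have := P.mono_map_i_whiskerRight hC Φ Y
  mono_comp' inferInstance (mono_comp _ _)

/-- The endomorphism of `J` with `Φ φ = π ≫ ι`. -/
def φ (Y : C) : P.J.obj Y ⟶ P.J.obj Y := (P.full_from Y (P.J.obj Y) (P.π Y ≫ P.ι Y)).choose

lemma map_φ (Y : C) : Φ.map (P.φ Y) = P.π Y ≫ P.ι Y :=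
  (P.full_from _ _ _).choose_spec

lemma φ_naturality {Y Z : C} (f : Y ⟶ Z) : P.J.map f ≫ P.φ Z = P.φ Y ≫ P.J.map f :=
  Φ.map_injective (by
    rw [Φ.map_comp, Φ.map_comp, map_φ, map_φ, π_naturality_assoc, ι_naturality, Category.assoc])

/-- The morphism `J (Φ V) ⟶ V` with image `π` under `Φ`. -/
def counit (V : A) : P.J.obj (Φ.obj V) ⟶ V := (P.full_from (Φ.obj V) V (P.π (Φ.obj V))).choose

lemma map_counit (V : A) : Φ.map (P.counit V) = P.π (Φ.obj V) :=
  (P.full_from _ _ _).choose_spec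

lemma counit_naturality {V W : A} (f : V ⟶ W) :
    P.J.map (Φ.map f) ≫ P.counit W = P.counit V ≫ f :=
  Φ.map_injective (by rw [Φ.map_comp, Φ.map_comp, map_counit, map_counit, π_naturality])

/-- The morphism `V ⟶ J (Φ V)` with image `ι` under `Φ`. -/
def unit (V : A) : V ⟶ P.J.obj (Φ.obj V) := (P.full_to V (Φ.obj V) (P.ι (Φ.obj V))).choose

lemma map_unit (V : A) : Φ.map (P.unit V) = P.ι (Φ.obj V) :=
  (P.full_to _ _ _).choose_spec

/-- On objects that come from `A`, the image factorisation of `φ` exists already in `A`, so that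
every functor on `A` carries it along. -/
lemma φ_map (V : A) : P.φ (Φ.obj V) = P.counit V ≫ P.unit V :=
  Φ.map_injective (by rw [map_φ, Φ.map_comp, map_counit, map_unit])

/-- Serves to identify the extension of a functor on `π Y` with the epimorphism onto the image of
`φ`. -/
lemma map_π_comp_φ (Y : C) :
    P.J.map (P.π Y) ≫ P.φ Y = P.counit (P.J.obj Y) ≫ P.φ Y :=
  Φ.map_injective (by
    rw [Φ.map_comp, Φ.map_comp, map_φ, map_counit, π_naturality_assoc])

/-- Exact sequences are turned into split epimorphisms at the end. -/
lemma exists_section (hC : IsTensorCategory k C) {Y Z : C} (f : Y ⟶ Z) [Epi f] :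
    ∃ s, s ≫ P.J.map f = 𝟙 _ := by
  let := hC.abelian
  obtain ⟨a, b, h⟩ := P.contraction f (0 : Z ⟶ Z) comp_zero
    ((ShortComplex.exact_iff_epi _ rfl).2 inferInstance)
  exact ⟨b, by simpa using h⟩

/-- This is the contraction at `Y` for a zero morphism followed by `f`; the term through zero
disappears. -/
lemma exists_retraction (hC : IsTensorCategory k C) {Y Z : C} (f : Y ⟶ Z) [Mono f] :
    ∃ s, P.J.map f ≫ s = 𝟙 _ := by
  let := hC.abelian
  obtain ⟨a, b, h⟩ := P.contraction (0 : Y ⟶ Y) f zero_comp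
    ((ShortComplex.exact_iff_mono _ rfl).2 inferInstance)
  exact ⟨a, by simpa using h⟩

section

variable {D : Type u₃} [Category.{v₃} D] [Preadditive D] [Linear k D]
  [MonoidalCategory D] [MonoidalPreadditive D] [MonoidalLinear k D] (hD : IsTensorCategory k D)
  (F : A ⥤ D) [F.Additive] [F.Linear k] [F.Monoidal] [F.Faithful]

include hD in
-- The isomorphism `Φ (X ⊗ V) ≅ Φ (J (Φ V))` lifts to a morphism `t` of `A`, and `t ≫ counit = e ▷ V
-- ≫ λ` holds in `A` because `Φ` is faithful. Any `F` preserves this identity, and the right-hand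
-- side becomes epi in `D`.
lemma epi_map_counit (V : A) : Epi (F.map (P.counit V)) := by
  obtain ⟨t, ht⟩ := P.full_to (P.X ⊗ V) (Φ.obj V) (δ Φ _ _ ≫ P.θ.inv.app (Φ.obj V))
  have h : t ≫ P.counit V = P.e ▷ V ≫ (λ_ V).hom := Φ.map_injective (by
    rw [Φ.map_comp, ht, map_counit, Φ.map_comp, Functor.Monoidal.map_leftUnitor]
    simp only [π, Category.assoc, comp_whiskerRight, Functor.Monoidal.map_whiskerRight,
      Functor.Monoidal.μ_δ_assoc, θ_inv_hom_comp])
  have := P.epi_map_e_whiskerRight hD F (F.obj V)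
  have e : F.map t ≫ F.map (P.counit V) =
      δ F _ _ ≫ (F.map P.e ≫ η F) ▷ F.obj V ≫ (λ_ _).hom := by
    rw [← F.map_comp, h, F.map_comp, Functor.Monoidal.map_leftUnitor]
    simp only [Category.assoc, comp_whiskerRight, Functor.Monoidal.map_whiskerRight,
      Functor.Monoidal.μ_δ_assoc]
  have : Epi (F.map t ≫ F.map (P.counit V)) := by
    rw [e]
    exact epi_comp' inferInstance (epi_comp _ _)
  exact epi_of_epi (F.map t) _

include hD in
lemma mono_map_unit (V : A) : Mono (F.map (P.unit V)) := by
  obtain ⟨t, ht⟩ := P.full_from (Φ.obj V) (P.X ⊗ V) (P.θ.hom.app (Φ.obj V) ≫ μ Φ _ _)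
  have h : P.unit V ≫ t = (λ_ V).inv ≫ P.i ▷ V := Φ.map_injective (by
    rw [Φ.map_comp, ht, map_unit, Φ.map_comp, Functor.Monoidal.map_leftUnitor_inv]
    simp only [ι, Category.assoc, comp_whiskerRight, Functor.Monoidal.map_whiskerRight,
      Functor.Monoidal.μ_δ_assoc, θ_inv_hom_comp])
  have := P.mono_map_i_whiskerRight hD F (F.obj V)
  have e : F.map (P.unit V) ≫ F.map t =
      (λ_ _).inv ≫ (ε F ≫ F.map P.i) ▷ F.obj V ≫ μ F _ _ := by
    rw [← F.map_comp, h, F.map_comp, Functor.Monoidal.map_leftUnitor_inv]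
    simp only [Category.assoc, comp_whiskerRight, Functor.Monoidal.map_whiskerRight,
      Functor.Monoidal.μ_δ_assoc]
  have : Mono (F.map (P.unit V) ≫ F.map t) := by
    rw [e]
    exact mono_comp' inferInstance (mono_comp _ _)
  exact mono_of_mono _ (F.map t)

end

end Presentation

end

end TensorEnvelope

namespace TensorEnvelope

open CategoryTheory MonoidalCategory Limits Functor.LaxMonoidal Functor.OplaxMonoidal

noncomputable section

set_option linter.unusedSectionVars false

/-! ### Extension of a faithful tensor functor along Φ -/

section Oplax

variable {C : Type u₁} [Category.{v₁} C] [MonoidalCategory C] {D : Type u₂} [Category.{v₂} D]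
  [MonoidalCategory D] (F : C ⥤ D) [F.Monoidal]

lemma δ_tensor_associator {X Y Z : C} {X' Y' Z' : D} (a : F.obj X ⟶ X') (b : F.obj Y ⟶ Y')
    (c : F.obj Z ⟶ Z') :
    F.map (α_ X Y Z).hom ≫ δ F X (Y ⊗ Z) ≫ (a ⊗ₘ (δ F Y Z ≫ (b ⊗ₘ c))) =
      (δ F (X ⊗ Y) Z ≫ ((δ F X Y ≫ (a ⊗ₘ b)) ⊗ₘ c)) ≫ (α_ X' Y' Z').hom := by
  have h₁ : (a ⊗ₘ (δ F Y Z ≫ (b ⊗ₘ c))) = F.obj X ◁ δ F Y Z ≫ (a ⊗ₘ (b ⊗ₘ c)) := by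
    rw [← id_tensorHom, tensorHom_comp_tensorHom, Category.id_comp]
  have h₂ : ((δ F X Y ≫ (a ⊗ₘ b)) ⊗ₘ c) = δ F X Y ▷ F.obj Z ≫ ((a ⊗ₘ b) ⊗ₘ c) := by
    rw [← tensorHom_id, tensorHom_comp_tensorHom, Category.id_comp]
  rw [h₁, h₂, Category.assoc, Category.assoc, associator_naturality,
    Functor.OplaxMonoidal.associativity_assoc]

lemma δ_tensor_leftUnitor {X : C} {X' : D} (a : F.obj X ⟶ X') :
    F.map (λ_ X).hom ≫ a = (δ F (𝟙_ C) X ≫ (η F ⊗ₘ a)) ≫ (λ_ X').hom := by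
  rw [MonoidalCategory.tensorHom_def, Category.assoc, Category.assoc, leftUnitor_naturality,
    Functor.Monoidal.map_leftUnitor_assoc]

lemma δ_tensor_rightUnitor {X : C} {X' : D} (a : F.obj X ⟶ X') :
    F.map (ρ_ X).hom ≫ a = (δ F X (𝟙_ C) ≫ (a ⊗ₘ η F)) ≫ (ρ_ X').hom := by
  rw [MonoidalCategory.tensorHom_def', Category.assoc, Category.assoc, rightUnitor_naturality,
    Functor.Monoidal.map_rightUnitor_assoc]

end Oplax

namespace Presentation

variable {k : Type u} [Field k]
  {A : Type u₁} [Category.{v₁} A] [Preadditive A] [Linear k A]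
  [MonoidalCategory A] [MonoidalPreadditive A] [MonoidalLinear k A]
  {C : Type u₂} [Category.{v₂} C] [Preadditive C] [Linear k C]
  [MonoidalCategory C] [MonoidalPreadditive C] [MonoidalLinear k C]
  {Φ : A ⥤ C} [Φ.Additive] [Φ.Linear k] [Φ.Monoidal] [Φ.Faithful] (P : Presentation k Φ)
  {D : Type u₃} [Category.{v₃} D] [Preadditive D] [Linear k D]
  [MonoidalCategory D] [MonoidalPreadditive D] [MonoidalLinear k D]
  (F : A ⥤ D) [F.Additive] [F.Linear k] [F.Monoidal] [F.Faithful]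

/-- The functor whose value at `Y` is the image of `F φ`. -/
lemma exists_image_functor (hD : IsTensorCategory k D) :
    ∃ (E : C ⥤ D) (e : ∀ Y, F.obj (P.J.obj Y) ⟶ E.obj Y) (m : ∀ Y, E.obj Y ⟶ F.obj (P.J.obj Y)),
      (∀ Y, Epi (e Y)) ∧ (∀ Y, Mono (m Y)) ∧ (∀ Y, e Y ≫ m Y = F.map (P.φ Y)) ∧
      (∀ {Y Z : C} (f : Y ⟶ Z), F.map (P.J.map f) ≫ e Z = e Y ≫ E.map f) ∧
      (∀ {Y Z : C} (f : Y ⟶ Z), E.map f ≫ m Z = m Y ≫ F.map (P.J.map f)) := by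
  let := hD.abelian
  -- Naturality of `φ` makes `Y ↦ F φ` a functor to arrows, and taking images is functorial on
  -- arrows.
  let T : C ⥤ Arrow D :=
    { obj := fun Y => Arrow.mk (F.map (P.φ Y))
      map := fun {Y Z} f => Arrow.homMk (F.map (P.J.map f)) (F.map (P.J.map f)) (by
        simp only [Arrow.mk_hom]
        rw [← F.map_comp, ← F.map_comp, φ_naturality])
      map_id := fun Y => by ext <;> simp
      map_comp := fun f g => by ext <;> simp }
  refine ⟨T ⋙ im, fun Y => factorThruImage (F.map (P.φ Y)), fun Y => image.ι (F.map (P.φ Y)),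
    fun Y => inferInstanceAs (Epi (factorThruImage _)),
    fun Y => inferInstanceAs (Mono (image.ι _)), fun Y => image.fac _, fun {Y Z} f => ?_,
    fun {Y Z} f => ?_⟩
  · exact (image.factor_map (T.map f)).symm
  · exact image.map_ι (T.map f)

section Hat

variable (E : C ⥤ D) (κ : Φ ⋙ E ≅ F)

variable {F E} in
/-- The morphism `F V ⟶ E Y` induced by a morphism `Φ V ⟶ Y`. -/
def hat {V : A} {Y : C} (f : Φ.obj V ⟶ Y) : F.obj V ⟶ E.obj Y := κ.inv.app V ≫ E.map f

variable {F E}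

lemma hat_comp {V : A} {Y Z : C} (f : Φ.obj V ⟶ Y) (g : Y ⟶ Z) :
    hat κ f ≫ E.map g = hat κ (f ≫ g) := by
  rw [hat, hat, Category.assoc, E.map_comp]

lemma hat_comp_assoc {V : A} {Y Z : C} (f : Φ.obj V ⟶ Y) (g : Y ⟶ Z) {W : D}
    (t : E.obj Z ⟶ W) : hat κ f ≫ E.map g ≫ t = hat κ (f ≫ g) ≫ t := by
  rw [reassoc_of% (hat_comp κ f g)]

lemma map_hat {V W : A} {Y : C} (a : V ⟶ W) (f : Φ.obj W ⟶ Y) :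
    F.map a ≫ hat κ f = hat κ (Φ.map a ≫ f) := by
  rw [hat, hat, E.map_comp, NatTrans.naturality_assoc]
  rfl

lemma hat_id (V : A) : hat κ (𝟙 (Φ.obj V)) = κ.inv.app V := by
  rw [hat, E.map_id]
  exact Category.comp_id _

end Hat

/-- Preservation of epimorphisms and monomorphisms comes from the splitting of `J f`, transferred
along the squares with `e` and `m`. Full exactness is left until the monoidal structure is
available. -/
lemma exists_extension_functor (hC : IsTensorCategory k C) (hD : IsTensorCategory k D) :
    ∃ (E : C ⥤ D) (κ : Φ ⋙ E ≅ F), E.Additive ∧ E.Linear k ∧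
      (∀ Y, Epi (hat κ (P.π Y))) ∧
      (∀ {Y Z : C} (f : Y ⟶ Z) [Epi f], Epi (E.map f)) ∧
      (∀ {Y Z : C} (f : Y ⟶ Z) [Mono f], Mono (E.map f)) := by
  let := hD.abelian
  obtain ⟨E, e, m, he, hm, hem, he', hm'⟩ := P.exists_image_functor F hD
  -- `F φ` at `Φ V` has two epi-mono factorisations: through its image, and through `F V` by the
  -- counit and the unit.
  have hκ : ∀ V, ∃ κ : E.obj (Φ.obj V) ≅ F.obj V, e (Φ.obj V) ≫ κ.hom = F.map (P.counit V) :=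
    fun V => by
      have := P.epi_map_counit hD F V
      have := P.mono_map_unit hD F V
      obtain ⟨κ, hκ, -⟩ := exists_iso_of_epi_mono (e (Φ.obj V)) (m (Φ.obj V)) (F.map (P.counit V))
        (F.map (P.unit V)) (by rw [hem, φ_map, F.map_comp])
      exact ⟨κ, hκ⟩
  choose κ hκ using hκ
  let κ' : Φ ⋙ E ≅ F := NatIso.ofComponents κ fun {V W} f => by
    rw [Functor.comp_map, ← cancel_epi (e (Φ.obj V)), ← reassoc_of% he', hκ, reassoc_of% hκ,
      ← F.map_comp, ← F.map_comp, counit_naturality]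
  have hπ : ∀ Y, hat κ' (P.π Y) = e Y := fun Y => by
    change (κ (P.J.obj Y)).inv ≫ E.map (P.π Y) = e Y
    rw [Iso.inv_comp_eq, ← cancel_epi (e _), ← he', reassoc_of% hκ, ← cancel_mono (m Y), Category.assoc,
      Category.assoc, hem, ← F.map_comp, ← F.map_comp, map_π_comp_φ]
  have hadd : E.Additive := ⟨fun {Y Z f g} => by
    rw [← cancel_epi (e Y), ← he', P.J.map_add, F.map_add, Preadditive.add_comp, he', he',
      Preadditive.comp_add]⟩
  refine ⟨E, κ', hadd, ⟨fun {Y Z} f a => ?_⟩, fun Y => ?_, fun {Y Z} f _ => ?_, fun {Y Z} f _ => ?_⟩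
  · rw [← cancel_epi (e Y), ← he', P.J.map_smul, F.map_smul, Linear.smul_comp, he',
      Linear.comp_smul]
  · rw [hπ]
    exact he Y
  · obtain ⟨s, hs⟩ := P.exists_section hC f
    have : Epi (F.map (P.J.map f)) :=
      (IsSplitEpi.mk' ⟨F.map s, by rw [← F.map_comp, hs, F.map_id]⟩).epi
    have h : Epi (e Y ≫ E.map f) := by
      rw [← he']
      exact epi_comp _ _
    exact epi_of_epi (e Y) _
  · obtain ⟨s, hs⟩ := P.exists_retraction hC f
    have : Mono (F.map (P.J.map f)) :=
      (IsSplitMono.mk' ⟨F.map s, by rw [← F.map_comp, hs, F.map_id]⟩).mono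
    have h : Mono (E.map f ≫ m Z) := by
      rw [hm']
      exact mono_comp _ _
    exact mono_of_mono _ (m Z)

section Monoidal

variable {F} {E : C ⥤ D} [E.Additive] [E.Linear k] (κ : Φ ⋙ E ≅ F)

variable (hD : IsTensorCategory k D) (hπ : ∀ Y, Epi (hat κ (P.π Y)))

include hD hπ in
lemma epi_hat_tensor (Y Z : C) : Epi (hat κ (P.π Y) ⊗ₘ hat κ (P.π Z)) := by
  have := fun X => (hD.hasLeftDual X).some
  have := fun X => (hD.hasRightDual X).some
  rw [MonoidalCategory.tensorHom_def]
  have := epi_whiskerRight (F.obj (P.J.obj Z)) (hat κ (P.π Y))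
  have := epi_whiskerLeft (E.obj Y) (hat κ (P.π Z))
  exact epi_comp _ _

include hD in
lemma epi_counit_tensor (V W : A) : Epi (F.map (P.counit V) ⊗ₘ F.map (P.counit W)) := by
  have := fun X => (hD.hasLeftDual X).some
  have := fun X => (hD.hasRightDual X).some
  have := P.epi_map_counit hD F V
  have := P.epi_map_counit hD F W
  rw [MonoidalCategory.tensorHom_def]
  have := epi_whiskerRight (F.obj (P.J.obj (Φ.obj W))) (F.map (P.counit V))
  have := epi_whiskerLeft (F.obj V) (F.map (P.counit W))
  exact epi_comp _ _

variable (hC : IsTensorCategory k C)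
  (hEpi : ∀ {Y Z : C} (f : Y ⟶ Z) [Epi f], Epi (E.map f))
  (hMono : ∀ {Y Z : C} (f : Y ⟶ Z) [Mono f], Mono (E.map f))

include hD hπ hC hEpi hMono in
-- Both objects are images of `F φ ⊗ F φ`: the first because tensoring is exact on both sides, the
-- second because `E` preserves the epimorphism `π ⊗ π` and the monomorphism `ι ⊗ ι`.
lemma exists_tensorIso (Y Z : C) : ∃ μ' : E.obj Y ⊗ E.obj Z ≅ E.obj (Y ⊗ Z),
    (hat κ (P.π Y) ⊗ₘ hat κ (P.π Z)) ≫ μ'.hom =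
      μ F _ _ ≫ hat κ (δ Φ _ _ ≫ (P.π Y ⊗ₘ P.π Z)) := by
  let := hD.abelian
  have := P.epi_hat_tensor κ hD hπ Y Z
  have hp : Epi (P.π Y ⊗ₘ P.π Z) := by
    have := (hC.hasLeftDual Y).some
    have := (hC.hasRightDual (Φ.obj (P.J.obj Z))).some
    have := P.epi_π hC Y
    have := P.epi_π hC Z
    rw [MonoidalCategory.tensorHom_def]
    have := epi_whiskerRight (Φ.obj (P.J.obj Z)) (P.π Y)
    have := epi_whiskerLeft Y (P.π Z)
    exact epi_comp _ _
  have hi : Mono (P.ι Y ⊗ₘ P.ι Z) := by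
    have := (hC.hasLeftDual Z).some
    have := (hC.hasRightDual (Φ.obj (P.J.obj Y))).some
    have := P.mono_ι hC Y
    have := P.mono_ι hC Z
    rw [MonoidalCategory.tensorHom_def]
    have := mono_whiskerRight Z (P.ι Y)
    have := mono_whiskerLeft (Φ.obj (P.J.obj Y)) (P.ι Z)
    exact mono_comp _ _
  have h₁ : Epi (μ F _ _ ≫ hat κ (δ Φ _ _ ≫ (P.π Y ⊗ₘ P.π Z))) := by
    have := hEpi (δ Φ _ _ ≫ (P.π Y ⊗ₘ P.π Z))
    have : Epi (hat κ (δ Φ _ _ ≫ (P.π Y ⊗ₘ P.π Z))) :=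
      epi_comp (κ.inv.app (P.J.obj Y ⊗ P.J.obj Z)) (E.map (δ Φ _ _ ≫ (P.π Y ⊗ₘ P.π Z)))
    exact epi_comp _ (hat κ (δ Φ _ _ ≫ (P.π Y ⊗ₘ P.π Z)))
  have h₂ : Mono (E.map ((P.ι Y ⊗ₘ P.ι Z) ≫ μ Φ _ _) ≫ κ.hom.app (P.J.obj Y ⊗ P.J.obj Z) ≫
      δ F _ _) := by
    have := hMono ((P.ι Y ⊗ₘ P.ι Z) ≫ μ Φ _ _)
    have := mono_comp (κ.hom.app (P.J.obj Y ⊗ P.J.obj Z)) (δ F _ _)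
    exact mono_comp _ _
  have h₃ : ∀ Y, hat κ (P.π Y) ≫ E.map (P.ι Y) ≫ κ.hom.app _ = F.map (P.φ Y) := fun Y => by
    rw [hat_comp_assoc, ← map_φ, ← Category.comp_id (Φ.map _), ← map_hat, hat_id, Category.assoc,
      Iso.inv_hom_id_app, Category.comp_id]
  have h₅ : ∀ Y, Mono (E.map (P.ι Y) ≫ κ.hom.app (P.J.obj Y)) := fun Y => by
    have := P.mono_ι hC Y
    have := hMono (P.ι Y)
    exact mono_comp _ _
  have h₄ : Mono ((E.map (P.ι Y) ≫ κ.hom.app _) ⊗ₘ (E.map (P.ι Z) ≫ κ.hom.app _)) := by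
    have := fun X => (hD.hasLeftDual X).some
    have := fun X => (hD.hasRightDual X).some
    rw [MonoidalCategory.tensorHom_def]
    have := mono_whiskerRight (E.obj Z) (E.map (P.ι Y) ≫ κ.hom.app (P.J.obj Y))
    have := mono_whiskerLeft (F.obj (P.J.obj Y)) (E.map (P.ι Z) ≫ κ.hom.app (P.J.obj Z))
    exact mono_comp _ _
  obtain ⟨μ', hμ, -⟩ := exists_iso_of_epi_mono (hat κ (P.π Y) ⊗ₘ hat κ (P.π Z))
    ((E.map (P.ι Y) ≫ κ.hom.app _) ⊗ₘ (E.map (P.ι Z) ≫ κ.hom.app _))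
    (μ F _ _ ≫ hat κ (δ Φ _ _ ≫ (P.π Y ⊗ₘ P.π Z)))
    (E.map ((P.ι Y ⊗ₘ P.ι Z) ≫ μ Φ _ _) ≫ κ.hom.app (P.J.obj Y ⊗ P.J.obj Z) ≫ δ F _ _) (by
      rw [tensorHom_comp_tensorHom, h₃, h₃, Category.assoc, hat_comp_assoc, Category.assoc,
        tensorHom_comp_tensorHom_assoc, ← map_φ, ← map_φ, δ_natural_assoc, Functor.Monoidal.δ_μ,
        ← map_hat, hat_id, Category.assoc, Iso.inv_hom_id_app_assoc, ← δ_natural,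
        Functor.Monoidal.μ_δ_assoc])
  exact ⟨μ', hμ⟩

/-- The formula for `π` implies the one for arbitrary morphisms from objects of `A`: after the
epimorphism `F counit`, the morphism `hat κ f` becomes `F (J f) ≫ hat κ π`. -/
lemma tensorIso_natural {μ' : ∀ Y Z : C, E.obj Y ⊗ E.obj Z ⟶ E.obj (Y ⊗ Z)}
    (hD : IsTensorCategory k D)
    (h : ∀ Y Z, (hat κ (P.π Y) ⊗ₘ hat κ (P.π Z)) ≫ μ' Y Z =
      μ F _ _ ≫ hat κ (δ Φ _ _ ≫ (P.π Y ⊗ₘ P.π Z)))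
    {V W : A} {Y Z : C} (f : Φ.obj V ⟶ Y) (g : Φ.obj W ⟶ Z) :
    (hat κ f ⊗ₘ hat κ g) ≫ μ' Y Z = μ F _ _ ≫ hat κ (δ Φ _ _ ≫ (f ⊗ₘ g)) := by
  have := P.epi_counit_tensor (F := F) hD V W
  have h₁ : ∀ {V : A} {Y : C} (f : Φ.obj V ⟶ Y), F.map (P.counit V) ≫ hat κ f =
      F.map (P.J.map f) ≫ hat κ (P.π Y) := fun f => by
    rw [map_hat, map_hat, map_counit, π_naturality]
  have h₂ : Φ.map (P.J.map f ⊗ₘ P.J.map g) ≫ δ Φ _ _ ≫ (P.π Y ⊗ₘ P.π Z) =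
      Φ.map (P.counit V ⊗ₘ P.counit W) ≫ δ Φ _ _ ≫ (f ⊗ₘ g) := by
    rw [← δ_natural_assoc, ← δ_natural_assoc, tensorHom_comp_tensorHom, tensorHom_comp_tensorHom,
      π_naturality, π_naturality, map_counit, map_counit]
  rw [← cancel_epi (F.map (P.counit V) ⊗ₘ F.map (P.counit W)), tensorHom_comp_tensorHom_assoc, h₁,
    h₁, ← tensorHom_comp_tensorHom_assoc, h, μ_natural_assoc, μ_natural_assoc, map_hat, map_hat, h₂]

include hD hπ hC hEpi hMono in
-- Each coherence condition is checked after composing with an epimorphism built from the `hat κ (π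
-- _)`. There `hnat` turns it into the corresponding condition for `F` and `Φ`.
lemma exists_monoidal : ∃ _ : E.Monoidal, NatTrans.IsMonoidal κ.hom := by
  choose μ' hμ using P.exists_tensorIso κ hD hπ hC hEpi hMono
  have hnat : ∀ {V W : A} {Y Z : C} (f : Φ.obj V ⟶ Y) (g : Φ.obj W ⟶ Z),
      (hat κ f ⊗ₘ hat κ g) ≫ (μ' Y Z).hom = μ F _ _ ≫ hat κ (δ Φ _ _ ≫ (f ⊗ₘ g)) :=
    fun f g => P.tensorIso_natural κ (μ' := fun Y Z => (μ' Y Z).hom) hD hμ f g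
  have hnat_assoc : ∀ {V W : A} {Y Z : C} (f : Φ.obj V ⟶ Y) (g : Φ.obj W ⟶ Z) {T : D}
      (t : E.obj (Y ⊗ Z) ⟶ T), (hat κ f ⊗ₘ hat κ g) ≫ (μ' Y Z).hom ≫ t =
        μ F _ _ ≫ hat κ (δ Φ _ _ ≫ (f ⊗ₘ g)) ≫ t := fun f g T t => by
    rw [reassoc_of% hnat f g]
  have hepi := P.epi_hat_tensor κ hD hπ
  have := fun X => (hD.hasLeftDual X).some
  have := fun X => (hD.hasRightDual X).some
  let εI : 𝟙_ D ≅ E.obj (𝟙_ C) :=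
    Functor.Monoidal.εIso F ≪≫ κ.symm.app (𝟙_ A) ≪≫ E.mapIso (Functor.Monoidal.εIso Φ).symm
  have hε : εI.hom = ε F ≫ hat κ (η Φ) := rfl
  let core : E.CoreMonoidal :=
    { εIso := εI
      μIso := μ'
      μIso_hom_natural_left := fun {Y Z} f W => by
        have := hepi Y W
        rw [← cancel_epi (hat κ (P.π Y) ⊗ₘ hat κ (P.π W)), reassoc_of% hμ, hat_comp,
          ← tensorHom_id, tensorHom_comp_tensorHom_assoc, hat_comp, Category.comp_id, hnat,
          Category.assoc, ← tensorHom_id, tensorHom_comp_tensorHom, Category.comp_id]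
      μIso_hom_natural_right := fun {Y Z} W f => by
        have := hepi W Y
        rw [← cancel_epi (hat κ (P.π W) ⊗ₘ hat κ (P.π Y)), reassoc_of% hμ, hat_comp,
          ← id_tensorHom, tensorHom_comp_tensorHom_assoc, hat_comp, Category.comp_id, hnat,
          Category.assoc, ← id_tensorHom, tensorHom_comp_tensorHom, Category.comp_id]
      associativity := fun X Y Z => by
        have h3 : Epi ((hat κ (P.π X) ⊗ₘ hat κ (P.π Y)) ⊗ₘ hat κ (P.π Z)) := by
          have := hepi X Y
          have := hπ Z
          rw [MonoidalCategory.tensorHom_def]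
          have := epi_whiskerRight (F.obj (P.J.obj Z)) (hat κ (P.π X) ⊗ₘ hat κ (P.π Y))
          have := epi_whiskerLeft (E.obj X ⊗ E.obj Y) (hat κ (P.π Z))
          exact epi_comp _ _
        have hl : ((hat κ (P.π X) ⊗ₘ hat κ (P.π Y)) ⊗ₘ hat κ (P.π Z)) ≫
            (μ' X Y).hom ▷ E.obj Z ≫ (μ' (X ⊗ Y) Z).hom =
            μ F _ _ ▷ _ ≫ μ F _ _ ≫ hat κ (δ Φ _ _ ≫ ((δ Φ _ _ ≫ (P.π X ⊗ₘ P.π Y)) ⊗ₘ P.π Z)) := by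
          rw [← tensorHom_id, tensorHom_comp_tensorHom_assoc, hμ, Category.comp_id,
            ← hnat (δ Φ _ _ ≫ (P.π X ⊗ₘ P.π Y)) (P.π Z), ← tensorHom_id, tensorHom_comp_tensorHom_assoc, Category.id_comp]
        have hr : (hat κ (P.π X) ⊗ₘ (hat κ (P.π Y) ⊗ₘ hat κ (P.π Z))) ≫
            E.obj X ◁ (μ' Y Z).hom ≫ (μ' X (Y ⊗ Z)).hom =
            _ ◁ μ F _ _ ≫ μ F _ _ ≫ hat κ (δ Φ _ _ ≫ (P.π X ⊗ₘ (δ Φ _ _ ≫ (P.π Y ⊗ₘ P.π Z)))) := by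
          rw [← id_tensorHom, tensorHom_comp_tensorHom_assoc, hμ, Category.comp_id,
            ← hnat (P.π X) (δ Φ _ _ ≫ (P.π Y ⊗ₘ P.π Z)), ← id_tensorHom, tensorHom_comp_tensorHom_assoc, Category.id_comp]
        rw [← cancel_epi ((hat κ (P.π X) ⊗ₘ hat κ (P.π Y)) ⊗ₘ hat κ (P.π Z)), reassoc_of% hl,
          hat_comp, associator_naturality_assoc, hr, ← Functor.LaxMonoidal.associativity_assoc, map_hat,
          δ_tensor_associator]
      left_unitality := fun X => by
        have := epi_whiskerLeft (𝟙_ D) (hat κ (P.π X))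
        rw [← cancel_epi (𝟙_ D ◁ hat κ (P.π X)), leftUnitor_naturality, hε,
          Functor.LaxMonoidal.left_unitality, Category.assoc, Category.assoc, map_hat,
          δ_tensor_leftUnitor, ← hat_comp, ← hnat_assoc, ← tensorHom_id, ← id_tensorHom,
          ← tensorHom_id, tensorHom_comp_tensorHom_assoc, tensorHom_comp_tensorHom_assoc,
          Category.id_comp, Category.id_comp, Category.comp_id]
      right_unitality := fun X => by
        have := epi_whiskerRight (𝟙_ D) (hat κ (P.π X))
        rw [← cancel_epi (hat κ (P.π X) ▷ 𝟙_ D), rightUnitor_naturality, hε,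
          Functor.LaxMonoidal.right_unitality, Category.assoc, Category.assoc, map_hat,
          δ_tensor_rightUnitor, ← hat_comp, ← hnat_assoc, ← tensorHom_id, ← id_tensorHom,
          ← id_tensorHom, tensorHom_comp_tensorHom_assoc, tensorHom_comp_tensorHom_assoc,
          Category.id_comp, Category.id_comp, Category.comp_id] }
  let := core.toMonoidal
  have hε' : ε E = ε F ≫ hat κ (η Φ) := rfl
  have hμ' : ∀ Y Z, μ E Y Z = (μ' Y Z).hom := fun Y Z => rfl
  refine ⟨inferInstance, ⟨?_, fun V W => ?_⟩⟩
  · rw [comp_ε, hε', Category.assoc, Category.assoc, hat_comp_assoc, Functor.Monoidal.η_ε, hat_id,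
      Iso.inv_hom_id_app, Category.comp_id]
  · rw [comp_μ, hμ', ← cancel_epi (κ.inv.app V ⊗ₘ κ.inv.app W), ← hat_id, ← hat_id, Category.assoc,
      reassoc_of% hnat, hat_comp_assoc, id_tensorHom_id, Category.comp_id, Functor.Monoidal.δ_μ,
      hat_id, Iso.inv_hom_id_app, Category.comp_id, hat_id, hat_id, tensorHom_comp_tensorHom_assoc,
      Iso.inv_hom_id_app, Iso.inv_hom_id_app, id_tensorHom_id, Category.id_comp]

end Monoidal

end Presentation

end

end TensorEnvelope

namespace TensorEnvelope

open CategoryTheory MonoidalCategory Limits Functor.LaxMonoidal Functor.OplaxMonoidal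

noncomputable section

set_option linter.unusedSectionVars false

/-! ### Exactness of extensions and uniqueness of monoidal transformations -/

namespace Presentation

variable {k : Type u} [Field k]
  {A : Type u₁} [Category.{v₁} A] [Preadditive A] [Linear k A]
  [MonoidalCategory A] [MonoidalPreadditive A] [MonoidalLinear k A]
  {C : Type u₂} [Category.{v₂} C] [Preadditive C] [Linear k C]
  [MonoidalCategory C] [MonoidalPreadditive C] [MonoidalLinear k C]
  {Φ : A ⥤ C} [Φ.Additive] [Φ.Linear k] [Φ.Monoidal] [Φ.Faithful] (P : Presentation k Φ)
  {D : Type u₃} [Category.{v₃} D] [Preadditive D] [Linear k D]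
  [MonoidalCategory D] [MonoidalPreadditive D] [MonoidalLinear k D]

include P in
/-- A monoidal functor on `C` that extends a faithful tensor functor on `A` is exact. -/
lemma isLinearExact_of_monoidal (hC : IsTensorCategory k C) (hD : IsTensorCategory k D)
    (F : A ⥤ D) [F.Additive] [F.Linear k] [F.Monoidal] [F.Faithful]
    (E : C ⥤ D) [E.Additive] [E.Linear k] [E.Monoidal] (κ : Φ ⋙ E ≅ F) : IsLinearExact k E := by
  let := hC.abelian
  let := hD.abelian
  have h : ∀ S : ShortComplex C, S.Exact → (S.map E).Exact := fun S hS => by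
    -- Exactness may be tested after tensoring with `X'`, a nonzero object since `F e ≠ 0`.
    let X' := E.obj (Φ.obj P.X)
    have hX' : ¬ IsZero X' := fun h0 => by
      apply P.e_ne_zero
      apply F.map_injective
      rw [F.map_zero]
      exact (h0.of_iso (κ.symm.app P.X)).eq_of_src _ _
    have := faithful_tensorLeft hD.bijective_unit hD.hasLeftDual hD.hasRightDual X' hX'
    have : (tensorLeft X').PreservesZeroMorphisms := inferInstance
    -- Monoidality of `E` gives `X' ⊗ E Y ≅ E (Φ X ⊗ Y) ≅ E (Φ (J Y)) ≅ F (J Y)`; on the last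
    -- functor exact sequences acquire a contraction.
    let e : E ⋙ tensorLeft X' ≅ P.J ⋙ F := NatIso.ofComponents
      (fun Y => Functor.Monoidal.μIso E (Φ.obj P.X) Y ≪≫ E.mapIso (P.θ.symm.app Y) ≪≫
        κ.app (P.J.obj Y)) fun {Y Z} f => by
          simp only [Functor.comp_map, Iso.trans_hom, Functor.Monoidal.μIso_hom, Functor.mapIso_hom,
            Iso.app_hom, Iso.symm_hom, Category.assoc]
          have h₁ := κ.hom.naturality (P.J.map f)
          simp only [Functor.comp_map] at h₁
          refine (μ_natural_right_assoc E (Φ.obj P.X) f _).trans ?_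
          rw [← h₁, ← E.map_comp_assoc, θ_inv_naturality, E.map_comp_assoc]
    refine Functor.reflects_exact_of_faithful (tensorLeft X') _ ?_
    refine (ShortComplex.exact_iff_of_iso (S.mapNatIso e)).2 ?_
    obtain ⟨a, b, hab⟩ := P.contraction S.f S.g S.zero hS
    refine exact_of_contraction (S.map (P.J ⋙ F)) (F.map a) (F.map b) ?_
    change F.map (P.J.map S.g) ≫ F.map a + F.map b ≫ F.map (P.J.map S.f) = 𝟙 (F.obj (P.J.obj S.X₂))
    rw [← F.map_comp, ← F.map_comp, ← F.map_add, hab, F.map_id]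
  have h' := ((Functor.exact_tfae E).out 1 3).1 h
  exact ⟨inferInstance, inferInstance, h'.1, h'.2⟩

section NatTrans

variable {E E' : C ⥤ D}

include P in
-- The component at `Y` is the diagonal filler between the epimorphism `E π` and the monomorphism
-- `E' ι`; the square commutes by naturality of `τ` at `φ`.
lemma exists_natTrans (hC : IsTensorCategory k C) (hD : IsTensorCategory k D)
    (hE : IsLinearExact k E) (hE' : IsLinearExact k E') (τ : Φ ⋙ E ⟶ Φ ⋙ E') :
    ∃ σ : E ⟶ E', Functor.whiskerLeft Φ σ = τ := by
  let := hD.abelian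
  have := hE.preservesFiniteColimits
  have := hE'.preservesFiniteLimits
  have hp := P.epi_π hC
  have hm := P.mono_ι hC
  have hp' : ∀ Y, Epi (E.map (P.π Y)) := fun Y => inferInstance
  have hσ : ∀ Y, ∃ l : E.obj Y ⟶ E'.obj Y,
      E.map (P.π Y) ≫ l = τ.app (P.J.obj Y) ≫ E'.map (P.π Y) := fun Y => by
    have h := τ.naturality (P.φ Y)
    simp only [Functor.comp_map, map_φ, Functor.map_comp, Category.assoc] at h
    obtain ⟨l, hl, -⟩ := exists_lift_of_epi_mono (E.map (P.π Y)) (E'.map (P.ι Y))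
      (τ.app (P.J.obj Y) ≫ E'.map (P.π Y)) (E.map (P.ι Y) ≫ τ.app (P.J.obj Y)) (by
        rw [h, Category.assoc])
    exact ⟨l, hl⟩
  choose σ hσ using hσ
  refine ⟨{ app := σ, naturality := fun Y Z f => ?_ }, ?_⟩
  · have h := τ.naturality (P.J.map f)
    simp only [Functor.comp_map] at h
    rw [← cancel_epi (E.map (P.π Y)), ← E.map_comp_assoc, ← π_naturality, E.map_comp_assoc, hσ,
      reassoc_of% h, ← E'.map_comp, π_naturality, E'.map_comp, reassoc_of% hσ]
  · ext V
    change σ (Φ.obj V) = τ.app V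
    have h := τ.naturality (P.counit V)
    simp only [Functor.comp_map, map_counit] at h
    rw [← cancel_epi (E.map (P.π (Φ.obj V))), hσ, h]

include P in
-- The epimorphism `E π` determines the component at `Y` from the one at `Φ (J Y)`.
lemma natTrans_ext (hC : IsTensorCategory k C) (hE : IsLinearExact k E) {σ σ' : E ⟶ E'}
    (h : Functor.whiskerLeft Φ σ = Functor.whiskerLeft Φ σ') : σ = σ' := by
  have := hE.preservesFiniteColimits
  have hp := P.epi_π hC
  ext Y
  have h' := congrArg (fun t => t.app (P.J.obj Y)) h
  simp only [Functor.whiskerLeft_app] at h'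
  rw [← cancel_epi (E.map (P.π Y)), σ.naturality, σ'.naturality, h']

include P in
lemma isMonoidal_of_whiskerLeft (hC : IsTensorCategory k C) (hD : IsTensorCategory k D)
    [E.Monoidal] [E'.Monoidal] (hE : IsLinearExact k E) (σ : E ⟶ E')
    [h : NatTrans.IsMonoidal (Functor.whiskerLeft Φ σ)] : NatTrans.IsMonoidal σ := by
  let := hC.abelian
  have := hE.preservesFiniteColimits
  have hp := P.epi_π hC
  have hp' : ∀ Y, Epi (E.map (P.π Y)) := fun Y => inferInstance
  have hE : ∀ Y Z, Epi (E.map (P.π Y) ⊗ₘ E.map (P.π Z)) := fun Y Z => by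
    have := (hD.hasRightDual (E.obj (Φ.obj (P.J.obj Z)))).some
    have := (hD.hasLeftDual (E.obj Y)).some
    rw [MonoidalCategory.tensorHom_def]
    have := epi_whiskerRight (E.obj (Φ.obj (P.J.obj Z))) (E.map (P.π Y))
    have := epi_whiskerLeft (E.obj Y) (E.map (P.π Z))
    exact epi_comp _ _
  refine ⟨?_, fun Y Z => ?_⟩
  · have h₁ := h.unit
    rw [comp_ε, comp_ε, Functor.whiskerLeft_app, Category.assoc, σ.naturality, ← Category.assoc,
      cancel_mono] at h₁
    exact h₁
  · have := hE Y Z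
    have h₁ := h.tensor (P.J.obj Y) (P.J.obj Z)
    simp only [comp_μ, Functor.whiskerLeft_app, Category.assoc, σ.naturality] at h₁
    rw [← Category.assoc, ← Category.assoc, cancel_mono] at h₁
    rw [← cancel_epi (E.map (P.π Y) ⊗ₘ E.map (P.π Z)), μ_natural_assoc, σ.naturality,
      reassoc_of% h₁, ← μ_natural, tensorHom_comp_tensorHom_assoc, tensorHom_comp_tensorHom_assoc,
      σ.naturality, σ.naturality]

end NatTrans

include P in
/-- A tensor functor that admits a presentation is an abelian envelope. -/
theorem isAbelianEnvelope (hA : IsPseudoTensorCategory k A) (hC : IsTensorCategory k C) :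
    IsAbelianEnvelope.{u, v₁, v₂, v₃, u₁, u₂, u₃} k Φ where
  isPseudoTensorCategory := hA
  isTensorCategory := hC
  faithful := inferInstance
  exists_extension D _ _ _ _ _ _ hD F _ _ _ _ := by
    obtain ⟨E, κ, _, _, h₁, h₂, h₃⟩ := P.exists_extension_functor F hC hD
    obtain ⟨_, hκ⟩ := P.exists_monoidal κ hD h₁ hC h₂ h₃
    exact ⟨E, inferInstance, P.isLinearExact_of_monoidal hC hD F E κ, κ, hκ⟩
  existsUnique_natTrans D _ _ _ _ _ _ hD E E' _ _ hE hE' τ hτ := by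
    obtain ⟨σ, rfl⟩ := P.exists_natTrans hC hD hE hE' τ
    exact ⟨σ, ⟨P.isMonoidal_of_whiskerLeft hC hD hE σ, rfl⟩, fun σ' h =>
      P.natTrans_ext hC hE h.2⟩

end Presentation

end

end TensorEnvelope

namespace TensorEnvelope

open CategoryTheory MonoidalCategory Limits Functor.LaxMonoidal Functor.OplaxMonoidal

noncomputable section

set_option linter.unusedSectionVars false

/-! ### The equivariantization of a von Neumann regular category is abelian of finite length -/

namespace SymmetricAction

variable {k : Type u} [Field k] {Q : Type w} [Group Q]
  {C : Type u₁} [Category.{v₁} C] [Preadditive C] [Linear k C]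
  [MonoidalCategory C] [SymmetricCategory C] {A : SymmetricAction k Q C}

variable (A) in
lemma compIso_naturality {q r s : Q} (h : q * r = s) {X Y : C} (f : X ⟶ Y) :
    (A.T q).map ((A.T r).map f) ≫ (A.compIso h).hom.app Y =
      (A.compIso h).hom.app X ≫ (A.T s).map f :=
  (A.compIso h).hom.naturality f

variable (A) in
lemma compIso_naturality_assoc {q r s : Q} (h : q * r = s) {X Y W : C} (f : X ⟶ Y)
    (t : (A.T s).obj Y ⟶ W) :
    (A.T q).map ((A.T r).map f) ≫ (A.compIso h).hom.app Y ≫ t =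
      (A.compIso h).hom.app X ≫ (A.T s).map f ≫ t := by
  rw [reassoc_of% (A.compIso_naturality h f)]

variable (A) in
/-- The isomorphism `X ⟶ T 1 X`. -/
def unitHom (X : C) : X ⟶ (A.T 1).obj X := A.unitIso.hom.app X

instance (X : C) : IsIso (A.unitHom X) := inferInstanceAs (IsIso (A.unitIso.hom.app X))

variable (A) in
lemma unitHom_naturality {X Y : C} (f : X ⟶ Y) :
    f ≫ A.unitHom Y = A.unitHom X ≫ (A.T 1).map f :=
  A.unitIso.hom.naturality f

variable (A) in
lemma unitHom_naturality_assoc {X Y W : C} (f : X ⟶ Y) (t : (A.T 1).obj Y ⟶ W) :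
    f ≫ A.unitHom Y ≫ t = A.unitHom X ≫ (A.T 1).map f ≫ t := by
  rw [reassoc_of% (A.unitHom_naturality f)]

variable (A) in
lemma map_one_injective {X Y : C} {f g : X ⟶ Y} (h : (A.T 1).map f = (A.T 1).map g) : f = g := by
  rw [← cancel_mono (A.unitHom Y), unitHom_naturality, unitHom_naturality, h]

variable (A) in
instance faithful_T (q : Q) : (A.T q).Faithful where
  map_injective {X Y f g} h := A.map_one_injective (by
    rw [← cancel_epi ((A.compIso (inv_mul_cancel q)).hom.app X), ← compIso_naturality,
      ← compIso_naturality, h])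

namespace EquivariantObject

/-- The normalisation at `1` is not part of the definition. It follows from the cocycle condition
for `1 * 1 = 1`, because `u 1` can be cancelled. -/
lemma unitHom_u (X : A.EquivariantObject) : A.unitHom X.obj ≫ (X.u 1).hom = 𝟙 X.obj := by
  have h := X.u_comp (mul_one (1 : Q))
  rw [cancel_mono] at h
  have h₁ : A.unitHom ((A.T 1).obj X.obj) ≫ (A.compIso (one_mul (1 : Q))).hom.app X.obj = 𝟙 _ :=
    A.unit_left 1 X.obj
  rw [h, ← unitHom_naturality] at h₁
  rw [← cancel_epi (X.u 1).hom, reassoc_of% h₁, Category.comp_id]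

lemma unitHom_u_assoc (X : A.EquivariantObject) {W : C} (t : X.obj ⟶ W) :
    A.unitHom X.obj ≫ (X.u 1).hom ≫ t = t := by
  rw [reassoc_of% X.unitHom_u]

section OfHom

variable (X : C) (u : ∀ q : Q, (A.T q).obj X ⟶ X)
  (u_comp : ∀ {q r s : Q} (h : q * r = s),
    (A.compIso h).hom.app X ≫ u s = (A.T q).map (u r) ≫ u q)
  (u_one : A.unitHom X ≫ u 1 = 𝟙 X)

include u_comp u_one in
-- The cocycle condition for `q * q⁻¹` splits `u q`; the one for `q⁻¹ * q` makes `T q⁻¹ (u q)` mono,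
-- and the faithful functor `T q⁻¹` then lets the section be a two-sided inverse.
lemma isIso_of_comp (q : Q) : IsIso (u q) := by
  have h1 : IsIso (u 1) := by
    rw [← IsIso.inv_eq_of_hom_inv_id u_one]
    infer_instance
  have hs : ∀ q, IsSplitEpi (u q) := fun q => by
    have : IsIso ((A.compIso (mul_inv_cancel q)).hom.app X ≫ u 1) := inferInstance
    exact IsSplitEpi.mk' ⟨inv ((A.compIso (mul_inv_cancel q)).hom.app X ≫ u 1) ≫
      (A.T q).map (u q⁻¹), by rw [Category.assoc, ← u_comp (mul_inv_cancel q), IsIso.inv_hom_id]⟩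
  have hm : Mono ((A.T q⁻¹).map (u q)) := by
    have : Mono ((A.T q⁻¹).map (u q) ≫ u q⁻¹) := by
      rw [← u_comp (inv_mul_cancel q)]
      infer_instance
    exact mono_of_mono _ (u q⁻¹)
  have := hs q
  refine ⟨section_ (u q), ?_, IsSplitEpi.id _⟩
  apply (A.T q⁻¹).map_injective
  rw [← cancel_mono ((A.T q⁻¹).map (u q)), ← Functor.map_comp, ← Functor.map_comp, Category.assoc,
    IsSplitEpi.id, Category.comp_id, Category.id_comp]

/-- An equivariant structure may be given by morphisms that are not yet known to be isomorphisms. -/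
def ofHom : A.EquivariantObject where
  obj := X
  u q := have := isIso_of_comp X u u_comp u_one q; asIso (u q)
  u_comp h := u_comp h

end OfHom

/-- The idempotent `1 - g r` projects onto the kernel of `g`. Neither `r` nor `e` need be
equivariant, but `u q` preserves the summand because `g` is equivariant, so the compression of `u q`
is again an equivariant structure. -/
lemma exists_kernel [IsIdempotentComplete C] {Y Z : A.EquivariantObject} (g : Y ⟶ Z)
    (r : Z.obj ⟶ Y.obj) (hr : g.hom ≫ r ≫ g.hom = g.hom) :
    ∃ (K : A.EquivariantObject) (i : K ⟶ Y) (e : Y.obj ⟶ K.obj),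
      i ≫ g = 0 ∧ i.hom ≫ e = 𝟙 _ ∧ e ≫ i.hom = 𝟙 _ - g.hom ≫ r := by
  obtain ⟨K, i, e, hie, hei⟩ := IsIdempotentComplete.idempotents_split Y.obj (𝟙 _ - g.hom ≫ r) (by
    have hr' : g.hom ≫ r ≫ g.hom ≫ r = g.hom ≫ r := by rw [reassoc_of% hr]
    simp [Preadditive.sub_comp, Preadditive.comp_sub, hr'])
  have hig : i ≫ g.hom = 0 := by
    have : i = i ≫ e ≫ i := by rw [reassoc_of% hie]
    rw [this, hei]
    simp [Preadditive.sub_comp, Preadditive.comp_sub, hr]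
  have h : ∀ q, (A.T q).map i ≫ (Y.u q).hom ≫ e ≫ i = (A.T q).map i ≫ (Y.u q).hom := fun q => by
    rw [hei, Preadditive.comp_sub, Preadditive.comp_sub, ← reassoc_of% (g.comm q),
      ← Functor.map_comp_assoc, hig]
    simp
  refine ⟨ofHom K (fun q => (A.T q).map i ≫ (Y.u q).hom ≫ e) (fun {q r s} hs => ?_) ?_,
    ⟨i, fun q => ?_⟩, e, EquivariantObject.hom_ext hig, hie, hei⟩
  · rw [← compIso_naturality_assoc, reassoc_of% Y.u_comp hs, ← Functor.map_comp_assoc,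
      ← Functor.map_comp_assoc, Category.assoc, Category.assoc, h]
  · rw [← unitHom_naturality_assoc, unitHom_u_assoc, hie]
  · exact ((Category.assoc _ _ _).trans ((_ ≫= Category.assoc _ _ _).trans (h q))).symm

lemma exists_cokernel [IsIdempotentComplete C] {Y Z : A.EquivariantObject} (g : Y ⟶ Z)
    (r : Z.obj ⟶ Y.obj) (hr : g.hom ≫ r ≫ g.hom = g.hom) :
    ∃ (L : A.EquivariantObject) (e : Z ⟶ L) (i : L.obj ⟶ Z.obj),
      g ≫ e = 0 ∧ i ≫ e.hom = 𝟙 _ ∧ e.hom ≫ i = 𝟙 _ - r ≫ g.hom := by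
  obtain ⟨L, i, e, hie, hei⟩ := IsIdempotentComplete.idempotents_split Z.obj (𝟙 _ - r ≫ g.hom) (by
    simp [Preadditive.sub_comp, Preadditive.comp_sub, hr])
  have hig : g.hom ≫ e = 0 := by
    have : e = e ≫ i ≫ e := by rw [hie, Category.comp_id]
    rw [this, reassoc_of% hei]
    simp [Preadditive.sub_comp, Preadditive.comp_sub, reassoc_of% hr]
  have h : ∀ q, (A.T q).map (e ≫ i) ≫ (Z.u q).hom ≫ e = (Z.u q).hom ≫ e := fun q => by
    rw [hei, Functor.map_sub, Preadditive.sub_comp, Functor.map_comp, Category.assoc,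
      reassoc_of% (g.comm q), hig]
    simp
  refine ⟨ofHom L (fun q => (A.T q).map i ≫ (Z.u q).hom ≫ e) (fun {q r s} hs => ?_) ?_,
    ⟨e, fun q => ?_⟩, i, EquivariantObject.hom_ext hig, hie, hei⟩
  · rw [← compIso_naturality_assoc, reassoc_of% Z.u_comp hs, Functor.map_comp, Functor.map_comp,
      Category.assoc, Category.assoc, ← Functor.map_comp_assoc _ e i, h]
  · rw [← unitHom_naturality_assoc, unitHom_u_assoc, hie]
  · have := h q
    rw [Functor.map_comp, Category.assoc] at this
    exact this

section Regular

variable [IsIdempotentComplete C] (hreg : ∀ {X Y : C} (f : X ⟶ Y), ∃ r, f ≫ r ≫ f = f)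

include hreg

/-- Monomorphisms of equivariant objects split as morphisms of the underlying objects. -/
lemma exists_retraction_hom {Y Z : A.EquivariantObject} (f : Y ⟶ Z) [Mono f] :
    ∃ r, f.hom ≫ r = 𝟙 Y.obj := by
  obtain ⟨r, hr⟩ := hreg f.hom
  obtain ⟨K, i, e, hi, -, he⟩ := exists_kernel f r hr
  rw [zero_of_comp_mono f hi, zero_hom, comp_zero] at he
  exact ⟨r, (sub_eq_zero.1 he.symm).symm⟩

/-- Epimorphisms of equivariant objects split as morphisms of the underlying objects. -/
lemma exists_section_hom {Y Z : A.EquivariantObject} (f : Y ⟶ Z) [Epi f] :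
    ∃ r, r ≫ f.hom = 𝟙 Z.obj := by
  obtain ⟨r, hr⟩ := hreg f.hom
  obtain ⟨L, e, i, he, -, hi⟩ := exists_cokernel f r hr
  rw [zero_of_epi_comp f he, zero_hom, zero_comp] at hi
  exact ⟨r, (sub_eq_zero.1 hi.symm).symm⟩

/-- The one-sided inverses in `C` coincide, and the inverse of an equivariant isomorphism is
equivariant. -/
lemma isIso_of_mono_epi {Y Z : A.EquivariantObject} (f : Y ⟶ Z) [Mono f] [Epi f] : IsIso f := by
  obtain ⟨r, hr⟩ := exists_retraction_hom hreg f
  obtain ⟨s, hs⟩ := exists_section_hom hreg f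
  have h : s = r := by rw [← Category.comp_id s, ← hr, reassoc_of% hs]
  exact (mkIso ⟨f.hom, r, hr, h ▸ hs⟩ f.comm).isIso_hom

lemma hasKernels : HasKernels A.EquivariantObject where
  has_limit {Y Z} g := by
    obtain ⟨r, hr⟩ := hreg g.hom
    obtain ⟨K, i, e, hi, hie, hei⟩ := exists_kernel g r hr
    have hm : Mono i.hom := (IsSplitMono.mk' ⟨e, hie⟩).mono
    have hfac : ∀ {W : A.EquivariantObject} (t : W ⟶ Y), t ≫ g = 0 → (t.hom ≫ e) ≫ i.hom = t.hom :=
      fun t ht => by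
        have := congrArg Hom.hom ht
        rw [comp_hom, zero_hom] at this
        rw [Category.assoc, hei, Preadditive.comp_sub, Category.comp_id, reassoc_of% this,
          zero_comp, sub_zero]
    refine ⟨⟨_, KernelFork.IsLimit.ofι i hi (fun t ht => ⟨t.hom ≫ e, fun q => ?_⟩)
      (fun t ht => hom_ext (hfac t ht)) fun t ht m hm' => hom_ext ?_⟩⟩
    · rw [← cancel_mono i.hom, Category.assoc, ← i.comm, ← Functor.map_comp_assoc, hfac t ht,
        Category.assoc, hfac t ht, t.comm]
    · rw [← cancel_mono i.hom]
      exact (congrArg Hom.hom hm').trans (hfac t ht).symm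

lemma hasCokernels : HasCokernels A.EquivariantObject where
  has_colimit {Y Z} g := by
    obtain ⟨r, hr⟩ := hreg g.hom
    obtain ⟨L, e, i, he, hie, hei⟩ := exists_cokernel g r hr
    have hm : Epi e.hom := (IsSplitEpi.mk' ⟨i, hie⟩).epi
    have hm' : ∀ q, Epi ((A.T q).map e.hom) := fun q =>
      (IsSplitEpi.mk' ⟨(A.T q).map i, by rw [← Functor.map_comp, hie, CategoryTheory.Functor.map_id]⟩).epi
    have hfac : ∀ {W : A.EquivariantObject} (t : Z ⟶ W), g ≫ t = 0 → e.hom ≫ (i ≫ t.hom) = t.hom :=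
      fun t ht => by
        have := congrArg Hom.hom ht
        rw [comp_hom, zero_hom] at this
        rw [reassoc_of% hei, Preadditive.sub_comp, Category.id_comp, Category.assoc, this,
          comp_zero, sub_zero]
    refine ⟨⟨_, CokernelCofork.IsColimit.ofπ e he (fun t ht => ⟨i ≫ t.hom, fun q => ?_⟩)
      (fun t ht => hom_ext (hfac t ht)) fun t ht m hm' => hom_ext ?_⟩⟩
    · rw [← cancel_epi ((A.T q).map e.hom), ← Functor.map_comp_assoc, hfac t ht,
        reassoc_of% e.comm, hfac t ht, t.comm]
    · rw [← cancel_epi e.hom]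
      exact (congrArg Hom.hom hm').trans (hfac t ht).symm

lemma isNormalMonoCategory : IsNormalMonoCategory A.EquivariantObject where
  normalMonoOfMono {Y Z} f _ := by
    obtain ⟨r, hr⟩ := exists_retraction_hom hreg f
    have hr' : f.hom ≫ r ≫ f.hom = f.hom := by rw [reassoc_of% hr]
    obtain ⟨L, e, i, he, hie, hei⟩ := exists_cokernel f r hr'
    have hm : Mono f.hom := (IsSplitMono.mk' ⟨r, hr⟩).mono
    have hfac : ∀ {W : A.EquivariantObject} (t : W ⟶ Z), t ≫ e = 0 → (t.hom ≫ r) ≫ f.hom = t.hom :=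
      fun t ht => by
        have := congrArg Hom.hom ht
        rw [comp_hom, zero_hom] at this
        have h := t.hom ≫= hei
        rw [reassoc_of% this, zero_comp, Preadditive.comp_sub, Category.comp_id] at h
        exact (Category.assoc _ _ _).trans (sub_eq_zero.1 h.symm).symm
    refine ⟨⟨L, e, he, KernelFork.IsLimit.ofι f he (fun t ht => ⟨t.hom ≫ r, fun q => ?_⟩)
      (fun t ht => hom_ext (hfac t ht)) fun t ht m hm' => hom_ext ?_⟩⟩
    · rw [← cancel_mono f.hom, Category.assoc, ← f.comm, ← Functor.map_comp_assoc, hfac t ht,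
        Category.assoc, hfac t ht, t.comm]
    · rw [← cancel_mono f.hom]
      exact (congrArg Hom.hom hm').trans (hfac t ht).symm

lemma isNormalEpiCategory : IsNormalEpiCategory A.EquivariantObject where
  normalEpiOfEpi {Y Z} f _ := by
    obtain ⟨r, hr⟩ := exists_section_hom hreg f
    have hr' : f.hom ≫ r ≫ f.hom = f.hom := by rw [hr, Category.comp_id]
    obtain ⟨K, i, e, hi, hie, hei⟩ := exists_kernel f r hr'
    have hm : Epi f.hom := (IsSplitEpi.mk' ⟨r, hr⟩).epi
    have hm' : ∀ q, Epi ((A.T q).map f.hom) := fun q =>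
      (IsSplitEpi.mk' ⟨(A.T q).map r, by rw [← Functor.map_comp, hr, CategoryTheory.Functor.map_id]⟩).epi
    have hfac : ∀ {W : A.EquivariantObject} (t : Y ⟶ W), i ≫ t = 0 → f.hom ≫ (r ≫ t.hom) = t.hom :=
      fun t ht => by
        have := congrArg Hom.hom ht
        rw [comp_hom, zero_hom] at this
        have h := hei =≫ t.hom
        rw [Category.assoc, this, comp_zero, Preadditive.sub_comp, Category.id_comp,
          Category.assoc] at h
        exact (sub_eq_zero.1 h.symm).symm
    refine ⟨⟨K, i, hi, CokernelCofork.IsColimit.ofπ f hi (fun t ht => ⟨r ≫ t.hom, fun q => ?_⟩)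
      (fun t ht => hom_ext (hfac t ht)) fun t ht m hm' => hom_ext ?_⟩⟩
    · rw [← cancel_epi ((A.T q).map f.hom), ← Functor.map_comp_assoc, hfac t ht,
        reassoc_of% f.comm, hfac t ht, t.comm]
    · rw [← cancel_epi f.hom]
      exact (congrArg Hom.hom hm').trans (hfac t ht).symm

/-- The part of an exact sequence of equivariant objects that is split in the underlying category. -/
lemma exists_contraction {Y₁ Y₂ Y₃ : A.EquivariantObject} (f : Y₁ ⟶ Y₂) (g : Y₂ ⟶ Y₃)
    (w : f ≫ g = 0) [(ShortComplex.mk f g w).HasHomology] (h : (ShortComplex.mk f g w).Exact) :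
    ∃ (a : Y₃.obj ⟶ Y₂.obj) (b : Y₂.obj ⟶ Y₁.obj), g.hom ≫ a + b ≫ f.hom = 𝟙 Y₂.obj := by
  have := hasKernels (A := A) hreg
  obtain ⟨r, hr⟩ := hreg g.hom
  obtain ⟨K, i, e, hi, hie, hei⟩ := exists_kernel g r hr
  have : Epi (kernel.lift g f w) := (ShortComplex.exact_iff_epi_kernel_lift _).1 h
  obtain ⟨s, hs⟩ := exists_section_hom hreg (kernel.lift g f w)
  have h₁ : (kernel.lift g i hi).hom ≫ (kernel.ι g).hom = i.hom := by
    rw [← comp_hom, kernel.lift_ι]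
  have h₂ : (kernel.lift g f w).hom ≫ (kernel.ι g).hom = f.hom := by
    rw [← comp_hom, kernel.lift_ι]
  refine ⟨r, e ≫ (kernel.lift g i hi).hom ≫ s, ?_⟩
  rw [Category.assoc, Category.assoc, ← h₂, reassoc_of% hs, h₁, hei]
  simp

/-- The dimension of `Hom(X, S)`, taken in `C`, is strictly increasing in the subobject `S` and
bounded by that of `End X`. -/
lemma isFiniteLength (hfin : ∀ X Y : C, Module.Finite k (X ⟶ Y)) (X : A.EquivariantObject) :
    IsNoetherianObject X ∧ IsArtinianObject X := by
  let d : Subobject X → ℕ := fun S => Module.finrank k (X.obj ⟶ (S : A.EquivariantObject).obj)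
  have hd : StrictMono d := fun S S' h => by
    let t := Subobject.ofLE S S' h.le
    obtain ⟨r, hr⟩ := exists_retraction_hom hreg t
    let L : (X.obj ⟶ (S : A.EquivariantObject).obj) →ₗ[k] (X.obj ⟶ (S' : A.EquivariantObject).obj) :=
      Linear.rightComp k X.obj t.hom
    have hL : ∀ x, L x = x ≫ t.hom := fun x => rfl
    have hinj : Function.Injective L := fun x y hxy => by
      rw [hL, hL] at hxy
      have := hxy =≫ r
      simpa [hr] using this
    refine lt_of_le_of_ne (LinearMap.finrank_le_finrank_of_injective hinj) fun heq => h.not_ge ?_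
    have hsurj := (LinearMap.injective_iff_surjective_of_finrank_eq_finrank heq).1 hinj
    -- With equal dimensions the retraction `ρ : X ⟶ S'` factors through `S`, so the inclusion of
    -- `S` in `S'` is split epi in `C` and hence an isomorphism.
    obtain ⟨ρ, hρ⟩ := exists_retraction_hom hreg S'.arrow
    obtain ⟨y, hy⟩ := hsurj ρ
    rw [hL] at hy
    have : Epi t := ⟨fun a b hab => hom_ext (by
      have := congrArg Hom.hom hab
      rw [comp_hom, comp_hom] at this
      rw [← Category.id_comp a.hom, ← Category.id_comp b.hom, ← hρ, ← hy]
      simp only [Category.assoc, this])⟩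
    have := isIso_of_mono_epi hreg t
    exact Subobject.le_of_comm (inv t) (by rw [IsIso.inv_comp_eq, Subobject.ofLE_arrow])
  have hb : ∀ S, d S ≤ Module.finrank k (X.obj ⟶ X.obj) := fun S => by
    obtain ⟨r, hr⟩ := exists_retraction_hom hreg S.arrow
    refine LinearMap.finrank_le_finrank_of_injective (f := Linear.rightComp k X.obj S.arrow.hom)
      fun x y hxy => ?_
    have := (show x ≫ S.arrow.hom = y ≫ S.arrow.hom from hxy) =≫ r
    simpa [hr] using this
  refine ⟨(isNoetherianObject_iff_not_strictMono X).2 fun f hf => ?_,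
    (isArtinianObject_iff_not_strictAnti X).2 fun f hf => ?_⟩
  · exact absurd ((hd.comp hf).id_le (Module.finrank k (X.obj ⟶ X.obj) + 1))
      (not_le.2 (Nat.lt_succ_of_le (hb _)))
  · exact not_strictAnti_of_wellFoundedLT (d ∘ f) (hd.comp_strictAnti hf)

end Regular

end EquivariantObject

end SymmetricAction

end

end TensorEnvelope

namespace TensorEnvelope

open CategoryTheory MonoidalCategory Limits Functor.LaxMonoidal Functor.OplaxMonoidal

noncomputable section

set_option linter.unusedSectionVars false

/-! ### Duals, biproducts and smallness of the equivariantization -/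

section Mates

variable {C : Type u₁} [Category.{v₁} C] [MonoidalCategory C]

/-- Morphisms into the second object of a dual pair are determined by their pairing. -/
lemma eq_of_whiskerRight_evaluation {Y Y' W : C} [ExactPairing Y Y'] {a b : W ⟶ Y'}
    (h : a ▷ Y ≫ ε_ Y Y' = b ▷ Y ≫ ε_ Y Y') : a = b := by
  have key : ∀ a : W ⟶ Y', (tensorRightHomEquiv W Y Y' (𝟙_ C)) (a ▷ Y ≫ ε_ Y Y') =
      a ≫ (λ_ Y').inv := fun a => by
    rw [← Equiv.eq_symm_apply]
    simp [tensorRightHomEquiv, ← unitors_equal]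
  rw [← cancel_mono (λ_ Y').inv, ← key, ← key, h]

/-- An isomorphism between objects with duals can be dualized. -/
lemma exists_mate {Y Y' Z Z' : C} [hY : ExactPairing Y Y'] [hZ : ExactPairing Z Z'] (u : Z ≅ Y) :
    ∃ v : Z' ⟶ Y', (v ⊗ₘ u.hom) ≫ ε_ Y Y' = ε_ Z Z' ∧ η_ Z Z' ≫ (u.hom ⊗ₘ v) = η_ Y Y' := by
  let : HasRightDual Y := ⟨Y'⟩
  let : HasRightDual Z := ⟨Z'⟩
  -- The transpose of `u.inv` goes from `Z'` to `Y'`, the direction in which the pair `(u, v)`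
  -- preserves evaluation and coevaluation.
  obtain ⟨v, h₁, h₂⟩ : ∃ v : Z' ⟶ Y', v ▷ Y ≫ ε_ Y Y' = Z' ◁ u.inv ≫ ε_ Z Z' ∧
      η_ Z Z' ≫ Z ◁ v = η_ Y Y' ≫ u.inv ▷ Y' :=
    ⟨u.invᘁ, rightAdjointMate_comp_evaluation u.inv, coevaluation_comp_rightAdjointMate u.inv⟩
  refine ⟨v, ?_, ?_⟩
  · rw [MonoidalCategory.tensorHom_def', Category.assoc, h₁, ← MonoidalCategory.whiskerLeft_comp_assoc,
      u.hom_inv_id, MonoidalCategory.whiskerLeft_id, Category.id_comp]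
  · rw [MonoidalCategory.tensorHom_def, ← whisker_exchange, reassoc_of% h₂, ← comp_whiskerRight,
      u.inv_hom_id, id_whiskerRight, Category.comp_id]

end Mates

namespace SymmetricAction

variable {k : Type u} [Field k] {Q : Type w} [Group Q]
  {C : Type u₁} [Category.{v₁} C] [Preadditive C] [Linear k C]
  [MonoidalCategory C] [SymmetricCategory C] {A : SymmetricAction k Q C}

variable (A) in
lemma compIso_δ {q r s : Q} (h : q * r = s) (X Y : C) :
    (A.compIso h).hom.app (X ⊗ Y) ≫ δ (A.T s) X Y =
      (A.T q).map (δ (A.T r) X Y) ≫ δ (A.T q) _ _ ≫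
        ((A.compIso h).hom.app X ⊗ₘ (A.compIso h).hom.app Y) := by
  rw [← cancel_epi (μ (A.T r ⋙ A.T q) X Y), NatTrans.IsMonoidal.tensor_assoc]
  simp only [Functor.LaxMonoidal.comp_μ, Functor.Monoidal.μ_δ, Category.comp_id, Category.assoc]
  rw [← Functor.map_comp_assoc (A.T q) (μ (A.T r) _ _), Functor.Monoidal.μ_δ,
    CategoryTheory.Functor.map_id, Category.id_comp, Functor.Monoidal.μ_δ_assoc]

variable (A) in
lemma compIso_δ_assoc {q r s : Q} (h : q * r = s) (X Y : C) {W : C}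
    (t : (A.T s).obj X ⊗ (A.T s).obj Y ⟶ W) :
    (A.compIso h).hom.app (X ⊗ Y) ≫ δ (A.T s) X Y ≫ t =
      (A.T q).map (δ (A.T r) X Y) ≫ δ (A.T q) _ _ ≫
        ((A.compIso h).hom.app X ⊗ₘ (A.compIso h).hom.app Y) ≫ t := by
  rw [reassoc_of% (A.compIso_δ h X Y)]

variable (A) in
lemma compIso_η {q r s : Q} (h : q * r = s) :
    (A.compIso h).hom.app (𝟙_ C) ≫ η (A.T s) = (A.T q).map (η (A.T r)) ≫ η (A.T q) := by
  rw [← cancel_epi (ε (A.T r ⋙ A.T q)), NatTrans.IsMonoidal.unit_assoc]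
  simp

variable (A) in
lemma unitHom_δ (X Y : C) :
    A.unitHom (X ⊗ Y) ≫ δ (A.T 1) X Y = A.unitHom X ⊗ₘ A.unitHom Y := by
  have := A.unitIso_isMonoidal.tensor X Y
  rw [← cancel_mono (μ (A.T 1) X Y), Category.assoc, Functor.Monoidal.δ_μ]
  simpa [unitHom] using this

variable (A) in
lemma unitHom_δ_assoc (X Y : C) {W : C} (t : (A.T 1).obj X ⊗ (A.T 1).obj Y ⟶ W) :
    A.unitHom (X ⊗ Y) ≫ δ (A.T 1) X Y ≫ t = (A.unitHom X ⊗ₘ A.unitHom Y) ≫ t := by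
  rw [reassoc_of% (A.unitHom_δ X Y)]

variable (A) in
lemma unitHom_η : A.unitHom (𝟙_ C) ≫ η (A.T 1) = 𝟙 _ := by
  have := A.unitIso_isMonoidal.unit
  rw [← cancel_mono (ε (A.T 1)), Category.assoc, Functor.Monoidal.η_ε]
  simpa [unitHom] using this

namespace EquivariantObject

/-- `T q` carries the dual pair of `Y.obj` to a dual pair, and the mate `v q` of `u q` is the
structure on the dual. Evaluation and coevaluation are then equivariant by construction. -/
lemma hasRightDual (Y : A.EquivariantObject) (h : Nonempty (HasRightDual Y.obj)) :
    Nonempty (HasRightDual Y) := by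
  obtain ⟨⟨Y', _⟩⟩ := h
  have hT : ∀ q, ∃ v : (A.T q).obj Y' ⟶ Y',
      δ (A.T q) Y' Y.obj ≫ (v ⊗ₘ (Y.u q).hom) ≫ ε_ Y.obj Y' =
        (A.T q).map (ε_ Y.obj Y') ≫ η (A.T q) ∧
      (A.T q).map (η_ Y.obj Y') ≫ δ (A.T q) Y.obj Y' ≫ ((Y.u q).hom ⊗ₘ v) =
        η (A.T q) ≫ η_ Y.obj Y' := fun q => by
    let := exactPairingMap (A.T q) Y.obj Y'
    obtain ⟨v, h₁, h₂⟩ := exists_mate (Y' := Y') (Z' := (A.T q).obj Y') (Y.u q)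
    refine ⟨v, ?_, ?_⟩
    · rw [h₁, ← cancel_epi (μ (A.T q) Y' Y.obj), Functor.Monoidal.μ_δ_assoc]
      rfl
    · rw [← cancel_epi (ε (A.T q)), Functor.Monoidal.ε_η_assoc]
      refine Eq.trans ?_ h₂
      change _ = (ε (A.T q) ≫ (A.T q).map (η_ Y.obj Y') ≫ δ (A.T q) Y.obj Y') ≫ _
      simp only [Category.assoc]
  choose v hε hη using hT
  have hcomp : ∀ {q r s : Q} (h : q * r = s),
      (A.compIso h).hom.app Y' ≫ v s = (A.T q).map (v r) ≫ v q := fun {q r s} h => by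
    -- A morphism to `Y'` is determined by its pairing with `Y`, so the cocycle condition for `v`
    -- follows from that of `u`.
    apply eq_of_whiskerRight_evaluation (Y := Y.obj)
    have key : δ (A.T q) _ _ ≫ (((A.compIso h).hom.app Y' ≫ v s) ⊗ₘ
          ((A.compIso h).hom.app Y.obj ≫ (Y.u s).hom)) ≫ ε_ Y.obj Y' =
        δ (A.T q) _ _ ≫ (((A.T q).map (v r) ≫ v q) ⊗ₘ
          ((A.compIso h).hom.app Y.obj ≫ (Y.u s).hom)) ≫ ε_ Y.obj Y' := by
      rw [← cancel_epi ((A.T q).map (δ (A.T r) Y' Y.obj)), ← tensorHom_comp_tensorHom,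
        Category.assoc, ← compIso_δ_assoc, hε, Y.u_comp, ← tensorHom_comp_tensorHom,
        Category.assoc, δ_natural_assoc, hε, ← Functor.map_comp_assoc, ← Functor.map_comp_assoc,
        ← compIso_naturality_assoc, compIso_η, Category.assoc, hε, Functor.map_comp_assoc]
    rw [cancel_epi, MonoidalCategory.tensorHom_def', MonoidalCategory.tensorHom_def',
      Category.assoc, Category.assoc, cancel_epi] at key
    exact key
  have hone : A.unitHom Y' ≫ v 1 = 𝟙 Y' := by
    apply eq_of_whiskerRight_evaluation (Y := Y.obj)
    have := hε 1
    rw [← cancel_epi (A.unitHom _), unitHom_δ_assoc, tensorHom_comp_tensorHom_assoc, unitHom_u,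
      ← unitHom_naturality_assoc, unitHom_η, Category.comp_id, tensorHom_id] at this
    rw [this, id_whiskerRight, Category.id_comp]
  refine ⟨@HasRightDual.mk _ _ _ Y (ofHom Y' v hcomp hone) ?_⟩
  exact
    { coevaluation' := ⟨η_ Y.obj Y', fun q => hη q⟩
      evaluation' := ⟨ε_ Y.obj Y', fun q =>
        (hε q).symm.trans (Category.assoc _ _ _).symm⟩
      coevaluation_evaluation' := Hom.ext (ExactPairing.coevaluation_evaluation Y.obj Y')
      evaluation_coevaluation' := Hom.ext (ExactPairing.evaluation_coevaluation Y.obj Y') }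

lemma hasFiniteProducts [HasFiniteBiproducts C] : HasFiniteProducts A.EquivariantObject := by
  have : HasBinaryBiproducts C := hasBinaryBiproducts_of_finite_biproducts C
  have : HasZeroObject C := hasZeroObject_of_hasFiniteBiproducts C
  have hz : HasTerminal A.EquivariantObject := by
    let Z : A.EquivariantObject := ofHom (HasZeroObject.zero' C).zero (fun q => 0) (by simp)
      ((isZero_zero C).eq_of_src _ _)
    have : IsZero Z := (IsZero.iff_id_eq_zero Z).2 (hom_ext ((isZero_zero C).eq_of_src _ _))
    exact (this.isTerminal).hasTerminal
  have hb : HasBinaryBiproducts A.EquivariantObject := ⟨fun Y Z => by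
    let t : ∀ q, (A.T q).obj (Y.obj ⊞ Z.obj) ⟶ Y.obj ⊞ Z.obj := fun q =>
      biprod.lift ((A.T q).map biprod.fst ≫ (Y.u q).hom) ((A.T q).map biprod.snd ≫ (Z.u q).hom)
    have h₁ : ∀ q, t q ≫ biprod.fst = (A.T q).map biprod.fst ≫ (Y.u q).hom := fun q => by simp [t]
    have h₂ : ∀ q, t q ≫ biprod.snd = (A.T q).map biprod.snd ≫ (Z.u q).hom := fun q => by simp [t]
    let W : A.EquivariantObject := ofHom (Y.obj ⊞ Z.obj) t
      (fun {q r s} h => by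
        refine biprod.hom_ext _ _ ?_ ?_
        · rw [Category.assoc, Category.assoc, h₁, h₁, ← compIso_naturality_assoc, Y.u_comp,
            ← Functor.map_comp_assoc, ← h₁, Functor.map_comp_assoc]
        · rw [Category.assoc, Category.assoc, h₂, h₂, ← compIso_naturality_assoc, Z.u_comp,
            ← Functor.map_comp_assoc, ← h₂, Functor.map_comp_assoc])
      (by
        refine biprod.hom_ext _ _ ?_ ?_
        · rw [Category.assoc, h₁, ← unitHom_naturality_assoc, unitHom_u]
          simp
        · rw [Category.assoc, h₂, ← unitHom_naturality_assoc, unitHom_u]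
          simp)
    have h₃ : ∀ q, (A.T q).map biprod.inl ≫ t q = (Y.u q).hom ≫ biprod.inl := fun q => by
      refine biprod.hom_ext _ _ ?_ ?_
      · rw [Category.assoc, h₁, ← Functor.map_comp_assoc]
        simp
      · rw [Category.assoc, h₂, ← Functor.map_comp_assoc]
        simp
    have h₄ : ∀ q, (A.T q).map biprod.inr ≫ t q = (Z.u q).hom ≫ biprod.inr := fun q => by
      refine biprod.hom_ext _ _ ?_ ?_
      · rw [Category.assoc, h₁, ← Functor.map_comp_assoc]
        simp
      · rw [Category.assoc, h₂, ← Functor.map_comp_assoc]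
        simp
    let b : BinaryBicone Y Z :=
      { pt := W
        fst := ⟨biprod.fst, fun q => (h₁ q).symm⟩
        snd := ⟨biprod.snd, fun q => (h₂ q).symm⟩
        inl := ⟨biprod.inl, h₃⟩
        inr := ⟨biprod.inr, h₄⟩
        inl_fst := hom_ext biprod.inl_fst
        inl_snd := hom_ext biprod.inl_snd
        inr_fst := hom_ext biprod.inr_fst
        inr_snd := hom_ext biprod.inr_snd }
    exact hasBinaryBiproduct_of_total b (hom_ext biprod.total)⟩
  exact hasFiniteProducts_of_has_binary_and_terminal

/-- Up to isomorphism an equivariant object is an object of the small model of `C` with a family of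
morphisms indexed by `Q`. Finiteness of `Q` keeps such data small although `Q` lives in another
universe. -/
lemma essentiallySmall [Finite Q] [EssentiallySmall.{v₁} C] :
    EssentiallySmall.{v₁} A.EquivariantObject := by
  let E := equivSmallModel.{v₁} C
  let S := Σ b : SmallModel.{v₁} C, ∀ q : Q, (A.T q).obj (E.inverse.obj b) ⟶ E.inverse.obj b
  have hp : ∀ Z : A.EquivariantObject, ∃ (p : S) (e : E.inverse.obj p.1 ≅ Z.obj),
      ∀ q, (A.T q).map e.hom ≫ (Z.u q).hom = p.2 q ≫ e.hom := fun Z =>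
    ⟨⟨E.functor.obj Z.obj, fun q => (A.T q).map (E.unitIso.inv.app Z.obj) ≫ (Z.u q).hom ≫
      E.unitIso.hom.app Z.obj⟩, (E.unitIso.app Z.obj).symm, fun q => by simp⟩
  choose p e he using hp
  rw [essentiallySmall_iff]
  refine ⟨small_of_injective (β := S)
    (f := fun Z : Skeleton A.EquivariantObject => p ((fromSkeleton _).obj Z)) fun Z Z' h => ?_,
      inferInstance⟩
  have key : ∀ (p : S) (Z Z' : A.EquivariantObject) (e : E.inverse.obj p.1 ≅ Z.obj)
      (e' : E.inverse.obj p.1 ≅ Z'.obj),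
      (∀ q, (A.T q).map e.hom ≫ (Z.u q).hom = p.2 q ≫ e.hom) →
      (∀ q, (A.T q).map e'.hom ≫ (Z'.u q).hom = p.2 q ≫ e'.hom) → Nonempty (Z ≅ Z') :=
    fun p Z Z' e e' h h' => ⟨mkIso (e.symm ≪≫ e') fun q => by
      rw [← cancel_epi ((A.T q).map e.hom), reassoc_of% h q, ← Functor.map_comp_assoc]
      simp [h']⟩
  have : ∀ (p' : S) (Z : A.EquivariantObject), p Z = p' → ∃ (e : E.inverse.obj p'.1 ≅ Z.obj),
      ∀ q, (A.T q).map e.hom ≫ (Z.u q).hom = p'.2 q ≫ e.hom := by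
    rintro _ Z rfl
    exact ⟨e Z, he Z⟩
  obtain ⟨e₁, h₁⟩ := this _ _ h
  obtain ⟨i⟩ := key _ _ _ _ _ h₁ (he _)
  exact skeleton_skeletal _ ⟨(fromSkeleton _).preimageIso i⟩

/-- The equivariantization of a von Neumann regular pseudo-tensor category is a tensor category. -/
lemma isTensorCategory [Finite Q] [MonoidalPreadditive C] [MonoidalLinear k C]
    (hC : IsPseudoTensorCategory k C) (hreg : ∀ {X Y : C} (f : X ⟶ Y), ∃ r, f ≫ r ≫ f = f) :
    IsTensorCategory k A.EquivariantObject := by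
  have := hC.isIdempotentComplete
  have := hC.essentiallySmall
  have := hC.hasFiniteBiproducts
  exact
    { essentiallySmall := essentiallySmall
      hasFiniteProducts := hasFiniteProducts
      hasKernels := hasKernels hreg
      hasCokernels := hasCokernels hreg
      isNormalMonoCategory := isNormalMonoCategory hreg
      isNormalEpiCategory := isNormalEpiCategory hreg
      isNoetherianObject := fun X => (isFiniteLength hreg hC.finite_hom X).1
      isArtinianObject := fun X => (isFiniteLength hreg hC.finite_hom X).2
      bijective_unit := ⟨fun a b h => hC.bijective_unit.1 (congrArg Hom.hom h), fun f => by
        obtain ⟨a, ha⟩ := hC.bijective_unit.2 f.hom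
        exact ⟨a, hom_ext ha⟩⟩
      hasLeftDual := fun X => by
        obtain ⟨_⟩ := hasRightDual X (hC.hasRightDual X.obj)
        exact ⟨BraidedCategory.hasLeftDualOfHasRightDual⟩
      hasRightDual := fun X => hasRightDual X (hC.hasRightDual X.obj) }

end EquivariantObject

end SymmetricAction

end

end TensorEnvelope

namespace TensorEnvelope

open CategoryTheory MonoidalCategory Limits Functor.LaxMonoidal Functor.OplaxMonoidal

noncomputable section

set_option linter.unusedSectionVars false

/-! ### Traces and induced objects in the equivariantization -/

namespace SymmetricAction

variable {k : Type u} [Field k] {Q : Type w} [Group Q]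
  {C : Type u₁} [Category.{v₁} C] [Preadditive C] [Linear k C]
  [MonoidalCategory C] [SymmetricCategory C] {A : SymmetricAction k Q C}

namespace EquivariantObject

lemma u_inv_compIso (Y : A.EquivariantObject) {q r s : Q} (h : q * r = s) :
    (A.T q).map (Y.u r).inv ≫ (A.compIso h).hom.app Y.obj = (Y.u q).hom ≫ (Y.u s).inv := by
  rw [← cancel_mono (Y.u s).hom, Category.assoc, Y.u_comp, ← Functor.map_comp_assoc]
  simp

lemma u_inv_compIso_assoc (Y : A.EquivariantObject) {q r s : Q} (h : q * r = s) {W : C}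
    (t : (A.T s).obj Y.obj ⟶ W) :
    (A.T q).map (Y.u r).inv ≫ (A.compIso h).hom.app Y.obj ≫ t =
      (Y.u q).hom ≫ (Y.u s).inv ≫ t := by
  rw [reassoc_of% (Y.u_inv_compIso h)]

/-- The conjugate of a morphism of the underlying objects by an element of the group. -/
def conj {Y Z : A.EquivariantObject} (a : Y.obj ⟶ Z.obj) (q : Q) : Y.obj ⟶ Z.obj :=
  (Y.u q).inv ≫ (A.T q).map a ≫ (Z.u q).hom

lemma u_one_inv (Y : A.EquivariantObject) : (Y.u 1).inv = A.unitHom Y.obj := by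
  rw [← cancel_mono (Y.u 1).hom, unitHom_u, Iso.inv_hom_id]

lemma conj_one {Y Z : A.EquivariantObject} (a : Y.obj ⟶ Z.obj) : conj a 1 = a := by
  rw [conj, u_one_inv, ← unitHom_naturality_assoc, unitHom_u, Category.comp_id]

/-- Conjugation by `q` permutes the conjugates of `a`; this makes their sum over `Q` equivariant. -/
lemma map_conj_u {Y Z : A.EquivariantObject} (a : Y.obj ⟶ Z.obj) {q r s : Q} (h : q * r = s) :
    (A.T q).map (conj a r) ≫ (Z.u q).hom = (Y.u q).hom ≫ conj a s := by
  rw [conj, conj, ← u_inv_compIso_assoc Y h, ← compIso_naturality_assoc, Z.u_comp]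
  simp

variable [Fintype Q]

/-- The trace of a morphism of the underlying objects: the sum of its conjugates. -/
def trace {Y Z : A.EquivariantObject} (a : Y.obj ⟶ Z.obj) : Y ⟶ Z where
  hom := ∑ q : Q, conj a q
  comm r := by
    rw [Functor.map_sum, Preadditive.sum_comp, Preadditive.comp_sum]
    exact (Finset.sum_congr rfl fun q _ => map_conj_u a (s := r * q) rfl).trans
      (Equiv.sum_comp (Equiv.mulLeft r) fun q => (Y.u r).hom ≫ conj a q)

lemma trace_hom {Y Z : A.EquivariantObject} (a : Y.obj ⟶ Z.obj) :
    (trace a).hom = ∑ q : Q, conj a q := rfl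

lemma trace_add {Y Z : A.EquivariantObject} (a b : Y.obj ⟶ Z.obj) :
    trace (a + b) = trace a + trace b :=
  hom_ext (by simp [add_hom, trace_hom, conj, Finset.sum_add_distrib])

lemma trace_smul {Y Z : A.EquivariantObject} (c : k) (a : Y.obj ⟶ Z.obj) :
    trace (c • a) = c • trace a :=
  hom_ext (by simp [smul_hom, trace_hom, conj, Finset.smul_sum])

/-- With `comp_trace`, traces form a two-sided ideal; an object whose identity is a trace has only
traces as morphisms from it and to it. -/
lemma trace_comp {Y Z W : A.EquivariantObject} (a : Y.obj ⟶ Z.obj) (f : Z ⟶ W) :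
    trace a ≫ f = trace (a ≫ f.hom) :=
  hom_ext (by simp [trace_hom, conj, Preadditive.sum_comp, f.comm])

lemma comp_trace {Y Z W : A.EquivariantObject} (f : Y ⟶ Z) (a : Z.obj ⟶ W.obj) :
    f ≫ trace a = trace (f.hom ≫ a) :=
  hom_ext (by
    have h : ∀ q, f.hom ≫ (Z.u q).inv = (Y.u q).inv ≫ (A.T q).map f.hom := fun q => by
      rw [Iso.comp_inv_eq, Category.assoc, f.comm, Iso.inv_hom_id_assoc]
    simp [trace_hom, conj, Preadditive.comp_sum, reassoc_of% h])

lemma trace_whiskerRight [MonoidalPreadditive C] {X Z : A.EquivariantObject}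
    (a : X.obj ⟶ Z.obj) (Y : A.EquivariantObject) :
    trace (Y := X ⊗ Y) (Z := Z ⊗ Y) (a ▷ Y.obj) = trace a ▷ Y := by
  refine hom_ext ?_
  change ∑ q : Q, _ = (∑ q : Q, _) ▷ Y.obj
  rw [sum_whiskerRight]
  refine Finset.sum_congr rfl fun q _ => ?_
  refine (Iso.inv_comp_eq ((tensor X Y).u q)).2 ?_
  change (A.T q).map (a ▷ Y.obj) ≫ δ (A.T q) Z.obj Y.obj ≫ ((Z.u q).hom ⊗ₘ (Y.u q).hom) =
    (δ (A.T q) X.obj Y.obj ≫ ((X.u q).hom ⊗ₘ (Y.u q).hom)) ≫ _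
  rw [← δ_natural_left_assoc, Category.assoc, ← tensorHom_id, ← tensorHom_id,
    tensorHom_comp_tensorHom, tensorHom_comp_tensorHom, conj]
  simp

end EquivariantObject

open EquivariantObject

variable [Fintype Q]

/-- Data that exhibit an equivariant object `Y` as induced from the object `V` of the underlying
category: the sum of the conjugates of the summand `V` of `Y.obj` is `Y.obj`. -/
structure Induction (V : C) (Y : A.EquivariantObject) where
  incl : V ⟶ Y.obj
  eval : Y.obj ⟶ V
  incl_eval : incl ≫ eval = 𝟙 V
  orthogonal : ∀ q : Q, q ≠ 1 → incl ≫ (Y.u q).inv ≫ (A.T q).map eval = 0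
  total : trace (eval ≫ incl) = 𝟙 Y

namespace Induction

section

variable {V : C} {Y : A.EquivariantObject} (P : Induction V Y)

/-- Frobenius reciprocity: `b` is recovered from the equivariant morphism it induces, since
orthogonality leaves only the term at `1`. -/
lemma incl_trace {Z : A.EquivariantObject} (b : V ⟶ Z.obj) :
    P.incl ≫ (trace (P.eval ≫ b)).hom = b := by
  rw [trace_hom, Preadditive.comp_sum, Finset.sum_eq_single 1, conj_one,
    reassoc_of% P.incl_eval]
  · intro q _ hq
    rw [conj, Functor.map_comp, Category.assoc, reassoc_of% P.orthogonal q hq, zero_comp]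
  · simp

lemma trace_comp_trace {X Z : A.EquivariantObject} (a : X.obj ⟶ V) (b : V ⟶ Z.obj) :
    trace (a ≫ P.incl) ≫ trace (P.eval ≫ b) = trace (a ≫ b) := by
  rw [trace_comp, Category.assoc, incl_trace]

/-- The mirror image of `orthogonal`, obtained by applying `T q` to the relation at `q⁻¹`. -/
lemma orthogonal' (q : Q) (hq : q ≠ 1) : (A.T q).map P.incl ≫ (Y.u q).hom ≫ P.eval = 0 := by
  have h := congrArg (A.T q).map (P.orthogonal q⁻¹ (inv_ne_one.2 hq)) =≫
    (A.compIso (mul_inv_cancel q)).hom.app V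
  rw [Functor.map_comp, Functor.map_comp, Category.assoc, Category.assoc, compIso_naturality,
    u_inv_compIso_assoc, u_one_inv, ← unitHom_naturality, Functor.map_zero, zero_comp] at h
  rw [← cancel_mono (A.unitHom V)]
  simpa using h

lemma trace_incl_eval {Z : A.EquivariantObject} (b : Z.obj ⟶ V) :
    (trace (b ≫ P.incl)).hom ≫ P.eval = b := by
  rw [trace_hom, Preadditive.sum_comp, Finset.sum_eq_single 1, conj_one, Category.assoc,
    P.incl_eval, Category.comp_id]
  · intro q _ hq
    rw [conj, Functor.map_comp, Category.assoc, Category.assoc, Category.assoc, P.orthogonal' q hq,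
      comp_zero, comp_zero]
  · simp

include P in
-- The source of fullness: every equivariant morphism from an induced object is a trace, and traces
-- lift.
lemma eq_trace_of_hom {Z : A.EquivariantObject} (f : Y ⟶ Z) :
    trace (P.eval ≫ P.incl ≫ f.hom) = f := by
  rw [← Category.assoc, ← trace_comp, P.total, Category.id_comp]

include P in
lemma eq_trace_of_hom' {Z : A.EquivariantObject} (f : Z ⟶ Y) :
    trace (f.hom ≫ P.eval ≫ P.incl) = f := by
  rw [← comp_trace, P.total, Category.comp_id]

lemma eq_zero_of_trace_eval_comp {Z : A.EquivariantObject} {b : V ⟶ Z.obj}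
    (h : trace (P.eval ≫ b) = 0) : b = 0 := by
  rw [← P.incl_trace b, h, zero_hom, comp_zero]

lemma eq_zero_of_trace_comp_incl {Z : A.EquivariantObject} {b : Z.obj ⟶ V}
    (h : trace (b ≫ P.incl) = 0) : b = 0 := by
  rw [← P.trace_incl_eval b, h, zero_hom, zero_comp]

/-- The induced object is unique up to isomorphism. -/
def uniqueUpToIso {Z : A.EquivariantObject} (P' : Induction V Z) : Y ≅ Z where
  hom := trace (P.eval ≫ P'.incl)
  inv := trace (P'.eval ≫ P.incl)
  hom_inv_id := by rw [P'.trace_comp_trace, P.total]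
  inv_hom_id := by rw [P.trace_comp_trace, P'.total]

/-- Induction is compatible with isomorphisms. -/
def ofIso {W : C} (e : V ≅ W) : Induction W Y where
  incl := e.inv ≫ P.incl
  eval := P.eval ≫ e.hom
  incl_eval := by simp [reassoc_of% P.incl_eval]
  orthogonal q hq := by
    rw [Functor.map_comp, Category.assoc, reassoc_of% P.orthogonal q hq, zero_comp, comp_zero]
  total := by simp [P.total]

/-- The projection formula: inducing `V ⊗ Z.obj` is inducing `V` and tensoring with `Z`. -/
def tensorRight [MonoidalPreadditive C] (Z : A.EquivariantObject) :
    Induction (V ⊗ Z.obj) (Y ⊗ Z) where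
  incl := P.incl ▷ Z.obj
  eval := P.eval ▷ Z.obj
  incl_eval := by
    refine (comp_whiskerRight _ _ _).symm.trans ?_
    rw [P.incl_eval, id_whiskerRight]
  orthogonal q hq := by
    change P.incl ▷ Z.obj ≫ (((Y.u q).inv ⊗ₘ (Z.u q).inv) ≫ μ (A.T q) Y.obj Z.obj) ≫
      (A.T q).map (P.eval ▷ Z.obj) = 0
    rw [Category.assoc, ← μ_natural_left, ← tensorHom_id, ← tensorHom_id,
      tensorHom_comp_tensorHom_assoc, tensorHom_comp_tensorHom_assoc, Category.assoc,
      P.orthogonal q hq, MonoidalPreadditive.zero_tensor, zero_comp]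
  total := by
    refine Eq.trans ?_ ((trace_whiskerRight (P.eval ≫ P.incl) Z).trans ?_)
    · exact congrArg _ (comp_whiskerRight _ _ _).symm
    · rw [P.total]
      exact id_whiskerRight _ _

end

variable {D : Type u₂} [Category.{v₂} D] {Φ : D ⥤ A.EquivariantObject} [Φ.Faithful]
  {R : C → D} (P : ∀ V : C, Induction V (Φ.obj (R V)))
  (hΦ : ∀ {V W : D} (a : (Φ.obj V).obj ⟶ (Φ.obj W).obj), ∃ g, Φ.map g = trace a)

/-- Induction, as a functor on the underlying category. -/
def functor : C ⥤ D where
  obj := R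
  map {V W} b := (hΦ ((P V).eval ≫ b ≫ (P W).incl)).choose
  map_id V := Φ.map_injective (by
    rw [(hΦ _).choose_spec, Category.id_comp, (P V).total, CategoryTheory.Functor.map_id])
  map_comp {V W U} b b' := Φ.map_injective (by
    rw [Functor.map_comp, (hΦ _).choose_spec, (hΦ _).choose_spec, (hΦ _).choose_spec,
      ← Category.assoc _ b, trace_comp_trace (P W)]
    simp only [Category.assoc])

lemma map_functor_map {V W : C} (b : V ⟶ W) :
    Φ.map ((functor P hΦ).map b) = trace ((P V).eval ≫ b ≫ (P W).incl) :=
  (hΦ _).choose_spec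

section

variable [Preadditive D] [Φ.Additive]

lemma functor_additive : (functor P hΦ).Additive where
  map_add {V W b b'} := Φ.map_injective (by
    refine (map_functor_map P hΦ _).trans (Eq.trans ?_ (Φ.map_add).symm)
    refine Eq.trans ?_ (congrArg₂ (· + ·) (map_functor_map P hΦ b) (map_functor_map P hΦ b')).symm
    rw [Preadditive.add_comp, Preadditive.comp_add]
    exact trace_add _ _)

lemma functor_linear [Linear k D] [Φ.Linear k] : (functor P hΦ).Linear k where
  map_smul {V W} b a := Φ.map_injective (by
    refine (map_functor_map P hΦ _).trans (Eq.trans ?_ (Φ.map_smul a _).symm)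
    refine Eq.trans ?_ (congrArg (a • ·) (map_functor_map P hΦ b)).symm
    rw [Linear.smul_comp, Linear.comp_smul]
    exact trace_smul _ _)

end

variable [MonoidalPreadditive C]

/-- Induction after restriction is the tensor product with the object induced from the unit. -/
def projectionFormula (Y : A.EquivariantObject) :
    Φ.obj (R Y.obj) ≅ Φ.obj (R (𝟙_ C)) ⊗ Y :=
  (P Y.obj).uniqueUpToIso (((P (𝟙_ C)).tensorRight Y).ofIso (λ_ Y.obj))

/-- Both sides are traces starting with the same evaluation at `Y`; it remains to compare two
morphisms out of `Y.obj`, by naturality of the unitor. -/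
lemma projectionFormula_naturality {Y Z : A.EquivariantObject} (f : Y ⟶ Z) :
    trace ((P Y.obj).eval ≫ f.hom ≫ (P Z.obj).incl) ≫ (projectionFormula P Z).hom =
      (projectionFormula P Y).hom ≫ Φ.obj (R (𝟙_ C)) ◁ f := by
  rw [← Category.assoc]
  refine ((P Z.obj).trace_comp_trace _ _).trans ((trace_comp _ _).trans ?_).symm
  congr 1
  rw [Category.assoc, Category.assoc]
  congr 1
  change ((λ_ Y.obj).inv ≫ (P (𝟙_ C)).incl ▷ Y.obj) ≫ (Φ.obj (R (𝟙_ C))).obj ◁ f.hom =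
    f.hom ≫ (λ_ Z.obj).inv ≫ (P (𝟙_ C)).incl ▷ Z.obj
  rw [Category.assoc, ← whisker_exchange, leftUnitor_inv_naturality_assoc]

/-- If all objects are induced from objects of `D` and all traces lift to `D`, then `D` presents
the equivariantization. -/
def presentation [MonoidalLinear k C] [IsIdempotentComplete C]
    (hreg : ∀ {X Y : C} (f : X ⟶ Y), ∃ r, f ≫ r ≫ f = f) (h1 : 𝟙 (𝟙_ C) ≠ 0)
    [Preadditive D] [Linear k D] [MonoidalCategory D] [MonoidalPreadditive D] [MonoidalLinear k D]
    [Φ.Additive] [Φ.Linear k] [Φ.Monoidal] : Presentation k Φ where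
  X := R (𝟙_ C)
  -- `e` and `i` correspond under Frobenius reciprocity to the identity of the unit, up to `ε Φ` and
  -- `η Φ`, hence are nonzero.
  e := (hΦ ((P (𝟙_ C)).eval ≫ (ε Φ).hom)).choose
  i := (hΦ ((η Φ).hom ≫ (P (𝟙_ C)).incl)).choose
  e_ne_zero h := h1 (by
    have h' := (hΦ ((P (𝟙_ C)).eval ≫ (ε Φ).hom)).choose_spec
    rw [h, Functor.map_zero] at h'
    have h₂ : (ε Φ).hom = 0 := (P (𝟙_ C)).eq_zero_of_trace_eval_comp h'.symm
    exact (congrArg Hom.hom (Functor.Monoidal.ε_η Φ)).symm.trans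
      ((congrArg (· ≫ _) h₂).trans zero_comp))
  i_ne_zero h := h1 (by
    have h' := (hΦ ((η Φ).hom ≫ (P (𝟙_ C)).incl)).choose_spec
    rw [h, Functor.map_zero] at h'
    have h₂ : (η Φ).hom = 0 := (P (𝟙_ C)).eq_zero_of_trace_comp_incl h'.symm
    exact (congrArg Hom.hom (Functor.Monoidal.ε_η Φ)).symm.trans
      ((congrArg (_ ≫ ·) h₂).trans comp_zero))
  J := forget A ⋙ functor P hΦ
  additive := by
    have := functor_additive P hΦ
    infer_instance
  linear := by
    have := functor_additive P hΦ
    have := functor_linear P hΦ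
    infer_instance
  θ := NatIso.ofComponents (fun Y => projectionFormula P Y) fun {Y Z} f => by
    refine Eq.trans ?_ (projectionFormula_naturality P f)
    exact congrArg (· ≫ _) (map_functor_map P hΦ f.hom)
  full_from Y V f := by
    obtain ⟨g, hg⟩ := hΦ (V := R Y.obj) (W := V) ((P Y.obj).eval ≫ (P Y.obj).incl ≫ f.hom)
    exact ⟨g, hg.trans ((P Y.obj).eq_trace_of_hom _)⟩
  full_to V Y f := by
    obtain ⟨g, hg⟩ := hΦ (V := V) (W := R Y.obj) (f.hom ≫ (P Y.obj).eval ≫ (P Y.obj).incl)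
    exact ⟨g, hg.trans ((P Y.obj).eq_trace_of_hom' _)⟩
  -- The contraction exists only between underlying objects, which suffices because `J` factors
  -- through the forgetful functor.
  contraction {Y₁ Y₂ Y₃} f g w _ h := by
    have := functor_additive P hΦ
    obtain ⟨a, b, hab⟩ := exists_contraction hreg f g w h
    refine ⟨(functor P hΦ).map a, (functor P hΦ).map b, ?_⟩
    have := congrArg (functor P hΦ).map hab
    rw [Functor.map_add, Functor.map_comp, Functor.map_comp, CategoryTheory.Functor.map_id] at this
    exact this

end Induction

end SymmetricAction

end

end TensorEnvelope

namespace TensorEnvelope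

open CategoryTheory MonoidalCategory Limits Functor.LaxMonoidal Functor.OplaxMonoidal

noncomputable section

set_option linter.unusedSectionVars false

/-! ### Regularity in finite-dimensional algebras -/

section FiniteDimensionalAlgebras

variable (k : Type u) [Field k] {R : Type v} [Ring R] [Algebra k R] [Module.Finite k R]

include k in
/-- An element of a finite-dimensional algebra is strongly π-regular. -/
lemma exists_pow_eq_pow_mul (x : R) :
    ∃ (n : ℕ) (z : R), Commute x z ∧ x ^ (n + 1) = x ^ (n + 1) * x ^ (n + 1) * z := by
  -- In the commutative Artinian algebra `k[x]` the ideals generated by the powers of `x` stabilise.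
  let S := Algebra.adjoin k {x}
  have : IsMulCommutative S := Algebra.isMulCommutative_adjoin k (by
    rintro _ rfl _ rfl
    rfl)
  have : IsArtinianRing S := IsArtinianRing.of_finite k S
  let X : S := ⟨x, Algebra.self_mem_adjoin_singleton k x⟩
  obtain ⟨n, y, hy⟩ := IsArtinian.exists_pow_succ_smul_dvd X (1 : S)
  rw [smul_eq_mul, smul_eq_mul, mul_one] at hy
  have h : ∀ m, X ^ n = X ^ (n + m) * y ^ m := fun m => by
    induction m with
    | zero => simp
    | succ m ih =>
      have h₁ : X ^ (n + m) = X ^ m * (X ^ (n + 1) * y) := by rw [hy]; ring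
      rw [h₁] at ih
      exact ih.trans (by ring)
  have h' : X ^ (n + 1) = X ^ (n + 1) * X ^ (n + 1) * y ^ (n + 1) := by
    calc X ^ (n + 1) = X ^ n * X := pow_succ _ _
      _ = X ^ (n + (n + 1)) * y ^ (n + 1) * X := by rw [← h]
      _ = _ := by ring
  refine ⟨n, y ^ (n + 1), ?_, congrArg Subtype.val h'⟩
  exact congrArg Subtype.val (mul_comm X (y ^ (n + 1)))

/-- A semisimple ring is von Neumann regular. -/
lemma exists_mul_mul_eq_of_isSemisimpleRing {R : Type v} [Ring R] [IsSemisimpleRing R] (x : R) :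
    ∃ y, x * y * x = x := by
  -- The left ideal `R x` equals `R e` for an idempotent `e`. Writing `e = y x` and `x = r e` gives
  -- `x y x = r e e = x`.
  obtain ⟨e, he, hx⟩ := IsSemisimpleRing.ideal_eq_span_idempotent (Ideal.span {x})
  obtain ⟨y, hy⟩ := Ideal.mem_span_singleton'.1 (hx ▸ Ideal.mem_span_singleton_self e)
  obtain ⟨r, hr⟩ := Ideal.mem_span_singleton'.1 (hx ▸ Ideal.mem_span_singleton_self x)
  refine ⟨y, ?_⟩
  rw [mul_assoc, hy, ← hr, mul_assoc, he.eq]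

include k in
/-- A finite-dimensional algebra is von Neumann regular modulo nilpotent elements. -/
lemma exists_isNilpotent_mul_sub (x : R) : ∃ y, ∀ z, IsNilpotent (z * (x * y * x - x)) := by
  have : IsArtinianRing R := IsArtinianRing.of_finite k R
  -- The quotient by the radical is semisimple, and the radical is a nilpotent ideal.
  obtain ⟨y, hy⟩ := exists_mul_mul_eq_of_isSemisimpleRing (Ideal.Quotient.mk (Ring.jacobson R) x)
  obtain ⟨y, rfl⟩ := Ideal.Quotient.mk_surjective y
  rw [← map_mul, ← map_mul, Ideal.Quotient.eq] at hy
  obtain ⟨n, hn⟩ := IsSemiprimaryRing.isNilpotent (R := R)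
  refine ⟨y, fun z => ⟨n, ?_⟩⟩
  have := Ideal.pow_mem_pow (Ideal.mul_mem_left _ z hy) n
  rw [hn] at this
  exact this

end FiniteDimensionalAlgebras

/-! ### Regularity modulo negligible morphisms, and smallness of Rep -/

section Representations

variable (k : Type u) [Field k] (G : Type v) [Group G]

instance (V : FDRep k G) : Module.Finite k (End V) :=
  inferInstanceAs (FiniteDimensional k (V ⟶ V))

variable {G} in
/-- Taking the underlying linear map, as a ring homomorphism. -/
def linRingHom (V : FDRep k G) : End V →+* Module.End k V where
  toFun f := lin k (V := V) (W := V) f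
  map_one' := rfl
  map_mul' _ _ := rfl
  map_zero' := rfl
  map_add' _ _ := rfl

/-- Representations are von Neumann regular modulo negligible morphisms. -/
lemma exists_sub_mem_negligible {V W : FDRep k G} (f : V ⟶ W) :
    ∃ r : W ⟶ V, f ≫ r ≫ f - f ∈ (negligible k G).hom V W := by
  -- Placing `f` off the diagonal of `V ⊞ W` reduces a morphism between two objects to an element of
  -- one finite-dimensional algebra.
  let x : End (V ⊞ W) := (biprod.fst ≫ f ≫ biprod.inr : V ⊞ W ⟶ V ⊞ W)
  obtain ⟨y, hy⟩ := exists_isNilpotent_mul_sub k x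
  let y' : V ⊞ W ⟶ V ⊞ W := y
  let x' : V ⊞ W ⟶ V ⊞ W := x
  have h : x' ≫ y' ≫ x' - x' ∈ (negligible k G).hom _ _ := fun z =>
    (LinearMap.isNilpotent_trace_of_isNilpotent ((hy z).map (linRingHom k _))).eq_zero
  refine ⟨biprod.inr ≫ y' ≫ biprod.fst, ?_⟩
  have h' := (negligible k G).comp_left biprod.inl ((negligible k G).comp_right biprod.snd h)
  have e : biprod.inl ≫ (x' ≫ y' ≫ x' - x') ≫ biprod.snd =
      f ≫ (biprod.inr ≫ y' ≫ biprod.fst) ≫ f - f := by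
    simp [x', x, Preadditive.sub_comp, Preadditive.comp_sub]
  rwa [e] at h'

/-- A basis reduces a representation to its dimension and a matrix for each element of `G`, and
finiteness of `G` keeps these data small. -/
lemma essentiallySmall_FDRep [Finite G] : EssentiallySmall.{u} (FDRep k G) := by
  let S := Σ n : ℕ, G → ((Fin n → k) →ₗ[k] (Fin n → k))
  have hp : ∀ V : FDRep k G, ∃ (p : S) (e : V ≃ₗ[k] (Fin p.1 → k)),
      ∀ g, e.toLinearMap ∘ₗ V.ρ g = p.2 g ∘ₗ e.toLinearMap := fun V =>
    let e := (Module.finBasis k V).equivFun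
    ⟨⟨Module.finrank k V, fun g => e.toLinearMap ∘ₗ V.ρ g ∘ₗ e.symm.toLinearMap⟩, e, fun g => by
      ext
      simp⟩
  choose p e he using hp
  have key : ∀ (p : S) (V W : FDRep k G) (e : V ≃ₗ[k] (Fin p.1 → k)) (e' : W ≃ₗ[k] (Fin p.1 → k)),
      (∀ g, e.toLinearMap ∘ₗ V.ρ g = p.2 g ∘ₗ e.toLinearMap) →
      (∀ g, e'.toLinearMap ∘ₗ W.ρ g = p.2 g ∘ₗ e'.toLinearMap) → Nonempty (V ≅ W) :=
    fun p V W e e' h h' => by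
      have hc : ∀ g, (e.trans e'.symm).toLinearMap ∘ₗ V.ρ g =
          W.ρ g ∘ₗ (e.trans e'.symm).toLinearMap := fun g => by
        ext v
        apply e'.injective
        have h₁ := LinearMap.congr_fun (h g) v
        have h₂ := LinearMap.congr_fun (h' g) (e'.symm (e v))
        simp at h₁ h₂ ⊢
        rw [h₁, h₂]
      have hc' : ∀ g, (e'.trans e.symm).toLinearMap ∘ₗ W.ρ g =
          V.ρ g ∘ₗ (e'.trans e.symm).toLinearMap := fun g => by
        ext v
        apply e.injective
        have h₁ := LinearMap.congr_fun (h' g) v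
        have h₂ := LinearMap.congr_fun (h g) (e.symm (e' v))
        simp at h₁ h₂ ⊢
        rw [h₁, h₂]
      exact ⟨⟨ofLin k _ hc, ofLin k _ hc',
        Action.Hom.ext (FGModuleCat.hom_ext (LinearMap.ext fun v =>
          show e.symm (e' (e'.symm (e v))) = v by simp)),
        Action.Hom.ext (FGModuleCat.hom_ext (LinearMap.ext fun v =>
          show e'.symm (e (e.symm (e' v))) = v by simp))⟩⟩
  rw [essentiallySmall_iff]
  refine ⟨small_of_injective (β := S)
    (f := fun V : Skeleton (FDRep k G) => p ((fromSkeleton _).obj V)) fun V W h => ?_,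
      inferInstance⟩
  have : ∀ (p' : S) (V : FDRep k G), p V = p' → ∃ e : V ≃ₗ[k] (Fin p'.1 → k),
      ∀ g, e.toLinearMap ∘ₗ V.ρ g = p'.2 g ∘ₗ e.toLinearMap := by
    rintro _ V rfl
    exact ⟨e V, he V⟩
  obtain ⟨e₁, h₁⟩ := this _ _ h
  obtain ⟨i⟩ := key _ _ _ _ _ h₁ (he _)
  exact skeleton_skeletal _ ⟨(fromSkeleton _).preimageIso i⟩

end Representations

/-! ### Quotients by tensor ideals as pseudo-tensor categories -/

namespace TensorIdeal

variable {k : Type u} [Field k] {C : Type u₁} [Category.{v₁} C] [Preadditive C] [Linear k C]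
  [MonoidalCategory C] (I : TensorIdeal k C)

lemma essentiallySmall [EssentiallySmall.{v₁} C] : EssentiallySmall.{v₁} I.Quot := by
  rw [essentiallySmall_iff]
  refine ⟨?_, inferInstance⟩
  refine small_of_surjective (α := Skeleton C)
    (f := fun X => toSkeleton (I.proj.obj ((fromSkeleton C).obj X))) fun Y => ?_
  exact ⟨toSkeleton ((fromSkeleton I.Quot).obj Y).as,
    toSkeleton_eq_iff.2 ⟨I.proj.mapIso (fromSkeletonToSkeletonIso _)⟩⟩

lemma hasFiniteBiproducts [HasFiniteBiproducts C] : HasFiniteBiproducts I.Quot where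
  out n := ⟨fun F => by
    have := HasFiniteBiproducts.out (C := C) n
    exact inferInstanceAs (HasBiproduct fun i => I.proj.obj (F i).as)⟩

/-- Idempotents lift modulo a tensor ideal. -/
lemma isIdempotentComplete [IsIdempotentComplete C] (hfin : ∀ X Y : C, Module.Finite k (X ⟶ Y)) :
    IsIdempotentComplete I.Quot where
  idempotents_split X p hp := by
    obtain ⟨x, rfl⟩ := I.proj_map_surj p
    have : Module.Finite k (End X.as) := hfin _ _
    obtain ⟨n, z, hxz, hn⟩ := exists_pow_eq_pow_mul k (show End X.as from x)
    let F := I.proj.mapEnd X.as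
    have hF : IsIdempotentElem (F x) := hp
    have hFn : F x ^ (n + 1) = F x := hF.pow_succ_eq n
    -- From `x ^ (n + 1) = x ^ (n + 1) * x ^ (n + 1) * z` and the commutation of `z` with `x`, this
    -- element is idempotent. Modulo the ideal all positive powers of `x` agree, so its class is
    -- that of `x`.
    let E : End X.as := (show End X.as from x) ^ (n + 1) * z
    have hE : E * E = E := by
      have hzx := (hxz.pow_left (n + 1)).eq
      calc _ = (show End X.as from x) ^ (n + 1) * (z * (show End X.as from x) ^ (n + 1)) * z := by
            simp only [E, mul_assoc]
        _ = E := by rw [← hzx, ← mul_assoc, ← hn]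
    have hFE : F E = F x := by
      have := congrArg F hn
      rw [map_mul, map_mul, map_pow, hFn, hF.eq] at this
      rw [map_mul, map_pow, hFn, ← this]
    obtain ⟨Y, i, e, hie, hei⟩ := IsIdempotentComplete.idempotents_split X.as E hE
    refine ⟨I.proj.obj Y, I.proj.map i, I.proj.map e, ?_, ?_⟩
    · rw [← Functor.map_comp, hie, CategoryTheory.Functor.map_id]
    · rw [← Functor.map_comp, hei]
      exact hFE

end TensorIdeal

section Representations

variable (k : Type u) [Field k] {G : Type v} [Group G] [Finite G]

/-- The quotient of the category of representations by a proper tensor ideal is a pseudo-tensor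
category. -/
lemma isPseudoTensorCategory_quot (I : TensorIdeal k (FDRep k G))
    (hI : 𝟙 (𝟙_ (FDRep k G)) ∉ I.hom _ _) : IsPseudoTensorCategory k I.Quot := by
  have hr : ∀ X : I.Quot, HasRightDual X := fun X =>
    { rightDual := I.proj.obj (X.asᘁ)
      exact := exactPairingMap I.proj X.as (X.asᘁ) }
  have := essentiallySmall_FDRep k G
  have := Abelian.hasFiniteBiproducts (C := FDRep k G)
  refine
    { essentiallySmall := I.essentiallySmall
      hasFiniteBiproducts := I.hasFiniteBiproducts
      isIdempotentComplete := I.isIdempotentComplete fun _ _ => inferInstance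
      finite_hom := fun X Y =>
        Module.Finite.of_surjective (I.proj.mapLinearMap k (X := X.as) (Y := Y.as)) I.proj_map_surj
      bijective_unit := ⟨?_, fun f => ?_⟩
      hasLeftDual := fun X => ⟨BraidedCategory.hasLeftDualOfHasRightDual⟩
      hasRightDual := fun X => ⟨hr X⟩ }
  · refine (injective_iff_map_eq_zero (LinearMap.toSpanSingleton k _ (𝟙 (𝟙_ I.Quot)))).2 fun a ha => ?_
    by_contra hne
    refine hI (((I.hom _ _).smul_mem_iff hne).1 ?_)
    have : I.proj.map (a • 𝟙 (𝟙_ (FDRep k G))) = I.proj.map 0 := ha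
    rwa [I.proj_map_eq_iff, sub_zero] at this
  · obtain ⟨f, rfl⟩ := I.proj_map_surj f
    let φ : k →ₗ[k] k := lin k (V := 𝟙_ (FDRep k G)) (W := 𝟙_ (FDRep k G)) f
    have : f = φ 1 • 𝟙 (𝟙_ (FDRep k G)) := Action.Hom.ext (FGModuleCat.hom_ext (by
      change φ = φ 1 • LinearMap.id
      ext
      simp))
    refine ⟨φ 1, ?_⟩
    rw [this]
    rfl

end Representations

end

end TensorEnvelope

namespace TensorEnvelope

open CategoryTheory MonoidalCategory Limits Functor.LaxMonoidal Functor.OplaxMonoidal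

noncomputable section

set_option linter.unusedSectionVars false

/-! ### Induced representations as spaces of functions -/

section InducedRepresentations

variable (k : Type u) [Field k] {G : Type v} [Group G] (N : Subgroup G)

section

variable {V : Type w} [AddCommGroup V] [Module k V] (ρ : Representation k N V)

/-- The space of the representation of `G` induced from the representation `V` of `N`: the functions
`f : G → V` with `f (g n) = n⁻¹ f g`. -/
def inducedSpace : Submodule k (G → V) where
  carrier := {f | ∀ (g : G) (n : N), f (g * n) = ρ n⁻¹ (f g)}
  add_mem' hf hf' g n := by simp [hf g n, hf' g n]
  zero_mem' g n := by simp
  smul_mem' a f hf g n := by simp [hf g n]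

/-- The induced representation: `(h f) g = f (h⁻¹ g)`. -/
def inducedRep : Representation k G (inducedSpace k N ρ) where
  toFun h :=
    { toFun f := ⟨fun g => f.1 (h⁻¹ * g), fun g n => by
        simpa only [mul_assoc] using f.2 (h⁻¹ * g) n⟩
      map_add' _ _ := rfl
      map_smul' _ _ := rfl }
  map_one' := by
    ext f g
    simp
  map_mul' h h' := by
    ext f g
    simp [mul_assoc]

/-- The evaluation of a function at the identity. -/
def inducedEval : inducedSpace k N ρ →ₗ[k] V where
  toFun f := f.1 1
  map_add' _ _ := rfl
  map_smul' _ _ := rfl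

open Classical in
/-- The functions supported on `N`. -/
def inducedIncl : V →ₗ[k] inducedSpace k N ρ where
  toFun v := ⟨fun g => if h : g ∈ N then ρ ⟨g, h⟩⁻¹ v else 0, fun g n => by
    by_cases h : g ∈ N
    · have h' : g * n ∈ N := N.mul_mem h n.2
      beta_reduce
      rw [dif_pos h, dif_pos h', ← Module.End.mul_apply, ← map_mul, ← mul_inv_rev]
      rfl
    · have h' : g * n ∉ N := fun h' => h ((N.mul_mem_cancel_right n.2).1 h')
      beta_reduce
      rw [dif_neg h, dif_neg h', map_zero]⟩
  map_add' v v' := by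
    ext g
    by_cases h : g ∈ N <;> simp [h]
  map_smul' a v := by
    ext g
    by_cases h : g ∈ N <;> simp [h]

lemma inducedIncl_of_mem (v : V) {g : G} (h : g ∈ N) :
    (inducedIncl k N ρ v).1 g = ρ ⟨g, h⟩⁻¹ v := dif_pos h

lemma inducedIncl_of_notMem (v : V) {g : G} (h : g ∉ N) : (inducedIncl k N ρ v).1 g = 0 := dif_neg h

lemma inducedEval_comm (n : N) :
    inducedEval k N ρ ∘ₗ inducedRep k N ρ n = ρ n ∘ₗ inducedEval k N ρ := by
  ext f
  have := f.2 1 n⁻¹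
  rw [inv_inv] at this
  change f.1 ((n : G)⁻¹ * 1) = ρ n (f.1 1)
  rw [← this]
  simp

lemma inducedIncl_comm (n : N) :
    inducedIncl k N ρ ∘ₗ ρ n = inducedRep k N ρ n ∘ₗ inducedIncl k N ρ := by
  ext v g
  change (inducedIncl k N ρ (ρ n v)).1 g = (inducedIncl k N ρ v).1 ((n : G)⁻¹ * g)
  by_cases h : g ∈ N
  · have h' : (n : G)⁻¹ * g ∈ N := N.mul_mem (N.inv_mem n.2) h
    rw [inducedIncl_of_mem k N ρ _ h, inducedIncl_of_mem k N ρ _ h', ← Module.End.mul_apply,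
      ← map_mul]
    congr 2
    ext
    simp
  · have h' : (n : G)⁻¹ * g ∉ N := fun h' => h ((N.mul_mem_cancel_left (N.inv_mem n.2)).1 h')
    rw [inducedIncl_of_notMem k N ρ _ h, inducedIncl_of_notMem k N ρ _ h']

lemma inducedEval_incl : inducedEval k N ρ ∘ₗ inducedIncl k N ρ = LinearMap.id := by
  ext v
  refine (inducedIncl_of_mem k N ρ v N.one_mem).trans ?_
  have : (⟨1, N.one_mem⟩ : N)⁻¹ = 1 := inv_one
  rw [this, map_one]
  rfl

/-- Translation by `g` moves the support from `N` to the coset `g N`, which does not contain `1`. -/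
lemma inducedEval_rep_incl {g : G} (h : g ∉ N) :
    inducedEval k N ρ ∘ₗ inducedRep k N ρ g ∘ₗ inducedIncl k N ρ = 0 := by
  ext v
  refine inducedIncl_of_notMem k N ρ v fun h' => h ?_
  simpa using h'

/-- The term at `q` restricts a function to the coset `q`, so at `g` only the coset of `g`
contributes. -/
lemma sum_inducedIncl_eval [N.Normal] [Fintype (G ⧸ N)] (s : G ⧸ N → G)
    (hs : ∀ q : G ⧸ N, (s q : G ⧸ N) = q) :
    ∑ q : G ⧸ N, inducedRep k N ρ (s q) ∘ₗ (inducedIncl k N ρ ∘ₗ inducedEval k N ρ) ∘ₗ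
      inducedRep k N ρ (s q)⁻¹ = LinearMap.id := by
  ext f g
  rw [LinearMap.sum_apply, Submodule.coe_sum, Finset.sum_apply, Finset.sum_eq_single (g : G ⧸ N)]
  · have h : (s (g : G ⧸ N))⁻¹ * g ∈ N := by rw [← QuotientGroup.eq, hs]
    refine (inducedIncl_of_mem k N ρ _ h).trans ?_
    rw [← inv_inv (⟨_, h⟩ : N)]
    change ρ _⁻¹⁻¹ (f.1 ((s (g : G ⧸ N))⁻¹⁻¹ * 1)) = f.1 g
    rw [inv_inv (⟨_, h⟩ : N), ← f.2]
    simp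
  · intro q _ hq
    refine inducedIncl_of_notMem k N ρ _ fun h => hq ?_
    rw [← QuotientGroup.eq, hs] at h
    exact h
  · simp

end

end InducedRepresentations

/-! ### The envelope functor is presented by induction -/

section Envelope

variable (k : Type u) [Field k] {G : Type v} [Group G] (N : Subgroup G) [N.Normal]
  (s : G ⧸ N → G) (hs : ∀ q : G ⧸ N, (s q : G ⧸ N) = q)

/-- The ideal is by definition the kernel of restriction followed by semisimplification. -/
instance faithful_envelopeFunctor : (envelopeFunctor k N s hs).Faithful where
  map_injective {V W f g} h := by
    obtain ⟨f, rfl⟩ := (idealOf k N).proj_map_surj f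
    obtain ⟨g, rfl⟩ := (idealOf k N).proj_map_surj g
    have h' : (negligible k N).proj.map ((resFunctor k N.subtype).map f) =
      (negligible k N).proj.map ((resFunctor k N.subtype).map g) :=
        congrArg SymmetricAction.EquivariantObject.Hom.hom h
    rw [TensorIdeal.proj_map_eq_iff] at h' ⊢
    exact h'

variable [Fintype (G ⧸ N)]

include hs in
/-- The sum of the conjugates of an `N`-linear map is `G`-linear. -/
lemma sum_conj_comm {V W : Type w} [AddCommGroup V] [Module k V] [AddCommGroup W] [Module k W]
    (ρ : Representation k G V) (σ : Representation k G W) (a : V →ₗ[k] W)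
    (ha : ∀ n : N, a ∘ₗ ρ n = σ n ∘ₗ a) (g : G) :
    (∑ q : G ⧸ N, σ (s q) ∘ₗ a ∘ₗ ρ (s q)⁻¹) ∘ₗ ρ g =
      σ g ∘ₗ ∑ q : G ⧸ N, σ (s q) ∘ₗ a ∘ₗ ρ (s q)⁻¹ := by
  -- As `a` is `N`-linear, the conjugate `c x` depends only on the coset of `x`; multiplication by
  -- `g` then merely permutes the summands.
  let c : G → (V →ₗ[k] W) := fun x => σ x ∘ₗ a ∘ₗ ρ x⁻¹
  have hc : ∀ x y : G, (x : G ⧸ N) = y → c x = c y := fun x y h => by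
    ext v
    obtain ⟨n, rfl⟩ : ∃ n : N, x * n = y := ⟨⟨_, QuotientGroup.eq.1 h⟩, by simp⟩
    have h₁ := LinearMap.congr_fun (ha n) (ρ (x * n)⁻¹ v)
    simp only [LinearMap.comp_apply, ← Module.End.mul_apply, ← map_mul] at h₁
    simp only [c, LinearMap.comp_apply, map_mul σ, Module.End.mul_apply, ← h₁]
    congr 4
    group
  have hg : ∀ x y : G, σ x ∘ₗ c y = c (x * y) ∘ₗ ρ x := fun x y => by
    ext v
    simp only [c, LinearMap.comp_apply, ← Module.End.mul_apply, ← map_mul]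
    congr 4
    group
  change (∑ q, c (s q)) ∘ₗ ρ g = σ g ∘ₗ ∑ q, c (s q)
  have hq : ∀ q, σ g ∘ₗ c (s q) = c (s (g * q)) ∘ₗ ρ g := fun q => by
    rw [hg, hc (g * s q) (s (g * q)) (by rw [hs, QuotientGroup.mk_mul, hs])]
  ext v
  rw [LinearMap.comp_apply, LinearMap.comp_apply, LinearMap.sum_apply, LinearMap.sum_apply, map_sum,
    ← Equiv.sum_comp (Equiv.mulLeft (g : G ⧸ N))]
  exact Finset.sum_congr rfl fun q _ => (LinearMap.congr_fun (hq q) v).symm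

lemma lin_sum {H : Type w} [Group H] {V W : FDRep k H} {ι : Type*} [Fintype ι] (f : ι → (V ⟶ W)) :
    lin k (∑ i, f i) = ∑ i, lin k (f i) :=
  map_sum (AddMonoidHom.mk' (fun f : V ⟶ W => lin k f) fun _ _ => rfl) f _

/-- The sum of the conjugates of an `N`-linear map. -/
def average {V W : FDRep k G}
    (a : (resFunctor k N.subtype).obj V ⟶ (resFunctor k N.subtype).obj W) : V ⟶ W :=
  let b : V →ₗ[k] W := (lin k a :)
  ofLin k (∑ q : G ⧸ N, W.ρ (s q) ∘ₗ b ∘ₗ V.ρ (s q)⁻¹)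
    (sum_conj_comm k N s hs V.ρ W.ρ b fun n => lin_comm k a n)

open SymmetricAction EquivariantObject

/-- Traces lift: the conjugates in the equivariantization are the classes of the conjugates by coset
representatives, whose sum is already `G`-linear before passing to the quotient. -/
lemma map_average {V W : FDRep k G}
    (a : (resFunctor k N.subtype).obj V ⟶ (resFunctor k N.subtype).obj W) :
    (envelopeFunctor k N s hs).map ((idealOf k N).proj.map (average k N s hs a)) =
      trace (A := semisimpleAction k N s hs) (Y := (toEquivariant k N s hs).obj V)
        (Z := (toEquivariant k N s hs).obj W) ((negligible k N).proj.map a) := by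
  refine EquivariantObject.hom_ext ?_
  have h : (resFunctor k N.subtype).map (average k N s hs a) =
      ∑ q : G ⧸ N, (resTwist k N (s q)).inv.app V ≫ (twist k N (s q)).map a ≫
        (resTwist k N (s q)).hom.app W := by
    refine Action.Hom.ext (FGModuleCat.hom_ext ?_)
    exact (lin_sum k fun q : G ⧸ N => (resTwist k N (s q)).inv.app V ≫ (twist k N (s q)).map a ≫
      (resTwist k N (s q)).hom.app W).symm
  refine (congrArg (negligible k N).proj.map h).trans ?_
  rw [Functor.map_sum]
  rfl

lemma exists_map_eq_trace {V W : (idealOf k N).Quot}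
    (a : ((envelopeFunctor k N s hs).obj V).obj ⟶ ((envelopeFunctor k N s hs).obj W).obj) :
    ∃ g, (envelopeFunctor k N s hs).map g = trace a := by
  obtain ⟨a, rfl⟩ := (negligible k N).proj_map_surj a
  exact ⟨_, map_average k N s hs a⟩

/-- Induction data from linear maps. -/
def inductionOfLinearMap {V : FDRep k N} {P : FDRep k G} (i : V →ₗ[k] P) (r : P →ₗ[k] V)
    (hi : ∀ n : N, i ∘ₗ V.ρ n = P.ρ n ∘ₗ i) (hr : ∀ n : N, r ∘ₗ P.ρ n = V.ρ n ∘ₗ r)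
    (hir : r ∘ₗ i = LinearMap.id) (orth : ∀ g ∉ N, r ∘ₗ P.ρ g ∘ₗ i = 0)
    (total : ∑ q : G ⧸ N, P.ρ (s q) ∘ₗ (i ∘ₗ r) ∘ₗ P.ρ (s q)⁻¹ = LinearMap.id) :
    Induction (A := semisimpleAction k N s hs) ((negligible k N).proj.obj V)
      ((toEquivariant k N s hs).obj P) :=
  let incl : V ⟶ (resFunctor k N.subtype).obj P := ofLin k i hi
  let eval : (resFunctor k N.subtype).obj P ⟶ V := ofLin k r hr
  { incl := (negligible k N).proj.map incl
    eval := (negligible k N).proj.map eval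
    incl_eval := by
      have h : incl ≫ eval = 𝟙 V := Action.Hom.ext (FGModuleCat.hom_ext hir)
      exact congrArg (negligible k N).proj.map h
    orthogonal q hq := by
      have hq' : (s q)⁻¹ ∉ N := fun h => hq (by
        rw [← hs q, QuotientGroup.eq_one_iff]
        exact (N.inv_mem_iff).1 h)
      have h : incl ≫ (resTwist k N (s q)).inv.app P ≫ (twist k N (s q)).map eval = 0 :=
        Action.Hom.ext (FGModuleCat.hom_ext (orth _ hq'))
      exact (congrArg (negligible k N).proj.map h).trans (Functor.map_zero _ _ _)
    total := by
      have h : average k N s hs (eval ≫ incl) = 𝟙 P :=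
        Action.Hom.ext (FGModuleCat.hom_ext total)
      refine (map_average k N s hs (eval ≫ incl)).symm.trans ?_
      rw [h, CategoryTheory.Functor.map_id]
      exact CategoryTheory.Functor.map_id _ _ }

/-- The function space lies in a universe that also involves that of `G`, so the representation is
transported along a basis to a coordinate space over `k`. -/
lemma exists_induction [Finite G] (V : FDRep k N) : ∃ P : FDRep k G,
    Nonempty (Induction (A := semisimpleAction k N s hs) ((negligible k N).proj.obj V)
      ((toEquivariant k N s hs).obj P)) := by
  have : Module.Finite k (inducedSpace k N V.ρ) := inferInstance
  let e := (Module.finBasis k (inducedSpace k N V.ρ)).equivFun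
  let ρ : Representation k G (Fin (Module.finrank k (inducedSpace k N V.ρ)) → k) :=
    e.conjRingEquiv.toMonoidHom.comp (inducedRep k N V.ρ)
  have h₁ : ∀ g, ρ g ∘ₗ e.toLinearMap = e.toLinearMap ∘ₗ inducedRep k N V.ρ g := fun g => by
    ext1 f
    change e (inducedRep k N V.ρ g (e.symm (e f))) = _
    rw [e.symm_apply_apply]
    rfl
  have h₂ : ∀ g, e.symm.toLinearMap ∘ₗ ρ g = inducedRep k N V.ρ g ∘ₗ e.symm.toLinearMap := fun g => by
    refine LinearMap.ext fun f => ?_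
    exact e.symm_apply_apply _
  refine ⟨FDRep.of ρ, ⟨inductionOfLinearMap k N s hs (e.toLinearMap ∘ₗ inducedIncl k N V.ρ)
    (inducedEval k N V.ρ ∘ₗ e.symm.toLinearMap) ?_ ?_ ?_ ?_ ?_⟩⟩
  · intro n
    change _ = ρ n ∘ₗ _
    rw [← LinearMap.comp_assoc, h₁, LinearMap.comp_assoc, LinearMap.comp_assoc, inducedIncl_comm]
  · intro n
    change _ ∘ₗ ρ n = _
    rw [LinearMap.comp_assoc, h₂, ← LinearMap.comp_assoc, inducedEval_comm, LinearMap.comp_assoc]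
  · rw [LinearMap.comp_assoc, ← LinearMap.comp_assoc _ e.toLinearMap, LinearEquiv.symm_comp,
      LinearMap.id_comp, inducedEval_incl]
  · intro g hg
    change _ ∘ₗ ρ g ∘ₗ _ = _
    rw [← LinearMap.comp_assoc _ e.toLinearMap, h₁, LinearMap.comp_assoc, LinearMap.comp_assoc,
      ← LinearMap.comp_assoc _ e.toLinearMap, LinearEquiv.symm_comp, LinearMap.id_comp,
      inducedEval_rep_incl k N V.ρ hg]
  · refine LinearMap.ext fun f => ?_
    have h := congrArg e (LinearMap.congr_fun (sum_inducedIncl_eval k N V.ρ s hs) (e.symm f))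
    rw [LinearMap.sum_apply, map_sum, LinearMap.id_apply, e.apply_symm_apply] at h
    rw [LinearMap.sum_apply]
    refine (Finset.sum_congr rfl fun q _ => ?_).trans h
    have h₃ := LinearMap.congr_fun (h₂ (s q)⁻¹) f
    refine (LinearMap.congr_fun (h₁ (s q)) _).trans ?_
    change e (inducedRep k N V.ρ (s q) (inducedIncl k N V.ρ (inducedEval k N V.ρ
      (e.symm (ρ (s q)⁻¹ f))))) = _
    exact congrArg (fun x => e (inducedRep k N V.ρ (s q) (inducedIncl k N V.ρ
      (inducedEval k N V.ρ x)))) h₃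

variable [Finite G]

/-- The functor `Φ` is an abelian envelope. -/
theorem isAbelianEnvelope_envelopeFunctor :
    IsAbelianEnvelope.{u, u, u, v₃, max (u + 1) v, max (u + 1) v, u₃} k
      (envelopeFunctor k N s hs) := by
  have hreg : ∀ {X Y : Semisimplification k N} (f : X ⟶ Y), ∃ r, f ≫ r ≫ f = f := fun f => by
    obtain ⟨f, rfl⟩ := (negligible k N).proj_map_surj f
    obtain ⟨r, hr⟩ := exists_sub_mem_negligible k N f
    refine ⟨(negligible k N).proj.map r, ?_⟩
    have := ((negligible k N).proj_map_eq_iff _ _).2 hr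
    rw [Functor.map_comp, Functor.map_comp] at this
    exact this
  have hB : IsPseudoTensorCategory k (Semisimplification k N) :=
    isPseudoTensorCategory_quot k _ (negligible_unit k)
  have hA : IsPseudoTensorCategory k (idealOf k N).Quot :=
    isPseudoTensorCategory_quot k _ (negligible_unit k (G := N))
  have := hB.isIdempotentComplete
  choose R hR using exists_induction k N s hs
  exact (Induction.presentation (Φ := envelopeFunctor k N s hs) (R := fun V => ⟨R V.as⟩)
    (fun V => (hR V.as).some) (exists_map_eq_trace k N s hs) hreg
    (fun h => negligible_unit k (by
      have := ((negligible k N).proj_map_eq_iff (𝟙 (𝟙_ (FDRep k N))) 0).1 h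
      rwa [sub_zero] at this))).isAbelianEnvelope hA (isTensorCategory hB hreg)

end Envelope

end

end TensorEnvelope

theorem mainTheorem10 {k : Type u} [Field k] (p : ℕ) [Fact p.Prime] [CharP k p]
    {G : Type v} [Group G] [Finite G] (N : Subgroup G) [N.Normal]
    (s : G ⧸ N → G) (hs : ∀ q : G ⧸ N, (s q : G ⧸ N) = q) :
    TensorEnvelope.IsAbelianEnvelope.{u, u, u, v₃, max (u + 1) v, max (u + 1) v, u₃} k
      (TensorEnvelope.envelopeFunctor k N s hs) := by
  have := Fintype.ofFinite (G ⧸ N)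
  exact TensorEnvelope.isAbelianEnvelope_envelopeFunctor k N s hs
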